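/- Let $(M,\omega)$ be a connected compact symplectic manifold of dimension $2n$, with Liouville volume form $\mu=\omega^n/n!$ and $\operatorname{Vol}(M)=\int_M\mu$, and let $\pi:P\to M$ be a prequantum bundle: a $U(1)$-principal bundle with a connection form $\alpha\in\Omega^1(P,\mathbb R)$, i.e. $\alpha$ is $U(1)$-invariant and $\alpha(\partial_\theta)=1$ for the generator $\partial_\theta$ of the action, such that $d\alpha+\pi^*\omega=0$. The Hamiltonian vector field $X$ of $f$ is defined by $\omega(X,\cdot)+df=0$, and $f$ is called normalised if $\int_M f\mu=0$. Let $\mathcal P(\mathrm{Ham})$ be the group (for the pointwise product) of smooth paths $(\varphi_t)_{t\in[0,1]}$ of Hamiltonian diffeomorphisms of $M$ with $\varphi_0=\mathrm{id}$, i.e. smooth paths of symplectic diffeomorphisms whose velocity field is the Hamiltonian vector field of a smooth time-dependent function. Let $\mathcal P(\mathrm{Preq})$ be the group of smooth paths $(\gamma_t)_{t\in[0,1]}$, $\gamma_0=\mathrm{id}$, of diffeomorphisms of $P$ preserving $\alpha$ and commuting with the $U(1)$-action. Let $\widetilde{\mathrm{Ham}}$ and $\widetilde{\mathrm{Preq}}^0$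 be the quotients of these groups by smooth homotopy with fixed endpoints. Each $(\gamma_t)\in\mathcal P(\mathrm{Preq})$ lifts a unique path in $\mathcal P(\mathrm{Ham})$ and has a unique generating Hamiltonian: the smooth function $f:[0,1]\times M\to\mathbb R$ such that the velocity field of $(\gamma_t)$ is $X_t^{\mathrm{hor}}-(\pi^*f_t)\,\partial_\theta$, with $X_t^{\mathrm{hor}}$ the $\alpha$-horizontal lift of the Hamiltonian vector field $X_t$ of $f_t$. Each $(\varphi_t)\in\mathcal P(\mathrm{Ham})$ has a unique lift in $\mathcal P(\mathrm{Preq})$ whose generating Hamiltonian is normalised at each time. The following are well-defined group morphisms: - $\pi:\widetilde{\mathrm{Preq}}^0\to\widetilde{\mathrm{Ham}}$, sending the class of a path to the class of the path that it lifts; - $\mathrm{Cal}:\widetilde{\mathrm{Preq}}^0\to\mathbb R$, $\mathrm{Cal}([\gamma_t])=\int_0^1\bigl(\int_M f_t\,\mu\bigr)dt$, where $(f_t)$ is the generating Hamiltonian of $(\gamma_t)$; - $L:\widetilde{\mathrm{Ham}}\to\widetilde{\mathrm{Preq}}^0$, sending the class of a path to the class of its lift with normalised generating Hamiltonian; - $R:\mathbb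 R\to\widetilde{\mathrm{Preq}}^0$, sending $\tau$ to the class of the path $t\mapsto e^{it\tau}$ given by the $U(1)$-action. The maps $\Phi:\widetilde{\mathrm{Preq}}^0\to\widetilde{\mathrm{Ham}}\times\mathbb R$, $\Phi(g)=(\pi(g),\mathrm{Cal}(g))$, and $\Psi:\widetilde{\mathrm{Ham}}\times\mathbb R\to\widetilde{\mathrm{Preq}}^0$, $\Psi(h,\tau)=L(h)R(\tau)$, are group isomorphisms. They satisfy $\Phi(\Psi(h,\tau))=(h,-\operatorname{Vol}(M)\,\tau)$; that is, they are inverse of each other after rescaling the factor $\mathbb R$ by $-\operatorname{Vol}(M)$: $\Phi^{-1}(h,\tau)=L(h)\,R(-\tau/\operatorname{Vol}(M))$. -/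

import Mathlib

open Set MeasureTheory
open scoped Manifold ContDiff

namespace Prequantum

noncomputable section

/-! ### Differential forms on manifolds -/

section Forms

variable {E : Type*} [NormedAddCommGroup E] [NormedSpace ℝ E]
  {H : Type*} [TopologicalSpace H]

/-- A (not necessarily smooth) differential form of degree `k`. -/
abbrev DiffForm (I : ModelWithCorners ℝ E H)
    (X : Type*) [TopologicalSpace X] [ChartedSpace H X] (k : ℕ) : Type _ :=
  ∀ x : X, TangentSpace I x [⋀^Fin k]→L[ℝ] ℝ

variable {I : ModelWithCorners ℝ E H}
  {X : Type*} [TopologicalSpace X] [ChartedSpace H X] {k : ℕ}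

/-- The coordinate expression of a form in the preferred chart at `c`. -/
def DiffForm.inChart (η : DiffForm I X k) (c : X) (y : E) : E [⋀^Fin k]→L[ℝ] ℝ :=
  (η ((extChartAt I c).symm y)).compContinuousLinearMap
    (mfderiv 𝓘(ℝ, E) I (extChartAt I c).symm y)

/-- A form is smooth if its coordinate expressions are. -/
def DiffForm.IsSmooth (η : DiffForm I X k) : Prop :=
  ∀ c : X, ContDiffOn ℝ ∞ (η.inChart c) (extChartAt I c).target

/-- The exterior derivative; its value at `x` is computed in the preferred chart at `x`. -/
def DiffForm.d (η : DiffForm I X k) : DiffForm I X (k + 1) := fun x =>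
  (extDeriv (η.inChart x) (extChartAt I x x)).compContinuousLinearMap
    (mfderiv I 𝓘(ℝ, E) (extChartAt I x) x)

/-- `φ^* η = η`. -/
def DiffForm.PreservedBy (η : DiffForm I X k) (φ : X → X) : Prop :=
  ∀ x, (η (φ x)).compContinuousLinearMap (mfderiv I I φ x) = η x

theorem DiffForm.PreservedBy.one (η : DiffForm I X k) :
    η.PreservedBy (1 : Equiv.Perm X) := by
  intro x
  have : mfderiv I I ((1 : Equiv.Perm X) : X → X) x = ContinuousLinearMap.id ℝ _ :=
    mfderiv_id
  rw [this]
  rfl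

theorem DiffForm.PreservedBy.mul {η : DiffForm I X k} {φ ψ : Equiv.Perm X}
    (hφ : MDifferentiable I I φ) (hψ : MDifferentiable I I ψ)
    (h : η.PreservedBy φ) (h' : η.PreservedBy ψ) : η.PreservedBy (φ * ψ : Equiv.Perm X) := by
  intro x
  have h1 : mfderiv I I ((φ * ψ : Equiv.Perm X) : X → X) x =
      (mfderiv I I φ (ψ x)).comp (mfderiv I I ψ x) :=
    mfderiv_comp x (hφ (ψ x)) (hψ x)
  rw [h1, ← h' x, ← h (ψ x)]
  rfl

theorem mfderiv_inv_apply {φ : Equiv.Perm X} (hφ : MDifferentiable I I φ)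
    (hi : MDifferentiable I I (φ⁻¹ : Equiv.Perm X)) (x : X) (v : TangentSpace I (φ x)) :
    mfderiv I I φ x (mfderiv I I (φ⁻¹ : Equiv.Perm X) (φ x) v) = v := by
  have h := mfderiv_comp_of_eq (I := I) (I' := I) (I'' := I) (x := φ x) (y := x)
    (f := (φ⁻¹ : Equiv.Perm X)) (g := φ) (hφ x) (hi (φ x)) (by simp)
  have h2 : (φ : X → X) ∘ (φ⁻¹ : Equiv.Perm X) = id := by ext; simp
  rw [h2, mfderiv_id] at h
  have hz : ∀ z, z = x → ∀ u : E, (mfderiv I I φ z u : E) = mfderiv I I φ x u := by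
    rintro z rfl u
    rfl
  exact (hz _ (φ.symm_apply_apply x) _).symm.trans (DFunLike.congr_fun h v).symm

theorem DiffForm.PreservedBy.inv {η : DiffForm I X k} {φ : Equiv.Perm X}
    (hφ : MDifferentiable I I φ) (hi : MDifferentiable I I (φ⁻¹ : Equiv.Perm X))
    (h : η.PreservedBy φ) : η.PreservedBy (φ⁻¹ : Equiv.Perm X) := by
  intro y
  obtain ⟨x, rfl⟩ := φ.surjective y
  have key : ∀ z (_ : z = x) (L : TangentSpace I (φ x) →L[ℝ] E),
      (∀ v : TangentSpace I (φ x), mfderiv I I φ x (L v) = v) →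
      (η z).compContinuousLinearMap (L : TangentSpace I (φ x) →L[ℝ] TangentSpace I z) =
        η (φ x) := by
    rintro z rfl L hL
    rw [← h z]
    ext v
    exact congrArg (η (φ z)) (funext fun i => hL (v i))
  exact key _ (by simp) _ (mfderiv_inv_apply hφ hi x)

end Forms

/-! ### Smooth families of diffeomorphisms -/

section Families

variable {E : Type*} [NormedAddCommGroup E] [NormedSpace ℝ E]
  {H : Type*} [TopologicalSpace H] (I : ModelWithCorners ℝ E H)
  {X : Type*} [TopologicalSpace X] [ChartedSpace H X]
  {E' : Type*} [NormedAddCommGroup E'] [NormedSpace ℝ E']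
  {H' : Type*} [TopologicalSpace H'] (J : ModelWithCorners ℝ E' H')
  {T : Type*} [TopologicalSpace T] [ChartedSpace H' T]

/-- A family of bijections of `X` parametrised by `T` is a smooth family of diffeomorphisms if
`(t, x) ↦ φ_t x` and `(t, x) ↦ φ_t⁻¹ x` are smooth on `T × X`. -/
def IsSmoothFamily (φ : T → Equiv.Perm X) : Prop :=
  ContMDiff (J.prod I) I ∞ (fun q : T × X => φ q.1 q.2) ∧
  ContMDiff (J.prod I) I ∞ (fun q : T × X => (φ q.1)⁻¹ q.2)

variable {I J}

theorem IsSmoothFamily.one : IsSmoothFamily I J (1 : T → Equiv.Perm X) :=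
  ⟨contMDiff_snd, contMDiff_snd⟩

theorem IsSmoothFamily.inv {φ : T → Equiv.Perm X} (h : IsSmoothFamily I J φ) :
    IsSmoothFamily I J φ⁻¹ :=
  ⟨h.2, by simpa using h.1⟩

theorem IsSmoothFamily.mul {φ ψ : T → Equiv.Perm X} (h : IsSmoothFamily I J φ)
    (h' : IsSmoothFamily I J ψ) : IsSmoothFamily I J (φ * ψ) := by
  refine ⟨h.1.comp (contMDiff_fst.prodMk h'.1), ?_⟩
  have := h'.2.comp (contMDiff_fst.prodMk h.2)
  simpa [Function.comp_def] using this

theorem IsSmoothFamily.comp {E'' : Type*} [NormedAddCommGroup E''] [NormedSpace ℝ E'']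
    {H'' : Type*} [TopologicalSpace H''] {J' : ModelWithCorners ℝ E'' H''}
    {S : Type*} [TopologicalSpace S] [ChartedSpace H'' S]
    {φ : T → Equiv.Perm X} (h : IsSmoothFamily I J φ) {u : S → T} (hu : ContMDiff J' J ∞ u) :
    IsSmoothFamily I J' (fun s => φ (u s)) :=
  ⟨h.1.comp ((hu.comp contMDiff_fst).prodMk contMDiff_snd),
    h.2.comp ((hu.comp contMDiff_fst).prodMk contMDiff_snd)⟩

theorem IsSmoothFamily.mdifferentiable {φ : T → Equiv.Perm X} (h : IsSmoothFamily I J φ) (t : T) :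
    MDifferentiable I I (φ t) :=
  ContMDiff.mdifferentiable (n := ∞)
    (h.1.comp ((contMDiff_const (c := t)).prodMk contMDiff_id)) (by simp)

variable (I)

/-- The velocity `d/dt φ_t(x)`, a tangent vector at `φ_t(x)`
(here `1` is the positive unit tangent vector of `[0, 1]`). -/
def velocity (φ : unitInterval → Equiv.Perm X) (t : unitInterval) (x : X) :
    TangentSpace I (φ t x) :=
  mfderiv (𝓡∂ 1) I (fun s => φ s x) t (1 : TangentSpace (𝓡∂ 1) t)

variable {I}

theorem velocity_mul {φ ψ : unitInterval → Equiv.Perm X} (h : IsSmoothFamily I (𝓡∂ 1) φ)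
    (h' : IsSmoothFamily I (𝓡∂ 1) ψ) (t : unitInterval) (x : X) :
    velocity I (φ * ψ) t x =
      velocity I φ t (ψ t x) + mfderiv I I (φ t) (ψ t x) (velocity I ψ t x) := by
  have hψ : MDifferentiableAt (𝓡∂ 1) I (fun s => ψ s x) t :=
    ContMDiffAt.mdifferentiableAt (n := ∞)
      ((h'.1.comp (contMDiff_id.prodMk (contMDiff_const (c := x)))) t) (by simp)
  have hφ : MDifferentiableAt ((𝓡∂ 1).prod I) I (fun q : unitInterval × X => φ q.1 q.2)
      (t, ψ t x) := ContMDiffAt.mdifferentiableAt (n := ∞) (h.1 _) (by simp)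
  have hp : MDifferentiableAt (𝓡∂ 1) ((𝓡∂ 1).prod I) (fun s => (s, ψ s x)) t :=
    mdifferentiableAt_id.prodMk hψ
  have h1 := mfderiv_comp_apply t hφ hp (1 : TangentSpace (𝓡∂ 1) t)
  have h2 := mfderiv_prodMk (mdifferentiableAt_id (x := t) (I := 𝓡∂ 1)) hψ
  have h3 := mfderiv_prod_eq_add_apply hφ
    (v := (mfderiv (𝓡∂ 1) ((𝓡∂ 1).prod I) (fun s => (s, ψ s x)) t) (1 : TangentSpace (𝓡∂ 1) t))
  refine Eq.trans h1 (h3.trans ?_)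
  have h4 : mfderiv (𝓡∂ 1) ((𝓡∂ 1).prod I) (fun s => (s, ψ s x)) t
      (1 : TangentSpace (𝓡∂ 1) t) = ((1 : TangentSpace (𝓡∂ 1) t), velocity I ψ t x) := by
    have := DFunLike.congr_fun h2 (1 : TangentSpace (𝓡∂ 1) t)
    refine this.trans ?_
    rw [mfderiv_id]
    rfl
  rw [h4]
  rfl

theorem velocity_one (t : unitInterval) (x : X) :
    velocity I (1 : unitInterval → Equiv.Perm X) t x = 0 := by
  have : mfderiv (𝓡∂ 1) I (fun _ : unitInterval => x) t = 0 := mfderiv_const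
  exact DFunLike.congr_fun this _

/-- Two elements of a group `G` of paths of diffeomorphisms are smoothly homotopic in `G` with
fixed endpoints. -/
def SmoothlyHomotopic (I : ModelWithCorners ℝ E H) (G : Subgroup (unitInterval → Equiv.Perm X))
    (γ γ' : G) : Prop :=
  ∃ Γ : unitInterval → G,
    IsSmoothFamily I ((𝓡∂ 1).prod (𝓡∂ 1))
      (fun q : unitInterval × unitInterval => (Γ q.1).1 q.2) ∧
    Γ 0 = γ ∧ Γ 1 = γ' ∧ ∀ s, (Γ s).1 0 = γ.1 0 ∧ (Γ s).1 1 = γ.1 1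

/-- Smooth homotopy with fixed endpoints, as a congruence on a group of smooth paths. -/
def homotopyCon (I : ModelWithCorners ℝ E H) (G : Subgroup (unitInterval → Equiv.Perm X))
    (hG : ∀ γ ∈ G, IsSmoothFamily I (𝓡∂ 1) γ) : Con G where
  r := SmoothlyHomotopic I G
  iseqv := by
    have hc : ∀ γ : G, IsSmoothFamily I ((𝓡∂ 1).prod (𝓡∂ 1))
        (fun q : unitInterval × unitInterval => γ.1 q.2) :=
      fun γ => (hG γ.1 γ.2).comp contMDiff_snd
    refine ⟨fun γ => ⟨fun _ => γ, hc γ, rfl, rfl, fun _ => ⟨rfl, rfl⟩⟩, ?_, ?_⟩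
    · rintro γ γ' ⟨Γ, hs, h0, h1, he⟩
      have h10 := (he 1).1
      have h11 := (he 1).2
      rw [h1] at h10 h11
      refine ⟨fun s => γ * (Γ s)⁻¹ * γ', ((hc γ).mul hs.inv).mul (hc γ'), by simp [h0],
        by simp [h1], fun s => ⟨?_, ?_⟩⟩
      · simp [(he s).1]
      · simp [(he s).2]
    · rintro γ γ' γ'' ⟨Γ, hs, h0, h1, he⟩ ⟨Γ', hs', h0', h1', he'⟩
      have h10 := (he 1).1
      have h11 := (he 1).2
      rw [h1] at h10 h11
      refine ⟨fun s => Γ s * γ'⁻¹ * Γ' s, (hs.mul (hc γ').inv).mul hs', by simp [h0, h0'],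
        by simp [h1, h1'], fun s => ⟨?_, ?_⟩⟩
      · simp [(he s).1, (he' s).1]
      · simp [(he s).2, (he' s).2]
  mul' := by
    rintro γ γ' δ δ' ⟨Γ, hs, h0, h1, he⟩ ⟨Γ', hs', h0', h1', he'⟩
    refine ⟨fun s => Γ s * Γ' s, hs.mul hs', by simp [h0, h0'], by simp [h1, h1'],
      fun s => ⟨?_, ?_⟩⟩
    · simp [(he s).1, (he' s).1]
    · simp [(he s).2, (he' s).2]

/-- The differential `df_x(w)` of a real function. -/
def differential (I : ModelWithCorners ℝ E H) (f : X → ℝ) (x : X) (w : TangentSpace I x) : ℝ :=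
  mfderiv I 𝓘(ℝ, ℝ) f x w

/-- The time-dependent function `f` generates the path `φ` with respect to the 2-form `Ω`:
`f` is smooth and the velocity field `X_t` of `φ` satisfies `Ω(X_t, ·) + df_t = 0`. -/
def Generates (Ω : DiffForm I X 2) (f : unitInterval × X → ℝ)
    (φ : unitInterval → Equiv.Perm X) : Prop :=
  ContMDiff ((𝓡∂ 1).prod I) 𝓘(ℝ, ℝ) ∞ f ∧
  ∀ (t : unitInterval) (x : X) (w : TangentSpace I (φ t x)),
    Ω (φ t x) ![velocity I φ t x, w] +
      differential I (fun y => f (t, y)) (φ t x) w = 0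

theorem differential_comp {f : X → ℝ} {u : X → X} (x : X)
    (hf : MDifferentiableAt I 𝓘(ℝ, ℝ) f (u x)) (hu : MDifferentiableAt I I u x)
    (w : TangentSpace I x) :
    differential I (fun y => f (u y)) x w = differential I f (u x) (mfderiv I I u x w) :=
  mfderiv_comp_apply x hf hu w

theorem Generates.mdifferentiableAt {Ω : DiffForm I X 2} {f : unitInterval × X → ℝ}
    {φ : unitInterval → Equiv.Perm X} (h : Generates Ω f φ) (t : unitInterval) (x : X) :
    MDifferentiableAt I 𝓘(ℝ, ℝ) (fun y => f (t, y)) x :=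
  ContMDiffAt.mdifferentiableAt (n := ∞)
    ((h.1.comp ((contMDiff_const (c := t)).prodMk contMDiff_id)) x) (by simp)

theorem Generates.one (Ω : DiffForm I X 2) :
    Generates Ω (fun _ => 0) (1 : unitInterval → Equiv.Perm X) := by
  refine ⟨contMDiff_const, fun t x w => ?_⟩
  have h1 : differential I (fun _ : X => (0 : ℝ)) x w = 0 := by
    have : mfderiv I 𝓘(ℝ, ℝ) (fun _ : X => (0 : ℝ)) x = 0 := mfderiv_const
    exact DFunLike.congr_fun this w
  rw [velocity_one]
  have h2 : Ω x ![(0 : TangentSpace I x), w] = 0 :=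
    (Ω x).map_coord_zero 0 rfl
  exact (congrArg₂ (· + ·) h2 h1).trans (add_zero 0)

theorem DiffForm.PreservedBy.apply₂ {Ω : DiffForm I X 2} {φ : X → X} (h : Ω.PreservedBy φ) (x : X)
    (v w : TangentSpace I x) :
    Ω (φ x) ![mfderiv I I φ x v, mfderiv I I φ x w] = Ω x ![v, w] := by
  rw [← h x]
  refine congrArg (Ω (φ x)) (funext fun i => ?_)
  fin_cases i <;> rfl

theorem Generates.mul {Ω : DiffForm I X 2} {f g : unitInterval × X → ℝ}
    {φ ψ : unitInterval → Equiv.Perm X} (hf : Generates Ω f φ) (hg : Generates Ω g ψ)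
    (hφ : IsSmoothFamily I (𝓡∂ 1) φ) (hψ : IsSmoothFamily I (𝓡∂ 1) ψ)
    (hΩ : ∀ t, Ω.PreservedBy (φ t)) :
    Generates Ω (fun q => f q + g (q.1, (φ q.1)⁻¹ q.2)) (φ * ψ) := by
  refine ⟨hf.1.add (hg.1.comp (contMDiff_fst.prodMk hφ.2)), fun t x w => ?_⟩
  have hi : MDifferentiable I I ((φ t)⁻¹ : Equiv.Perm X) := hφ.inv.mdifferentiable t
  have hd : MDifferentiable I I (φ t) := hφ.mdifferentiable t
  have hgd : MDifferentiableAt I 𝓘(ℝ, ℝ) (fun y => g (t, (φ t)⁻¹ y)) (φ t (ψ t x)) :=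
    (hg.mdifferentiableAt t _).comp _ (hi (φ t (ψ t x)))
  obtain ⟨u, hu⟩ : ∃ u : TangentSpace I (ψ t x), mfderiv I I (φ t) (ψ t x) u = w :=
    ⟨_, mfderiv_inv_apply hd hi (ψ t x) w⟩
  have e1 : differential I (fun y => f (t, y) + g (t, (φ t)⁻¹ y)) (φ t (ψ t x)) w =
      differential I (fun y => f (t, y)) (φ t (ψ t x)) w +
      differential I (fun y => g (t, (φ t)⁻¹ y)) (φ t (ψ t x)) w :=
    DFunLike.congr_fun (mfderiv_add (hf.mdifferentiableAt t (φ t (ψ t x))) hgd) w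
  have e2 : differential I (fun y => g (t, (φ t)⁻¹ y)) (φ t (ψ t x)) w =
      differential I (fun y => g (t, y)) (ψ t x) u := by
    rw [← hu, ← differential_comp (ψ t x) hgd (hd _) u]
    simp
  have e3 : Ω (φ t (ψ t x)) ![velocity I (φ * ψ) t x, w] =
      Ω (φ t (ψ t x)) ![velocity I φ t (ψ t x), w] +
      Ω (ψ t x) ![velocity I ψ t x, u] := by
    rw [← (hΩ t).apply₂ (ψ t x), hu, velocity_mul hφ hψ]
    exact (Ω (φ t (ψ t x))).vecCons_add ![w] _ _
  have e4 := hf.2 t (ψ t x) w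
  have e5 := hg.2 t x u
  refine (congrArg₂ (· + ·) e3 e1).trans ?_
  rw [e2]
  linarith

theorem Generates.inv {Ω : DiffForm I X 2} {f : unitInterval × X → ℝ}
    {φ : unitInterval → Equiv.Perm X} (hf : Generates Ω f φ)
    (hφ : IsSmoothFamily I (𝓡∂ 1) φ) (hΩ : ∀ t, Ω.PreservedBy (φ t)) :
    Generates Ω (fun q => -f (q.1, φ q.1 q.2)) φ⁻¹ := by
  refine ⟨(hf.1.comp (contMDiff_fst.prodMk hφ.1)).neg, fun t z w => ?_⟩
  have hd : MDifferentiable I I (φ t) := hφ.mdifferentiable t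
  have hfd : MDifferentiableAt I 𝓘(ℝ, ℝ) (fun y => f (t, φ t y)) (φ⁻¹ t z) :=
    (hf.mdifferentiableAt t _).comp _ (hd _)
  have key : ∀ y z' : X, z' = φ t y → ∀ (v : TangentSpace I z') (w' u : TangentSpace I y),
      v = 0 → (v : E) = velocity I φ t y + mfderiv I I (φ t) y u →
      Ω y ![u, w'] = differential I (fun y => f (t, y)) (φ t y) (mfderiv I I (φ t) y w') := by
    rintro y z' rfl v w' u rfl hv
    have h1 := hf.2 t y (mfderiv I I (φ t) y w')
    have h2 : Ω (φ t y) ![velocity I φ t y + mfderiv I I (φ t) y u, mfderiv I I (φ t) y w'] =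
        Ω (φ t y) ![velocity I φ t y, mfderiv I I (φ t) y w'] +
        Ω (φ t y) ![mfderiv I I (φ t) y u, mfderiv I I (φ t) y w'] :=
      (Ω (φ t y)).vecCons_add ![mfderiv I I (φ t) y w'] _ _
    have h3 : Ω (φ t y) ![velocity I φ t y + mfderiv I I (φ t) y u,
        mfderiv I I (φ t) y w'] = 0 := by
      refine (Ω (φ t y)).map_coord_zero 0 ?_
      exact hv.symm
    rw [(hΩ t).apply₂] at h2
    linarith
  have h1 := velocity_mul hφ hφ.inv t z
  have h0 : velocity I (φ * φ⁻¹) t z = 0 := by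
    rw [mul_inv_cancel]
    exact velocity_one t z
  have h2 := key (φ⁻¹ t z) _ rfl (velocity I (φ * φ⁻¹) t z) w (velocity I φ⁻¹ t z) h0 h1
  have h3 : differential I (fun y => -f (t, φ t y)) (φ⁻¹ t z) w =
      -differential I (fun y => f (t, φ t y)) (φ⁻¹ t z) w :=
    DFunLike.congr_fun (mfderiv_neg (f := fun y => f (t, φ t y)) (x := φ⁻¹ t z)) w
  have h4 := differential_comp (φ⁻¹ t z) (hf.mdifferentiableAt t _) (hd _) w
  refine (congrArg₂ (· + ·) h2 h3).trans ?_
  rw [h4]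
  exact add_neg_cancel _

end Families

/-! ### Symplectic manifolds, Liouville measure, Hamiltonian paths -/

section Symplectic

/-- A symplectic form on a manifold of dimension `2n`. -/
structure SymplecticForm (n : ℕ) (M : Type*) [TopologicalSpace M]
    [ChartedSpace (EuclideanSpace ℝ (Fin (2 * n))) M] where
  form : DiffForm (𝓡 (2 * n)) M 2
  smooth : form.IsSmooth
  nondegenerate : ∀ (x : M) (v : TangentSpace (𝓡 (2 * n)) x),
    (∀ w : TangentSpace (𝓡 (2 * n)) x, form x ![v, w] = 0) → v = 0
  closed : ∀ x, form.d x = 0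

variable {n : ℕ} {M : Type*} [TopologicalSpace M]
  [ChartedSpace (EuclideanSpace ℝ (Fin (2 * n))) M]

namespace SymplecticForm

variable (Ω : SymplecticForm n M)

/-- The Liouville form `Ω^n / n!`, with the `n`-fold wedge product written out:
`Ω^n (v_0, …, v_{2n-1}) = 2^{-n} ∑_σ sign(σ) ∏_i Ω(v_{σ(2i)}, v_{σ(2i+1)})`. -/
def liouvilleForm (x : M) (v : Fin (2 * n) → TangentSpace (𝓡 (2 * n)) x) : ℝ :=
  ((n.factorial : ℝ))⁻¹ * ((2 : ℝ) ^ n)⁻¹ *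
    ∑ σ : Equiv.Perm (Fin (2 * n)), ((Equiv.Perm.sign σ : ℤ) : ℝ) *
      ∏ i : Fin n, Ω.form x ![v (σ ⟨2 * i, by omega⟩), v (σ ⟨2 * i + 1, by omega⟩)]

/-- The absolute value of the coefficient of the Liouville form in the chart at `c`. -/
def liouvilleDensity (c : M) (y : EuclideanSpace ℝ (Fin (2 * n))) : ℝ :=
  |Ω.liouvilleForm ((extChartAt (𝓡 (2 * n)) c).symm y) fun i =>
    mfderiv 𝓘(ℝ, EuclideanSpace ℝ (Fin (2 * n))) (𝓡 (2 * n)) (extChartAt (𝓡 (2 * n)) c).symm y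
      (EuclideanSpace.single i (1 : ℝ))|

/-- The measure given by the Liouville form on the domain of the chart at `c`
(and zero outside it). -/
def chartLiouville [MeasurableSpace M] (c : M) : Measure M :=
  (((volume : Measure (EuclideanSpace ℝ (Fin (2 * n)))).restrict
      (extChartAt (𝓡 (2 * n)) c).target).withDensity
        fun y => ENNReal.ofReal (Ω.liouvilleDensity c y)).map (extChartAt (𝓡 (2 * n)) c).symm

/-- The Liouville measure, i.e. integration against `Ω^n / n!` (`M` being oriented by this form).
The chart measures agree on overlaps by the change of variables formula, and their supremum is
the measure obtained by gluing them. -/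
def liouville [MeasurableSpace M] : Measure M := ⨆ c : M, Ω.chartLiouville c

/-- The group `P(Ham)` of smooth paths of Hamiltonian diffeomorphisms based at the identity
(Hamiltonian isotopies), with the pointwise product: smooth paths of symplectomorphisms whose
velocity field is the Hamiltonian vector field of a smooth time-dependent function. -/
def HamPath : Subgroup (unitInterval → Equiv.Perm M) where
  carrier := {φ | φ 0 = 1 ∧ IsSmoothFamily (𝓡 (2 * n)) (𝓡∂ 1) φ ∧
    (∀ t, Ω.form.PreservedBy (φ t)) ∧ ∃ f, Generates Ω.form f φ}
  one_mem' := ⟨rfl, .one, fun _ => .one _, _, .one _⟩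
  mul_mem' := by
    rintro φ ψ ⟨h0, hs, hp, f, hf⟩ ⟨h0', hs', hp', g, hg⟩
    exact ⟨by simp [h0, h0'], hs.mul hs',
      fun t => .mul (hs.mdifferentiable t) (hs'.mdifferentiable t) (hp t) (hp' t),
      _, hf.mul hg hs hs' hp⟩
  inv_mem' := by
    rintro φ ⟨h0, hs, hp, f, hf⟩
    exact ⟨by simp [h0], hs.inv,
      fun t => .inv (hs.mdifferentiable t) (hs.inv.mdifferentiable t) (hp t), _, hf.inv hs hp⟩

/-- The congruence on `P(Ham)` given by smooth homotopy with fixed endpoints. -/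
def hamCon : Con Ω.HamPath := homotopyCon (𝓡 (2 * n)) Ω.HamPath fun _ h => h.2.1

/-- The group `Ham~`. -/
abbrev HamCover : Type _ := Ω.hamCon.Quotient

/-- The class in `Ham~` of a path. -/
def hamClass : Ω.HamPath →* Ω.HamCover := Ω.hamCon.mk'

end SymplecticForm

end Symplectic

/-! ### Prequantum bundles -/

section Prequantum

variable {n : ℕ} {M : Type*} [TopologicalSpace M]
  [ChartedSpace (EuclideanSpace ℝ (Fin (2 * n))) M]

/-- The infinitesimal generator `∂_θ` of a circle action. -/
def circleField {P : Type*} [TopologicalSpace P]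
    [ChartedSpace (EuclideanSpace ℝ (Fin (2 * n + 1))) P] [MulAction Circle P] (p : P) :
    TangentSpace (𝓡 (2 * n + 1)) p :=
  mfderiv 𝓘(ℝ, ℝ) (𝓡 (2 * n + 1)) (fun θ : ℝ => Circle.exp θ • p) 0 (1 : ℝ)

/-- A prequantum bundle over `(M, Ω)` with total space `P`: a principal `U(1)`-bundle
with a connection form `α` such that `dα + π^* Ω = 0`. -/
structure PrequantumBundle (Ω : SymplecticForm n M) (P : Type*) [TopologicalSpace P]
    [ChartedSpace (EuclideanSpace ℝ (Fin (2 * n + 1))) P] [MulAction Circle P] where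
  proj : P → M
  smooth_proj : ContMDiff (𝓡 (2 * n + 1)) (𝓡 (2 * n)) ∞ proj
  smooth_smul : ContMDiff ((𝓡 1).prod (𝓡 (2 * n + 1))) (𝓡 (2 * n + 1)) ∞
    (fun q : Circle × P => q.1 • q.2)
  proj_smul : ∀ (z : Circle) (p : P), proj (z • p) = proj p
  /-- Around every point there is a smooth equivariant trivialisation over an open set. -/
  locally_trivial : ∀ x : M, ∃ (U : Set M) (e : OpenPartialHomeomorph P (M × Circle)),
    IsOpen U ∧ x ∈ U ∧ e.source = proj ⁻¹' U ∧ e.target = U ×ˢ univ ∧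
    ContMDiffOn (𝓡 (2 * n + 1)) ((𝓡 (2 * n)).prod (𝓡 1)) ∞ e e.source ∧
    ContMDiffOn ((𝓡 (2 * n)).prod (𝓡 1)) (𝓡 (2 * n + 1)) ∞ e.symm e.target ∧
    ∀ p ∈ e.source, (e p).1 = proj p ∧ ∀ z : Circle, e (z • p) = (proj p, z * (e p).2)
  α : DiffForm (𝓡 (2 * n + 1)) P 1
  smooth_α : α.IsSmooth
  α_circleField : ∀ p, α p ![circleField p] = 1
  α_invariant : ∀ z : Circle, α.PreservedBy (z • ·)
  curvature : ∀ p, α.d p +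
    (Ω.form (proj p)).compContinuousLinearMap
      (mfderiv (𝓡 (2 * n + 1)) (𝓡 (2 * n)) proj p) = 0

namespace PrequantumBundle

variable {Ω : SymplecticForm n M} {P : Type*} [TopologicalSpace P]
  [ChartedSpace (EuclideanSpace ℝ (Fin (2 * n + 1))) P] [MulAction Circle P]
  (B : PrequantumBundle Ω P)

/-- The group `P(Preq)` of smooth paths of prequantum bundle automorphisms (diffeomorphisms of `P`
preserving `α` and commuting with the action) based at the identity, with the pointwise product. -/
def PreqPath : Subgroup (unitInterval → Equiv.Perm P) where
  carrier := {γ | γ 0 = 1 ∧ IsSmoothFamily (𝓡 (2 * n + 1)) (𝓡∂ 1) γ ∧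
    (∀ t, B.α.PreservedBy (γ t)) ∧ ∀ (t : unitInterval) (z : Circle) (p : P),
      γ t (z • p) = z • γ t p}
  one_mem' := ⟨rfl, .one, fun _ => .one _, fun _ _ _ => rfl⟩
  mul_mem' := by
    rintro φ ψ ⟨h0, hs, hp, hc⟩ ⟨h0', hs', hp', hc'⟩
    exact ⟨by simp [h0, h0'], hs.mul hs',
      fun t => .mul (hs.mdifferentiable t) (hs'.mdifferentiable t) (hp t) (hp' t),
      fun t z p => by simp [hc, hc']⟩
  inv_mem' := by
    rintro φ ⟨h0, hs, hp, hc⟩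
    refine ⟨by simp [h0], hs.inv,
      fun t => .inv (hs.mdifferentiable t) (hs.inv.mdifferentiable t) (hp t), fun t z p => ?_⟩
    apply (φ t).injective
    simp [hc]

/-- The congruence on `P(Preq)` given by smooth homotopy with fixed endpoints. -/
def preqCon : Con B.PreqPath := homotopyCon (𝓡 (2 * n + 1)) B.PreqPath fun _ h => h.2.1

/-- The universal cover of the identity component of `Preq`. -/
abbrev PreqCover : Type _ := B.preqCon.Quotient

/-- The class of a path in the universal cover. -/
def preqClass : B.PreqPath →* B.PreqCover := B.preqCon.mk'

/-- The path `γ` of `Preq` lifts the path `φ` of `Ham`. -/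
def Lifts (γ : B.PreqPath) (φ : Ω.HamPath) : Prop :=
  ∀ (t : unitInterval) (p : P), B.proj (γ.1 t p) = φ.1 t (B.proj p)

/-- `f` is the generating Hamiltonian of the path `γ` of `Preq`: `f` is smooth and the velocity
field of `γ` is `Y_t = X_t^hor - (π^* f_t) ∂_θ`, with `X_t` the Hamiltonian vector field of `f_t`.
That is, `Y_t + (π^* f_t) ∂_θ` is horizontal and projects to `X_t`. -/
def IsHamiltonianOf (f : unitInterval × M → ℝ) (γ : B.PreqPath) : Prop :=
  ContMDiff ((𝓡∂ 1).prod (𝓡 (2 * n))) 𝓘(ℝ, ℝ) ∞ f ∧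
  ∀ (t : unitInterval) (p : P),
    B.α (γ.1 t p) ![velocity (𝓡 (2 * n + 1)) γ.1 t p +
      f (t, B.proj (γ.1 t p)) • circleField (γ.1 t p)] = 0 ∧
    ∀ w : TangentSpace (𝓡 (2 * n)) (B.proj (γ.1 t p)),
      Ω.form (B.proj (γ.1 t p)) ![mfderiv (𝓡 (2 * n + 1)) (𝓡 (2 * n)) B.proj (γ.1 t p)
        (velocity (𝓡 (2 * n + 1)) γ.1 t p +
          f (t, B.proj (γ.1 t p)) • circleField (γ.1 t p)), w] +
      differential (𝓡 (2 * n)) (fun x => f (t, x)) (B.proj (γ.1 t p)) w = 0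

/-- The generating Hamiltonian of `γ` is normalised at each time. -/
def IsNormalised [MeasurableSpace M] (γ : B.PreqPath) : Prop :=
  ∃ f, B.IsHamiltonianOf f γ ∧ ∀ t : unitInterval, ∫ x, f (t, x) ∂Ω.liouville = 0

/-- The path `t ↦ e^{itτ}` of `Preq`, given by the action of `U(1)`. -/
def circlePath (τ : ℝ) : B.PreqPath :=
  ⟨fun t => MulAction.toPerm (Circle.exp (t * τ)), by
    have h1 : ContMDiff (𝓡∂ 1) 𝓘(ℝ, ℝ) ∞ (fun t : unitInterval => (t : ℝ)) :=
      contMDiff_subtypeVal_Icc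
    have h2 : ContMDiff (𝓡∂ 1) (𝓡 1) ∞ (fun t : unitInterval => Circle.exp (t * τ)) :=
      contMDiff_circleExp.comp (h1.mul contMDiff_const)
    have h3 : ContMDiff (𝓡∂ 1) (𝓡 1) ∞ (fun t : unitInterval => (Circle.exp (t * τ))⁻¹) := by
      have : ContMDiff (𝓡∂ 1) (𝓡 1) ∞ (fun t : unitInterval => Circle.exp (t * (-τ))) :=
        contMDiff_circleExp.comp (h1.mul contMDiff_const)
      simpa [Circle.exp_neg] using this
    refine ⟨?_, ⟨?_, ?_⟩, fun t => B.α_invariant _, fun t z p => ?_⟩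
    · ext p
      simp
    · exact B.smooth_smul.comp ((h2.comp contMDiff_fst).prodMk contMDiff_snd)
    · exact B.smooth_smul.comp ((h3.comp contMDiff_fst).prodMk contMDiff_snd)
    · exact smul_comm _ _ _⟩

end PrequantumBundle

end Prequantum

end

end Prequantum

open scoped Topology

set_option linter.unusedSectionVars false

namespace Prequantum

noncomputable section

/-! ### Smooth forms in charts, their pullbacks, and Cartan's formula for 1-forms -/

section Pullback

/-! The engine is Cartan's formula on a parametrised square
(`DiffForm.IsSmooth.pathDeriv_sub_pathDeriv`) combined with the curvature equation dα = -π^*ω. For a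
path G_t of automorphisms, the value of α on the velocity is circle-invariant, hence of the form -f
with f a function on the base. Cartan's formula for (t, s) ↦ G_t(c(s)), in which α(∂_s) does not
depend on t, says exactly that f generates the path induced on M
(`IsPreqFamily.exists_hamiltonian`). Read backwards, the same computation shows that a path obeying
the Hamiltonian equations preserves α (`preservedBy_of_hamiltonianAt`).

Lifting a Hamiltonian family therefore takes two steps. First any smooth equivariant lift is built,
by small steps between nearby fibres (`exists_isLift`); then it is rotated in the fibres by the
angle that gives α of the velocity the value -f (`exists_preqFamily`). To apply this to homotopies,
the Hamiltonians must depend smoothly on the homotopy parameter, although they are only given one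
path at a time; `exists_familyGenerates` obtains this by writing their differences as integrals of
ω. The zero-mean condition fixes the remaining function of time. It needs a Liouville measure that
is finite, nonzero and invariant under symplectic diffeomorphisms, which rests on the nonvanishing
of ω^n (`pfaffianForm_ne_zero`) and on the change of variables formula.

Homotopy invariance comes from one identity. If f and g are the Hamiltonians of a two-parameter
family in the directions t and s, Cartan's formula along trajectories, integrated over M against the
invariant measure, gives ∂_s ∫f μ = ∂_t ∫g μ (`IsPreqFamily.pathDeriv_integral_eq`). If the
endpoints in t are fixed, g vanishes there, so ∫∫ f μ dt does not depend on s: `Cal` is well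
defined. If instead f is normalised and only the endpoints on the base are fixed, ∫g μ remains 0; at
t = 1 the function g is constant on the connected manifold M, hence zero, so the endpoint of the
lift does not move: `L` is well defined.

Finally π L = id, Cal L = 0, π R = 1, and Cal R(τ) = -Vol τ because a rotation at speed τ has
Hamiltonian -τ. Hence Φ ∘ Ψ is injective. The map Ψ is onto: composing a path with a rotation whose
speed is the mean of its Hamiltonian makes it normalised, and a path of rotations is homotopic to
the uniform one with the same final angle. Bijectivity of Φ follows formally. -/

theorem two_le_infty : (2 : WithTop ℕ∞) ≤ ∞ := by
  exact WithTop.coe_le_coe.2 (le_top : (2 : ℕ∞) ≤ ⊤)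

variable {E : Type*} [NormedAddCommGroup E] [NormedSpace ℝ E]
  {H : Type*} [TopologicalSpace H] {I : ModelWithCorners ℝ E H} [I.Boundaryless]
  {X : Type*} [TopologicalSpace X] [ChartedSpace H X] [IsManifold I ∞ X] {k : ℕ}

theorem mfderiv_extChartAt_symm_mfderiv_extChartAt {c x : X} (hx : x ∈ (extChartAt I c).source)
    (v : TangentSpace I x) :
    (mfderiv 𝓘(ℝ, E) I (extChartAt I c).symm (extChartAt I c x)
      (mfderiv I 𝓘(ℝ, E) (extChartAt I c) x v) : E) = v := by
  have := mfderivWithin_extChartAt_symm_comp_mfderiv_extChartAt' (I := I) hx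
  rw [I.range_eq_univ, mfderivWithin_univ] at this
  exact DFunLike.congr_fun this v

theorem mfderiv_extChartAt_mfderiv_extChartAt_symm {c : X} {y : E}
    (hy : y ∈ (extChartAt I c).target) (v : E) :
    (mfderiv I 𝓘(ℝ, E) (extChartAt I c) ((extChartAt I c).symm y)
      (mfderiv 𝓘(ℝ, E) I (extChartAt I c).symm y v) : E) = v := by
  have := mfderiv_extChartAt_comp_mfderivWithin_extChartAt_symm (I := I) hy
  rw [I.range_eq_univ, mfderivWithin_univ] at this
  exact DFunLike.congr_fun this v

/-- A form in terms of its coordinate expression. -/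
theorem DiffForm.apply_eq_inChart (η : DiffForm I X k) {c x : X}
    (hx : x ∈ (extChartAt I c).source) (v : Fin k → TangentSpace I x) :
    η x v = η.inChart c (extChartAt I c x)
      (fun i => (mfderiv I 𝓘(ℝ, E) (extChartAt I c) x (v i) : E)) := by
  -- All tangent spaces are the model space `E`, but the form at `(extChartAt I c).symm (extChartAt
  -- I c x)` is typed over another point than `x`. Generalising that point to `z` allows
  -- substitution. The same device is used below whenever two base points are equal only
  -- propositionally.
  have key : ∀ z, z = x → ∀ w : Fin k → E, (∀ i, w i = v i) → η x v = η z w := by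
    rintro z rfl w hw
    exact congrArg (η z) (funext fun i => (hw i).symm)
  exact key _ ((extChartAt I c).left_inv hx) _
    fun i => mfderiv_extChartAt_symm_mfderiv_extChartAt hx (v i)

theorem contDiff_continuousAlternatingMap_apply :
    ContDiff ℝ ∞ (fun q : (E [⋀^Fin k]→L[ℝ] ℝ) × (Fin k → E) => q.1 q.2) :=
  ((ContinuousAlternatingMap.toContinuousMultilinearMapCLM (𝕜 := ℝ) (E := E)
    (F := ℝ) (ι := Fin k) ℝ).analyticOnNhd_uncurry_of_multilinear (s := univ)).contDiffOn
      uniqueDiffOn_univ |> contDiffOn_univ.1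

section Eval

variable {E' : Type*} [NormedAddCommGroup E'] [NormedSpace ℝ E']
  {H' : Type*} [TopologicalSpace H'] {J : ModelWithCorners ℝ E' H'}
  {N : Type*} [TopologicalSpace N] [ChartedSpace H' N]


/-- Coordinates of a smooth vector field along a map are smooth. -/
theorem ContMDiffWithinAt.mfderiv_extChartAt_apply {u : N → X}
    {V : ∀ y, TangentSpace I (u y)} {s : Set N} {y₀ : N}
    (hV : ContMDiffWithinAt J I.tangent ∞ (fun y => (⟨u y, V y⟩ : TangentBundle I X)) s y₀) :
    ContMDiffWithinAt J 𝓘(ℝ, E) ∞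
      (fun y => (mfderiv I 𝓘(ℝ, E) (extChartAt I (u y₀)) (u y) (V y) : E)) s y₀ := by
  obtain ⟨h1, h2⟩ := (Bundle.contMDiffWithinAt_totalSpace
    (F := E) (E := (TangentSpace I : X → Type _))).1 hV
  have hu : u ⁻¹' (chartAt H (u y₀)).source ∈ 𝓝[s] y₀ :=
    h1.continuousWithinAt.preimage_mem_nhdsWithin
      ((chartAt H (u y₀)).open_source.mem_nhds (mem_chart_source H _))
  -- Over the chart domain, the trivialisation of the tangent bundle at `u y₀` is the derivative of
  -- that chart, so smoothness of the section gives smoothness of its fibre coordinate.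
  have key : ∀ y, u y ∈ (chartAt H (u y₀)).source →
      (mfderiv I 𝓘(ℝ, E) (extChartAt I (u y₀)) (u y) (V y) : E) =
      (trivializationAt E (TangentSpace I) (u y₀) ⟨u y, V y⟩).2 := by
    intro y hy
    refine (DFunLike.congr_fun
      (TangentBundle.continuousLinearMapAt_trivializationAt hy) (V y)).symm.trans ?_
    exact congrFun (Bundle.Trivialization.coe_linearMapAt_of_mem (R := ℝ)
      (trivializationAt E (TangentSpace I) (u y₀)) (by simpa using hy)) (V y)
  refine h2.congr_of_eventuallyEq ?_ (key _ (mem_chart_source H _))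
  filter_upwards [hu] with y hy using key y hy


theorem DiffForm.IsSmooth.contMDiffWithinAt_inChart {η : DiffForm I X k} (hη : η.IsSmooth)
    {u : N → X} {s : Set N} {y₀ : N} (hu : ContMDiffWithinAt J I ∞ u s y₀) :
    ContMDiffWithinAt J 𝓘(ℝ, E [⋀^Fin k]→L[ℝ] ℝ) ∞
      (fun y => η.inChart (u y₀) (extChartAt I (u y₀) (u y))) s y₀ := by
  have h1 : ContMDiffWithinAt J 𝓘(ℝ, E) ∞ (fun y => extChartAt I (u y₀) (u y)) s y₀ :=
    ContMDiffAt.comp_contMDiffWithinAt y₀ contMDiffAt_extChartAt hu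
  have h2 : ContDiffAt ℝ ∞ (η.inChart (u y₀)) (extChartAt I (u y₀) (u y₀)) :=
    (hη (u y₀)).contDiffAt ((isOpen_extChartAt_target (u y₀)).mem_nhds
      (mem_extChartAt_target (u y₀)))
  exact ContMDiffAt.comp_contMDiffWithinAt y₀ h2.contMDiffAt h1

/-- A smooth form evaluated on smooth vector fields along a map is smooth. -/
theorem DiffForm.IsSmooth.contMDiffWithinAt_apply {η : DiffForm I X k} (hη : η.IsSmooth)
    {u : N → X} {s : Set N} {y₀ : N} (hu : ContMDiffWithinAt J I ∞ u s y₀)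
    {V : Fin k → ∀ y, TangentSpace I (u y)}
    (hV : ∀ i, ContMDiffWithinAt J I.tangent ∞
        (fun y => (⟨u y, V i y⟩ : TangentBundle I X)) s y₀) :
    ContMDiffWithinAt J 𝓘(ℝ, ℝ) ∞ (fun y => η (u y) (fun i => V i y)) s y₀ := by
  have h3 : ContMDiffWithinAt J 𝓘(ℝ, Fin k → E) ∞
      (fun y i => (mfderiv I 𝓘(ℝ, E) (extChartAt I (u y₀)) (u y) (V i y) : E)) s y₀ :=
    contMDiffWithinAt_pi_space.2 fun i => ContMDiffWithinAt.mfderiv_extChartAt_apply (hV i)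
  have h4 := ContMDiffAt.comp_contMDiffWithinAt y₀
    (contDiff_continuousAlternatingMap_apply (E := E) (k := k)).contMDiff.contMDiffAt
    ((hη.contMDiffWithinAt_inChart hu).prodMk_space h3)
  refine h4.congr_of_eventuallyEq ?_ ?_
  · have : u ⁻¹' (extChartAt I (u y₀)).source ∈ 𝓝[s] y₀ :=
      hu.continuousWithinAt.preimage_mem_nhdsWithin (extChartAt_source_mem_nhds _)
    filter_upwards [this] with y hy using η.apply_eq_inChart hy _
  · exact η.apply_eq_inChart (mem_extChartAt_source _) _

end Eval

section PullbackD

variable {F : Type*} [NormedAddCommGroup F] [NormedSpace ℝ F]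

/-- The pullback of a form under a map from a normed space. -/
def DiffForm.pullbackWithin (η : DiffForm I X k) (u : F → X) (S : Set F) (y : F) :
    F [⋀^Fin k]→L[ℝ] ℝ :=
  (η (u y)).compContinuousLinearMap (mfderivWithin 𝓘(ℝ, F) I u S y)

variable {η : DiffForm I X k} {u : F → X} {S : Set F} {y₀ : F}

/-- By the chain rule in the single chart at `u y₀`. The right-hand side is a pullback between
normed spaces, where the calculus of exterior derivatives applies. -/
theorem DiffForm.pullbackWithin_eventuallyEq (η : DiffForm I X k)
    (hu : ContMDiffOn 𝓘(ℝ, F) I ∞ u S) (hS : UniqueDiffOn ℝ S) (hy : y₀ ∈ S) :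
    η.pullbackWithin u S =ᶠ[𝓝[S] y₀] fun y =>
      (η.inChart (u y₀) (extChartAt I (u y₀) (u y))).compContinuousLinearMap
        (fderivWithin ℝ (fun y => extChartAt I (u y₀) (u y)) S y) := by
  have h1 : u ⁻¹' (extChartAt I (u y₀)).source ∈ 𝓝[S] y₀ :=
    (hu y₀ hy).continuousWithinAt.preimage_mem_nhdsWithin (extChartAt_source_mem_nhds _)
  filter_upwards [h1, self_mem_nhdsWithin] with y hy1 hy2
  have h2 := mfderiv_comp_mfderivWithin (I := 𝓘(ℝ, F)) (I' := I) (I'' := 𝓘(ℝ, E)) y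
    (g := extChartAt I (u y₀)) (f := u) (s := S)
    (mdifferentiableAt_extChartAt (by simpa using hy1))
    ((hu y hy2).mdifferentiableWithinAt (by simp)) (hS y hy2).uniqueMDiffWithinAt
  ext v
  refine (η.apply_eq_inChart hy1 _).trans ?_
  refine congrArg (η.inChart (u y₀) (extChartAt I (u y₀) (u y))) (funext fun i => ?_)
  have h3 := DFunLike.congr_fun h2 (v i)
  rw [mfderivWithin_eq_fderivWithin] at h3
  exact h3.symm

theorem DiffForm.IsSmooth.differentiableWithinAt_pullbackWithin (hη : η.IsSmooth)
    (hu : ContMDiffOn 𝓘(ℝ, F) I ∞ u S) (hS : UniqueDiffOn ℝ S) (hy : y₀ ∈ S) :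
    DifferentiableWithinAt ℝ (η.pullbackWithin u S) S y₀ := by
  have he := η.pullbackWithin_eventuallyEq hu hS hy
  have h1 : ContDiffWithinAt ℝ ∞ (fun y => extChartAt I (u y₀) (u y)) S y₀ :=
    (ContMDiffAt.comp_contMDiffWithinAt y₀ contMDiffAt_extChartAt (hu y₀ hy)).contDiffWithinAt
  have h2 : DifferentiableWithinAt ℝ
      (fun y => η.inChart (u y₀) (extChartAt I (u y₀) (u y))) S y₀ :=
    (hη.contMDiffWithinAt_inChart (hu y₀ hy)).contDiffWithinAt.differentiableWithinAt (by simp)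
  have h3 := (h1.fderivWithin_right hS (m := ∞) le_rfl hy).differentiableWithinAt
    (by simp)
  refine DifferentiableWithinAt.congr_of_eventuallyEq ?_ he (he.self_of_nhdsWithin hy)
  exact (h2.hasFDerivWithinAt.continuousAlternatingMapCompContinuousLinearMap
    h3.hasFDerivWithinAt).differentiableWithinAt

/-- The exterior derivative commutes with pullbacks. -/
theorem DiffForm.IsSmooth.extDerivWithin_pullbackWithin (hη : η.IsSmooth)
    (hu : ContMDiffOn 𝓘(ℝ, F) I ∞ u S) (hS : UniqueDiffOn ℝ S) (hy : y₀ ∈ S)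
    (hyc : y₀ ∈ closure (interior S)) :
    extDerivWithin (η.pullbackWithin u S) S y₀ = η.d.pullbackWithin u S y₀ := by
  have he := η.pullbackWithin_eventuallyEq hu hS hy
  have h1 : ContDiffWithinAt ℝ ∞ (fun y => extChartAt I (u y₀) (u y)) S y₀ :=
    (ContMDiffAt.comp_contMDiffWithinAt y₀ contMDiffAt_extChartAt (hu y₀ hy)).contDiffWithinAt
  have h2 : ContDiffAt ℝ ∞ (η.inChart (u y₀)) (extChartAt I (u y₀) (u y₀)) :=
    (hη (u y₀)).contDiffAt ((isOpen_extChartAt_target (u y₀)).mem_nhds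
      (mem_extChartAt_target (u y₀)))
  -- Naturality of the exterior derivative needs the second derivative of the coordinate map to be
  -- symmetric. At a boundary point of `S` this is where `hyc` enters, together with two orders of
  -- smoothness.
  rw [he.extDerivWithin_eq_of_mem hy,
    extDerivWithin_pullback (t := univ) (r := ∞) (f := fun y => extChartAt I (u y₀) (u y))
    (h2.differentiableAt (by simp)).differentiableWithinAt h1
    (by simpa using two_le_infty) hS hyc hy (mapsTo_univ _ _), extDerivWithin_univ]
  have h3 := mfderiv_comp_mfderivWithin (I := 𝓘(ℝ, F)) (I' := I) (I'' := 𝓘(ℝ, E)) y₀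
    (g := extChartAt I (u y₀)) (f := u) (s := S)
    (mdifferentiableAt_extChartAt (mem_chart_source H _))
    ((hu y₀ hy).mdifferentiableWithinAt (by simp)) (hS y₀ hy).uniqueMDiffWithinAt
  ext v
  refine congrArg (extDeriv (η.inChart (u y₀)) (extChartAt I (u y₀) (u y₀))) (funext fun i => ?_)
  have h4 := DFunLike.congr_fun h3 (v i)
  rw [mfderivWithin_eq_fderivWithin] at h4
  exact h4

/-- Cartan's formula for the differential of a 1-form, on a parametrised surface. -/
theorem DiffForm.IsSmooth.fderivWithin_sub_fderivWithin {η : DiffForm I X 1} (hη : η.IsSmooth)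
    (hu : ContMDiffOn 𝓘(ℝ, F) I ∞ u S) (hS : UniqueDiffOn ℝ S) (hy : y₀ ∈ S)
    (hyc : y₀ ∈ closure (interior S)) (a b : F) :
    fderivWithin ℝ (fun y => η (u y) ![mfderivWithin 𝓘(ℝ, F) I u S y b]) S y₀ a -
      fderivWithin ℝ (fun y => η (u y) ![mfderivWithin 𝓘(ℝ, F) I u S y a]) S y₀ b =
    η.d (u y₀) ![mfderivWithin 𝓘(ℝ, F) I u S y₀ a, mfderivWithin 𝓘(ℝ, F) I u S y₀ b] := by
  have h1 : ∑ i : Fin 2, (-1 : ℤ) ^ (i : ℕ) • fderivWithin ℝ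
      (fun y => η.pullbackWithin u S y (i.removeNth ![a, b])) S y₀ (![a, b] i) =
      η.d.pullbackWithin u S y₀ ![a, b] :=
    (extDerivWithin_apply (hη.differentiableWithinAt_pullbackWithin hu hS hy) (hS y₀ hy)
      ![a, b]).symm.trans (DFunLike.congr_fun (hη.extDerivWithin_pullbackWithin hu hS hy hyc) _)
  have e : ∀ (v : Fin 1 → F), (fun y => η.pullbackWithin u S y v) =
        fun y => η (u y) ![mfderivWithin 𝓘(ℝ, F) I u S y (v 0)] := by
    intro v
    ext y
    refine congrArg (η (u y)) (funext fun j => ?_)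
    fin_cases j
    rfl
  have e0 : ∀ x : ℝ, (-1 : ℤ) ^ ((0 : Fin 2) : ℕ) • x = x := by simp
  have e1 : ∀ x : ℝ, (-1 : ℤ) ^ ((1 : Fin 2) : ℕ) • x = -x := by simp
  rw [Fin.sum_univ_two, e, e] at h1
  refine Eq.trans ?_ (h1.trans (congrArg (η.d (u y₀)) (funext fun j => ?_)))
  · refine (sub_eq_add_neg _ _).trans (congrArg₂ (· + ·) ?_ ?_)
    · exact (e0 _).symm
    · exact (e1 _).symm
  · fin_cases j <;> rfl

end PullbackD

end Pullback

/-! ### Calculus on the unit interval as a manifold with boundary -/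

section Interval

variable {E : Type*} [NormedAddCommGroup E] [NormedSpace ℝ E]
  {H : Type*} [TopologicalSpace H] {I : ModelWithCorners ℝ E H}
  {X : Type*} [TopologicalSpace X] [ChartedSpace H X]
  {E' : Type*} [NormedAddCommGroup E'] [NormedSpace ℝ E']
  {H' : Type*} [TopologicalSpace H'] {J : ModelWithCorners ℝ E' H'}
  {N : Type*} [TopologicalSpace N] [ChartedSpace H' N]
  {F : Type*} [NormedAddCommGroup F] [NormedSpace ℝ F]

/-- The unit vector field on the unit interval is smooth. -/
theorem contMDiff_unitInterval_one :
    ContMDiff (𝓡∂ 1) (𝓡∂ 1).tangent ∞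
      (fun t : unitInterval => (⟨t, 1⟩ : TangentBundle (𝓡∂ 1) unitInterval)) := by
  rw [← contMDiffOn_comp_projIcc_iff]
  have h1 : ContMDiffOn 𝓘(ℝ, ℝ) 𝓘(ℝ, ℝ).tangent ∞
      (fun r : ℝ => (⟨r, 1⟩ : TangentBundle 𝓘(ℝ, ℝ) ℝ)) (Icc 0 1) :=
    (contMDiff_vectorSpace_iff_contDiff (V := fun _ : ℝ => (1 : ℝ)).2 contDiff_const).contMDiffOn
  have h2 := (contMDiffOn_projIcc (x := 0) (y := 1) (n := ∞)).contMDiffOn_tangentMapWithin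
    (m := ∞) le_rfl (uniqueDiffOn_Icc zero_lt_one).uniqueMDiffOn
  refine (h2.comp h1 fun r hr => hr).congr fun r hr => ?_
  have := mfderivWithin_projIcc_one hr
  simp only [Function.comp_def, tangentMapWithin]
  exact congrArg (Bundle.TotalSpace.mk _) this.symm

variable (I) in
/-- The velocity of a path in a manifold. -/
def unitDeriv (c : unitInterval → X) (t : unitInterval) : TangentSpace I (c t) :=
  mfderiv (𝓡∂ 1) I c t (1 : TangentSpace (𝓡∂ 1) t)

/-- The derivative of a path in a vector space. -/
def pathDeriv (h : unitInterval → F) (t : unitInterval) : F := unitDeriv 𝓘(ℝ, F) h t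

theorem unitDeriv_const (x : X) (t : unitInterval) :
    unitDeriv I (fun _ => x) t = 0 :=
  DFunLike.congr_fun (mfderiv_const (I := 𝓡∂ 1) (I' := I) (c := x)) _

theorem unitDeriv_comp {f : X → N} {c : unitInterval → X} (t : unitInterval)
    (hf : MDifferentiableAt I J f (c t)) (hc : MDifferentiableAt (𝓡∂ 1) I c t) :
    unitDeriv J (fun s => f (c s)) t = mfderiv I J f (c t) (unitDeriv I c t) :=
  mfderiv_comp_apply t hf hc _

/-- The bridge to calculus on the real line: extended by `projIcc`, a path becomes a function of a
real variable differentiated within `Icc 0 1`. -/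
theorem unitDeriv_eq_mfderivWithin (c : unitInterval → X) (t : unitInterval) :
    (mfderivWithin 𝓘(ℝ, ℝ) I (c ∘ projIcc 0 1 zero_le_one) (Icc 0 1) (t : ℝ) (1 : ℝ) : E) =
      unitDeriv I c t :=
  mfderivWithin_comp_projIcc_one

theorem projIcc_coe (t : unitInterval) : projIcc 0 1 zero_le_one (t : ℝ) = t :=
  projIcc_val _ t

theorem hasDerivWithinAt_pathDeriv {h : unitInterval → F} (t : unitInterval)
    (hh : MDifferentiableAt (𝓡∂ 1) 𝓘(ℝ, F) h t) :
    HasDerivWithinAt (h ∘ projIcc 0 1 zero_le_one) (pathDeriv h t : F) (Icc 0 1) t := by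
  have h1 : MDifferentiableWithinAt 𝓘(ℝ, ℝ) 𝓘(ℝ, F) (h ∘ projIcc 0 1 zero_le_one)
      (Icc (0 : ℝ) 1) (t : ℝ) := mdifferentiableWithinAt_comp_projIcc_iff.2 hh
  have h2 := h1.differentiableWithinAt.hasFDerivWithinAt.hasDerivWithinAt
  have h3 := unitDeriv_eq_mfderivWithin (I := 𝓘(ℝ, F)) h t
  rw [mfderivWithin_eq_fderivWithin] at h3
  exact h2.congr_deriv h3

theorem pathDeriv_eq_of_hasDerivWithinAt {h : unitInterval → F} {t : unitInterval} {v : F}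
    (hh : HasDerivWithinAt (h ∘ projIcc 0 1 zero_le_one) v (Icc 0 1) t) :
    (pathDeriv h t : F) = v := by
  have h1 : MDifferentiableAt (𝓡∂ 1) 𝓘(ℝ, F) h t :=
    mdifferentiableWithinAt_comp_projIcc_iff.1
      hh.hasFDerivWithinAt.differentiableWithinAt.mdifferentiableWithinAt
  have h2 : ∀ w : F, HasDerivWithinAt (h ∘ projIcc 0 1 zero_le_one) w (Icc 0 1) t → w = v :=
    fun w hw => (uniqueDiffOn_Icc zero_lt_one _ t.2).eq_deriv _ hw hh
  exact h2 _ (hasDerivWithinAt_pathDeriv t h1)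

/-- The partial velocity of a smooth map `[0, 1] × N → X` is a smooth vector field along it. -/
theorem contMDiff_unitDeriv [IsManifold I ∞ X] [IsManifold J ∞ N] {G : unitInterval × N → X}
    (hG : ContMDiff ((𝓡∂ 1).prod J) I ∞ G) :
    ContMDiff ((𝓡∂ 1).prod J) I.tangent ∞ (fun q : unitInterval × N =>
      (⟨G q, unitDeriv I (fun s => G (s, q.2)) q.1⟩ : TangentBundle I X)) := by
  have h1 : ContMDiff ((𝓡∂ 1).prod J) (((𝓡∂ 1).tangent).prod J.tangent) ∞
      (fun q : unitInterval × N => ((⟨q.1, 1⟩, ⟨q.2, 0⟩) :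
        TangentBundle (𝓡∂ 1) unitInterval × TangentBundle J N)) :=
    (contMDiff_unitInterval_one.comp contMDiff_fst).prodMk
      ((Bundle.contMDiff_zeroSection ℝ (TangentSpace J : N → Type _)).comp contMDiff_snd)
  have h2 := (hG.contMDiff_tangentMap (m := ∞) le_rfl).comp
    (contMDiff_equivTangentBundleProd_symm.comp h1)
  refine h2.congr fun q => ?_
  have h3 : MDifferentiableAt ((𝓡∂ 1).prod J) I G q := (hG q).mdifferentiableAt (by simp)
  have h4 := mfderiv_comp_apply q.1 (f := fun s : unitInterval => (s, q.2)) (g := G)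
    h3 (mdifferentiableAt_id.prodMk mdifferentiableAt_const) (1 : TangentSpace (𝓡∂ 1) q.1)
  have h5 : mfderiv (𝓡∂ 1) ((𝓡∂ 1).prod J) (fun s : unitInterval => (s, q.2)) q.1
      (1 : TangentSpace (𝓡∂ 1) q.1) = ((1 : TangentSpace (𝓡∂ 1) q.1), (0 : TangentSpace J q.2)) := by
    have h6 := mfderiv_prodMk (I := 𝓡∂ 1) (I' := 𝓡∂ 1) (I'' := J) (x := q.1) mdifferentiableAt_id
      (mdifferentiableAt_const (c := q.2))
    rw [mfderiv_id, mfderiv_const] at h6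
    exact DFunLike.congr_fun h6 _
  refine congrArg (Bundle.TotalSpace.mk _) (h4.trans ?_)
  exact congrArg (mfderiv ((𝓡∂ 1).prod J) I G q) h5

theorem contMDiff_pathDeriv [IsManifold J ∞ N] {G : unitInterval × N → F}
    (hG : ContMDiff ((𝓡∂ 1).prod J) 𝓘(ℝ, F) ∞ G) :
    ContMDiff ((𝓡∂ 1).prod J) 𝓘(ℝ, F) ∞ (fun q : unitInterval × N =>
      (pathDeriv (fun s => G (s, q.2)) q.1 : F)) :=
  (contMDiff_snd_tangentBundle_modelSpace F 𝓘(ℝ, F)).comp (contMDiff_unitDeriv hG)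

/-- A path with vanishing velocity is constant. -/
theorem eq_of_unitDeriv_eq_zero [IsManifold I ∞ X] {c : unitInterval → X}
    (hc : ContMDiff (𝓡∂ 1) I ∞ c)
    (h0 : ∀ t, unitDeriv I c t = 0) (s t : unitInterval) : c s = c t := by
  have key : IsLocallyConstant c := by
    refine (IsLocallyConstant.iff_eventually_eq c).2 fun t₀ => ?_
    have h1 : c ⁻¹' (extChartAt I (c t₀)).source ∈ 𝓝 t₀ :=
      hc.continuous.continuousAt.preimage_mem_nhds (extChartAt_source_mem_nhds _)
    obtain ⟨ε, hε, hb⟩ := Metric.mem_nhds_iff.1 h1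
    filter_upwards [Metric.ball_mem_nhds t₀ hε] with t ht
    -- On this convex set the path stays in one chart, so the mean value inequality with constant 0
    -- makes its coordinate expression constant.
    set S : Set ℝ := Icc 0 1 ∩ Metric.ball (t₀ : ℝ) ε
    have hS : Convex ℝ S := (convex_Icc 0 1).inter (convex_ball _ _)
    set h : unitInterval → E := fun s => extChartAt I (c t₀) (c s)
    have hsrc : ∀ s : unitInterval, (s : ℝ) ∈ S → c s ∈ (extChartAt I (c t₀)).source :=
      fun s hs => hb hs.2
    have hd : ∀ r ∈ S, HasFDerivWithinAt (h ∘ projIcc 0 1 zero_le_one)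
        ((0 : ℝ →L[ℝ] E)) S r := by
      intro r hr
      obtain ⟨s, rfl⟩ : ∃ s : unitInterval, (s : ℝ) = r := ⟨⟨r, hr.1⟩, rfl⟩
      have h2 : MDifferentiableAt I 𝓘(ℝ, E) (extChartAt I (c t₀)) (c s) :=
        mdifferentiableAt_extChartAt (by simpa using hsrc s hr)
      have h3 : MDifferentiableAt (𝓡∂ 1) I c s := (hc s).mdifferentiableAt (by simp)
      have h4 := hasDerivWithinAt_pathDeriv s (h2.comp s h3)
      have h5 : (pathDeriv (fun s => extChartAt I (c t₀) (c s)) s : E) = 0 := by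
        refine (unitDeriv_comp s h2 h3).trans ?_
        rw [h0]
        exact map_zero _
      have h6 := h4.hasFDerivWithinAt.mono (inter_subset_left : S ⊆ _)
      have h10 : ∀ w : E, w = 0 → ContinuousLinearMap.toSpanSingleton ℝ w = 0 := by
        rintro w rfl
        simp
      convert! h6 using 1
      exact (h10 _ h5).symm
    have h7 : ∀ s : unitInterval, (s : ℝ) ∈ S → h s = h t₀ := by
      intro s hs
      have h8 := hS.norm_image_sub_le_of_norm_hasFDerivWithin_le (C := 0) hd
        (fun _ _ => by simp) ⟨t₀.2, Metric.mem_ball_self hε⟩ hs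
      simp only [Function.comp_apply, projIcc_coe, zero_mul, norm_le_zero_iff, sub_eq_zero] at h8
      exact h8
    have ht' : (t : ℝ) ∈ S := ⟨t.2, ht⟩
    have h9 := h7 t ht'
    exact (extChartAt I (c t₀)).injOn (hsrc t ht') (mem_extChartAt_source _) h9
  exact key.apply_eq_of_isPreconnected isPreconnected_univ trivial trivial

/-- Fundamental theorem of calculus. -/
theorem pathDeriv_integral {h : unitInterval → ℝ} (hh : Continuous h) (t : unitInterval) :
    (pathDeriv (fun s : unitInterval =>
      ∫ r in (0 : ℝ)..s, h (projIcc 0 1 zero_le_one r)) t : ℝ) = h t := by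
  have h1 : Continuous fun r : ℝ => h (projIcc 0 1 zero_le_one r) :=
    hh.comp continuous_projIcc
  refine pathDeriv_eq_of_hasDerivWithinAt ?_
  have h2 := (h1.integral_hasStrictDerivAt 0 (t : ℝ)).hasDerivAt.hasDerivWithinAt (s := Icc 0 1)
  rw [projIcc_coe] at h2
  refine h2.congr_of_mem (fun r hr => ?_) t.2
  simp [projIcc_of_mem zero_le_one hr]

theorem integral_unitInterval (h : unitInterval → F) :
    ∫ t : unitInterval, h t = ∫ r in (0 : ℝ)..1, h (projIcc 0 1 zero_le_one r) := by
  rw [intervalIntegral.integral_of_le zero_le_one, ← integral_Icc_eq_integral_Ioc,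
    ← integral_subtype_comap measurableSet_Icc]
  simp only [projIcc_val]
  rfl

theorem integral_pathDeriv {h : unitInterval → ℝ} (hh : ContMDiff (𝓡∂ 1) 𝓘(ℝ, ℝ) ∞ h) :
    ∫ t : unitInterval, (pathDeriv h t : ℝ) = h 1 - h 0 := by
  have h1 : ContMDiff (𝓡∂ 1) 𝓘(ℝ, ℝ) ∞ fun t => (pathDeriv h t : ℝ) :=
    (contMDiff_snd_tangentBundle_modelSpace ℝ 𝓘(ℝ, ℝ)).comp
      ((hh.contMDiff_tangentMap (m := ∞) le_rfl).comp contMDiff_unitInterval_one)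
  have h2 : Continuous fun r : ℝ => (pathDeriv h (projIcc 0 1 zero_le_one r) : ℝ) :=
    h1.continuous.comp continuous_projIcc
  have h3 : Continuous fun r : ℝ => h (projIcc 0 1 zero_le_one r) :=
    hh.continuous.comp continuous_projIcc
  refine (integral_unitInterval fun t => (pathDeriv h t : ℝ)).trans ?_
  rw [intervalIntegral.integral_eq_sub_of_hasDerivAt_of_le zero_le_one h3.continuousOn ?_
    (h2.intervalIntegrable 0 1)]
  · simp
  · intro r hr
    obtain ⟨s, rfl⟩ : ∃ s : unitInterval, (s : ℝ) = r := ⟨⟨r, hr.1.le, hr.2.le⟩, rfl⟩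
    rw [projIcc_coe]
    exact (hasDerivWithinAt_pathDeriv s ((hh s).mdifferentiableAt (by simp))).hasDerivAt
      (Icc_mem_nhds hr.1 hr.2)

theorem pathDeriv_sub {h k : unitInterval → F} {t : unitInterval}
    (hh : MDifferentiableAt (𝓡∂ 1) 𝓘(ℝ, F) h t) (hk : MDifferentiableAt (𝓡∂ 1) 𝓘(ℝ, F) k t) :
    (pathDeriv (fun t => h t - k t) t : F) =
      pathDeriv h t - pathDeriv k t :=
  pathDeriv_eq_of_hasDerivWithinAt
    ((hasDerivWithinAt_pathDeriv t hh).sub (hasDerivWithinAt_pathDeriv t hk))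

theorem eq_of_pathDeriv_eq_pathDeriv {h k : unitInterval → F}
    (hh : ContMDiff (𝓡∂ 1) 𝓘(ℝ, F) ∞ h) (hk : ContMDiff (𝓡∂ 1) 𝓘(ℝ, F) ∞ k) (h0 : h 0 = k 0)
    (hd : ∀ t, pathDeriv h t = pathDeriv k t) (t : unitInterval) : h t = k t := by
  have h1 := eq_of_unitDeriv_eq_zero (I := 𝓘(ℝ, F)) (c := fun t => h t - k t)
    (hh.sub hk) (fun t => ?_) t 0
  · rwa [h0, sub_self, sub_eq_zero] at h1
  · have h2 := pathDeriv_sub ((hh t).mdifferentiableAt (by simp))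
      ((hk t).mdifferentiableAt (by simp))
    rw [hd, sub_self] at h2
    exact h2

end Interval

/-! ### Cartan's formula on the unit square -/

section Square

variable {E : Type*} [NormedAddCommGroup E] [NormedSpace ℝ E]
  {H : Type*} [TopologicalSpace H] {I : ModelWithCorners ℝ E H}
  {X : Type*} [TopologicalSpace X] [ChartedSpace H X]

/-- The projection of the plane to the unit square. -/
def projSquare (y : ℝ × ℝ) : unitInterval × unitInterval :=
  (projIcc 0 1 zero_le_one y.1, projIcc 0 1 zero_le_one y.2)

/-- Replaces a map on a manifold with corners by a map on a subset of the plane, to which the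
pullback results for normed spaces apply. -/
theorem contMDiffOn_comp_projSquare {u : unitInterval × unitInterval → X}
    (hu : ContMDiff ((𝓡∂ 1).prod (𝓡∂ 1)) I ∞ u) :
    ContMDiffOn 𝓘(ℝ, ℝ × ℝ) I ∞ (u ∘ projSquare) (Icc 0 1 ×ˢ Icc 0 1) := by
  refine hu.comp_contMDiffOn (ContMDiffOn.prodMk ?_ ?_)
  · exact contMDiffOn_projIcc.comp contDiff_fst.contMDiff.contMDiffOn fun y hy => hy.1
  · exact contMDiffOn_projIcc.comp contDiff_snd.contMDiff.contMDiffOn fun y hy => hy.2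

theorem uniqueDiffOn_square : UniqueDiffOn ℝ (Icc (0 : ℝ) 1 ×ˢ Icc (0 : ℝ) 1) :=
  (uniqueDiffOn_Icc zero_lt_one).prod (uniqueDiffOn_Icc zero_lt_one)

theorem mfderivWithin_square_fst {u : unitInterval × unitInterval → X}
    (hu : ContMDiff ((𝓡∂ 1).prod (𝓡∂ 1)) I ∞ u) (t s : unitInterval) :
    (mfderivWithin 𝓘(ℝ, ℝ × ℝ) I (u ∘ projSquare) (Icc 0 1 ×ˢ Icc 0 1) ((t : ℝ), (s : ℝ))
      ((1 : ℝ), (0 : ℝ)) : E) = unitDeriv I (fun t' => u (t', s)) t := by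
  have h1 : MDifferentiableWithinAt 𝓘(ℝ, ℝ × ℝ) I (u ∘ projSquare) (Icc 0 1 ×ˢ Icc 0 1)
      ((t : ℝ), (s : ℝ)) :=
    (contMDiffOn_comp_projSquare hu _ ⟨t.2, s.2⟩).mdifferentiableWithinAt (by simp)
  have h2 : HasFDerivWithinAt (fun r : ℝ => (r, (s : ℝ))) (ContinuousLinearMap.inl ℝ ℝ ℝ)
      (Icc 0 1) (t : ℝ) := (hasFDerivAt_prodMk_left _ _).hasFDerivWithinAt
  have hU := ((uniqueDiffOn_Icc (zero_lt_one (α := ℝ))) _ t.2)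
  have h3 := mfderivWithin_comp (I := 𝓘(ℝ, ℝ)) (t : ℝ) h1
    h2.differentiableWithinAt.mdifferentiableWithinAt (fun r hr => mk_mem_prod hr s.2)
    hU.uniqueMDiffWithinAt
  rw [mfderivWithin_eq_fderivWithin, h2.fderivWithin hU] at h3
  have h4 := DFunLike.congr_fun h3 (1 : ℝ)
  have h5 : (u ∘ projSquare) ∘ (fun r : ℝ => (r, (s : ℝ))) =
      (fun t' => u (t', s)) ∘ projIcc 0 1 zero_le_one := by
    ext r
    simp [projSquare]
  rw [h5] at h4
  exact h4.symm.trans (unitDeriv_eq_mfderivWithin (fun t' => u (t', s)) t)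

theorem mfderivWithin_square_snd {u : unitInterval × unitInterval → X}
    (hu : ContMDiff ((𝓡∂ 1).prod (𝓡∂ 1)) I ∞ u) (t s : unitInterval) :
    (mfderivWithin 𝓘(ℝ, ℝ × ℝ) I (u ∘ projSquare) (Icc 0 1 ×ˢ Icc 0 1) ((t : ℝ), (s : ℝ))
      ((0 : ℝ), (1 : ℝ)) : E) = unitDeriv I (fun s' => u (t, s')) s := by
  have h1 : MDifferentiableWithinAt 𝓘(ℝ, ℝ × ℝ) I (u ∘ projSquare) (Icc 0 1 ×ˢ Icc 0 1)
      ((t : ℝ), (s : ℝ)) :=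
    (contMDiffOn_comp_projSquare hu _ ⟨t.2, s.2⟩).mdifferentiableWithinAt (by simp)
  have h2 : HasFDerivWithinAt (fun r : ℝ => ((t : ℝ), r)) (ContinuousLinearMap.inr ℝ ℝ ℝ)
      (Icc 0 1) (s : ℝ) := (hasFDerivAt_prodMk_right _ _).hasFDerivWithinAt
  have hU := ((uniqueDiffOn_Icc (zero_lt_one (α := ℝ))) _ s.2)
  have h3 := mfderivWithin_comp (I := 𝓘(ℝ, ℝ)) (s : ℝ) h1
    h2.differentiableWithinAt.mdifferentiableWithinAt (fun r hr => mk_mem_prod t.2 hr)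
    hU.uniqueMDiffWithinAt
  rw [mfderivWithin_eq_fderivWithin, h2.fderivWithin hU] at h3
  have h4 := DFunLike.congr_fun h3 (1 : ℝ)
  have h5 : (u ∘ projSquare) ∘ (fun r : ℝ => ((t : ℝ), r)) =
      (fun s' => u (t, s')) ∘ projIcc 0 1 zero_le_one := by
    ext r
    simp [projSquare]
  rw [h5] at h4
  exact h4.symm.trans (unitDeriv_eq_mfderivWithin (fun s' => u (t, s')) s)

/-- Cartan's formula on a square: for a 1-form `η` and a smooth map `u` from the unit square,
`∂_t (η(∂_s u)) - ∂_s (η(∂_t u)) = dη(∂_t u, ∂_s u)`. -/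
theorem DiffForm.IsSmooth.pathDeriv_sub_pathDeriv [I.Boundaryless] [IsManifold I ∞ X]
    {η : DiffForm I X 1} (hη : η.IsSmooth)
    {u : unitInterval × unitInterval → X} (hu : ContMDiff ((𝓡∂ 1).prod (𝓡∂ 1)) I ∞ u)
    (t s : unitInterval) :
    (pathDeriv (fun t' => η (u (t', s)) ![unitDeriv I (fun s' => u (t', s')) s]) t : ℝ) -
      pathDeriv (fun s' => η (u (t, s')) ![unitDeriv I (fun t' => u (t', s')) t]) s =
    η.d (u (t, s)) ![unitDeriv I (fun t' => u (t', s)) t, unitDeriv I (fun s' => u (t, s')) s] := by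
  have hV1 : ContMDiff ((𝓡∂ 1).prod (𝓡∂ 1)) 𝓘(ℝ, ℝ) ∞ (fun q : unitInterval × unitInterval =>
      η (u q) ![unitDeriv I (fun t' => u (t', q.2)) q.1]) := by
    intro q
    refine ((hη.contMDiffWithinAt_apply (hu q).contMDiffWithinAt
      (V := fun _ q => unitDeriv I (fun t' => u (t', q.2)) q.1) (s := univ) fun _ =>
      (contMDiff_unitDeriv hu q).contMDiffWithinAt).contMDiffAt Filter.univ_mem).congr_of_eventuallyEq
      (.of_forall fun q => congrArg (η (u q)) (funext fun i => ?_))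
    fin_cases i
    rfl
  have hu' : ContMDiff ((𝓡∂ 1).prod (𝓡∂ 1)) I ∞
      (fun q : unitInterval × unitInterval => u (q.2, q.1)) :=
    hu.comp (contMDiff_snd.prodMk contMDiff_fst)
  have hV2 : ContMDiff ((𝓡∂ 1).prod (𝓡∂ 1)) 𝓘(ℝ, ℝ) ∞ (fun q : unitInterval × unitInterval =>
      η (u q) ![unitDeriv I (fun s' => u (q.1, s')) q.2]) := by
    intro q
    have h1 : ContMDiff ((𝓡∂ 1).prod (𝓡∂ 1)) I.tangent ∞ (fun q : unitInterval × unitInterval =>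
      (⟨u q, unitDeriv I (fun s' => u (q.1, s')) q.2⟩ : TangentBundle I X)) :=
      (contMDiff_unitDeriv hu').comp (contMDiff_snd.prodMk contMDiff_fst)
    refine ((hη.contMDiffWithinAt_apply (hu q).contMDiffWithinAt
      (V := fun _ q => unitDeriv I (fun s' => u (q.1, s')) q.2) (s := univ) fun _ =>
      (h1 q).contMDiffWithinAt).contMDiffAt Filter.univ_mem).congr_of_eventuallyEq
      (.of_forall fun q => congrArg (η (u q)) (funext fun i => ?_))
    fin_cases i
    rfl
  set S : Set (ℝ × ℝ) := Icc 0 1 ×ˢ Icc 0 1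
  have hmem : ((t : ℝ), (s : ℝ)) ∈ S := ⟨t.2, s.2⟩
  -- This includes edges and corners, so the formula is available at t = 0 and t = 1, where it is
  -- used later.
  have hclos : ((t : ℝ), (s : ℝ)) ∈ closure (interior S) := by
    rw [interior_prod_eq, closure_prod_eq, interior_Icc, closure_Ioo zero_ne_one]
    exact hmem
  have key := hη.fderivWithin_sub_fderivWithin (contMDiffOn_comp_projSquare hu)
    uniqueDiffOn_square hmem hclos ((1 : ℝ), (0 : ℝ)) ((0 : ℝ), (1 : ℝ))
  have hp : ∀ t s : unitInterval, projSquare ((t : ℝ), (s : ℝ)) = (t, s) := by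
    intro t s
    simp [projSquare]
  have e1 : fderivWithin ℝ (fun y => η ((u ∘ projSquare) y)
      ![mfderivWithin 𝓘(ℝ, ℝ × ℝ) I (u ∘ projSquare) S y ((0 : ℝ), (1 : ℝ))]) S
        ((t : ℝ), (s : ℝ)) ((1 : ℝ), (0 : ℝ)) =
      pathDeriv (fun t' => η (u (t', s)) ![unitDeriv I (fun s' => u (t', s')) s]) t := by
    -- The function η(∂_s u) is itself smooth on the square, so its partial derivative is identified
    -- by the same bridge lemma as those of `u`.
    refine Eq.trans ?_ (mfderivWithin_square_fst hV2 t s)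
    rw [mfderivWithin_eq_fderivWithin]
    refine DFunLike.congr_fun (fderivWithin_congr' (fun y hy => ?_) hmem) _
    obtain ⟨⟨t, s⟩, rfl⟩ : ∃ q : unitInterval × unitInterval, ((q.1 : ℝ), (q.2 : ℝ)) = y :=
      ⟨(⟨y.1, hy.1⟩, ⟨y.2, hy.2⟩), rfl⟩
    have h2 := mfderivWithin_square_snd hu t s
    have h3 : ∀ (q : unitInterval × unitInterval) (_ : q = (t, s)) (v : E),
        v = unitDeriv I (fun s' => u (t, s')) s →
          η (u q) ![v] = η (u q) ![unitDeriv I (fun s' => u (q.1, s')) q.2] := by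
      rintro q rfl v rfl
      rfl
    exact h3 _ (hp t s) _ h2
  have e2 : fderivWithin ℝ (fun y => η ((u ∘ projSquare) y)
      ![mfderivWithin 𝓘(ℝ, ℝ × ℝ) I (u ∘ projSquare) S y ((1 : ℝ), (0 : ℝ))]) S
        ((t : ℝ), (s : ℝ)) ((0 : ℝ), (1 : ℝ)) =
      pathDeriv (fun s' => η (u (t, s')) ![unitDeriv I (fun t' => u (t', s')) t]) s := by
    refine Eq.trans ?_ (mfderivWithin_square_snd hV1 t s)
    rw [mfderivWithin_eq_fderivWithin]
    refine DFunLike.congr_fun (fderivWithin_congr' (fun y hy => ?_) hmem) _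
    obtain ⟨⟨t, s⟩, rfl⟩ : ∃ q : unitInterval × unitInterval, ((q.1 : ℝ), (q.2 : ℝ)) = y :=
      ⟨(⟨y.1, hy.1⟩, ⟨y.2, hy.2⟩), rfl⟩
    have h2 := mfderivWithin_square_fst hu t s
    have h3 : ∀ (q : unitInterval × unitInterval) (_ : q = (t, s)) (v : E),
        v = unitDeriv I (fun t' => u (t', s)) t →
          η (u q) ![v] = η (u q) ![unitDeriv I (fun t' => u (t', q.2)) q.1] := by
      rintro q rfl v rfl
      rfl
    exact h3 _ (hp t s) _ h2
  refine (congrArg₂ (· - ·) e1 e2).symm.trans (key.trans ?_)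
  have h3 : ∀ (q : unitInterval × unitInterval) (_ : q = (t, s)) (v w v' w' : E), v = w →
      v' = w' → η.d (u q) ![v, v'] = η.d (u (t, s)) ![w, w'] := by
    rintro q rfl v w v' w' rfl rfl
    rfl
  exact h3 _ (hp t s) _ _ _ _ (mfderivWithin_square_fst hu t s) (mfderivWithin_square_snd hu t s)

end Square

/-! ### Integrals depending smoothly on parameters -/

section ParametricIntegral

theorem continuous_slice_of_continuousOn {E F X : Type*} [TopologicalSpace E] [TopologicalSpace F]
    [TopologicalSpace X] {S : Set E} {h : E × X → F}
    (hh : ContinuousOn h (S ×ˢ univ)) {e : E} (he : e ∈ S) : Continuous fun x => h (e, x) := by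
  have h1 : Continuous fun x : X => (e, x) := by fun_prop
  exact continuousOn_univ.1 (hh.comp h1.continuousOn fun x _ => ⟨he, trivial⟩)

variable {E F : Type} [NormedAddCommGroup E] [NormedSpace ℝ E]
  [NormedAddCommGroup F] [NormedSpace ℝ F]
  {E' : Type*} [NormedAddCommGroup E'] [NormedSpace ℝ E']
  {H' : Type*} [TopologicalSpace H'] {J : ModelWithCorners ℝ E' H'}
  {X : Type*} [TopologicalSpace X] [ChartedSpace H' X] [IsManifold J ∞ X]

theorem contMDiffOn_fderivWithin_fst {S : Set E} (hU : UniqueDiffOn ℝ S) {h : E × X → F}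
    (hh : ContMDiffOn (𝓘(ℝ, E).prod J) 𝓘(ℝ, F) ∞ h (S ×ˢ univ)) :
    ContMDiffOn (𝓘(ℝ, E).prod J) 𝓘(ℝ, E →L[ℝ] F) ∞
      (fun q : E × X => fderivWithin ℝ (fun e => h (e, q.2)) S q.1) (S ×ˢ univ) := by
  intro q hq
  have h1 : ContMDiffWithinAt ((𝓘(ℝ, E).prod J).prod 𝓘(ℝ, E)) 𝓘(ℝ, F) ∞
      (Function.uncurry fun (q : E × X) (e : E) => h (e, q.2)) ((S ×ˢ univ) ×ˢ S) (q, q.1) := by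
    refine (hh q hq).comp_of_eq (f := fun p : (E × X) × E => (p.2, p.1.2))
      (contMDiffWithinAt_snd.prodMk
        (contMDiff_snd.comp contMDiff_fst).contMDiffAt.contMDiffWithinAt)
      (fun p hp => ⟨hp.2, trivial⟩) rfl
  have h2 := ContMDiffWithinAt.mfderivWithin (I := 𝓘(ℝ, E)) (I' := 𝓘(ℝ, F)) (g := Prod.fst)
    (m := ∞) h1 contMDiffWithinAt_fst hq (fun p hp => hp.1) le_rfl hU.uniqueMDiffOn
  simpa only [inTangentCoordinates_model_space, mfderivWithin_eq_fderivWithin] using! h2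

variable [CompactSpace X] [SecondCountableTopology X] [MeasurableSpace X] [BorelSpace X]

theorem integrable_of_continuous_compactSpace (μ : Measure X) [IsFiniteMeasure μ] {k : X → F}
    (hk : Continuous k) : Integrable k μ :=
  hk.integrable_of_hasCompactSupport (HasCompactSupport.of_compactSpace k)

/-- Differentiation under the integral sign over a compact space. -/
theorem hasFDerivWithinAt_integral_compactSpace (μ : Measure X) [IsFiniteMeasure μ] {S : Set E}
    (hS : Convex ℝ S) {h : E × X → F} {D : E × X → E →L[ℝ] F}
    (hc : ContinuousOn h (S ×ˢ univ)) (hD : ContinuousOn D (S ×ˢ univ))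
    (hd : ∀ e ∈ S, ∀ x, HasFDerivWithinAt (fun e' => h (e', x)) (D (e, x)) S e)
    [CompleteSpace F] {e : E} (he : e ∈ S) :
    HasFDerivWithinAt (fun e' => ∫ x, h (e', x) ∂μ) (∫ x, D (e, x) ∂μ) S e := by
  rw [hasFDerivWithinAt_iff_isLittleO, Asymptotics.isLittleO_iff]
  intro ε hε
  obtain ⟨δ, hδ, hδε⟩ : ∃ δ > 0, δ * μ.real univ ≤ ε := by
    -- The `+ 1` covers the case of a zero measure.
    refine ⟨ε / (μ.real univ + 1), by positivity, ?_⟩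
    rw [div_mul_eq_mul_div, div_le_iff₀ (by positivity)]
    nlinarith [measureReal_nonneg (μ := μ) (s := univ)]
  -- Compactness of `X` makes the continuity of `D` at `e` uniform in `x`; the mean value inequality
  -- then bounds the first-order remainder uniformly.
  have hunif : ∀ᶠ e' in 𝓝 e, ∀ x ∈ (univ : Set X), e' ∈ S → ‖D (e', x) - D (e, x)‖ ≤ δ := by
    refine isCompact_univ.eventually_forall_of_forall_eventually fun x _ => ?_
    have h1 : ContinuousWithinAt (fun q : E × X => D q - D (e, q.2)) (S ×ˢ univ) (e, x) := by
      refine (hD _ ⟨he, trivial⟩).sub ?_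
      exact ((continuous_slice_of_continuousOn hD he).comp continuous_snd).continuousWithinAt
    have h2 : ∀ᶠ q in 𝓝[S ×ˢ univ] (e, x), ‖D q - D (e, q.2)‖ < δ :=
      Filter.Tendsto.eventually_lt_const (by simpa using hδ) h1.norm
    filter_upwards [eventually_nhdsWithin_iff.1 h2] with q hq hqS using (hq ⟨hqS, trivial⟩).le
  obtain ⟨r, hr, hball⟩ := Metric.eventually_nhds_iff_ball.1 hunif
  filter_upwards [inter_mem_nhdsWithin S (Metric.ball_mem_nhds e hr)] with e' he'
  have hconv : Convex ℝ (S ∩ Metric.ball e r) := hS.inter (convex_ball _ _)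
  have hmv : ∀ x, ‖h (e', x) - h (e, x) - D (e, x) (e' - e)‖ ≤ δ * ‖e' - e‖ := by
    intro x
    exact hconv.norm_image_sub_le_of_norm_hasFDerivWithin_le' (f := fun e' => h (e', x))
      (fun y hy => (hd y hy.1 x).mono inter_subset_left)
      (fun y hy => hball y hy.2 x trivial hy.1) ⟨he, Metric.mem_ball_self hr⟩ he'
  have i1 := integrable_of_continuous_compactSpace μ (continuous_slice_of_continuousOn hc he'.1)
  have i2 := integrable_of_continuous_compactSpace μ (continuous_slice_of_continuousOn hc he)
  have i3 := integrable_of_continuous_compactSpace μ (continuous_slice_of_continuousOn hD he)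
  rw [← integral_sub i1 i2, ContinuousLinearMap.integral_apply i3,
    ← integral_sub (f := fun x => h (e', x) - h (e, x)) (i1.sub i2)
      (i3.apply_continuousLinearMap _)]
  refine (norm_integral_le_of_norm_le_const (.of_forall hmv)).trans ?_
  calc δ * ‖e' - e‖ * μ.real univ = δ * μ.real univ * ‖e' - e‖ := by ring
    _ ≤ ε * ‖e' - e‖ := by gcongr

/-- By induction on the order: the derivative of the integral is the integral of the partial
derivative, which is again a smooth integrand. Its values lie in `E →L[ℝ] F`, so the target space is
quantified inside the induction. -/
theorem contDiffOn_integral_nat (μ : Measure X) [IsFiniteMeasure μ] {S : Set E}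
    (hS : Convex ℝ S) (hU : UniqueDiffOn ℝ S) (n : ℕ) :
    ∀ {F : Type} [NormedAddCommGroup F] [NormedSpace ℝ F] [CompleteSpace F] {h : E × X → F}
      (_ : ContMDiffOn (𝓘(ℝ, E).prod J) 𝓘(ℝ, F) ∞ h (S ×ˢ univ)),
    ContDiffOn ℝ n (fun e => ∫ x, h (e, x) ∂μ) S := by
  induction n with
  | zero =>
    intro F _ _ _ h hh
    have hD := contMDiffOn_fderivWithin_fst hU hh
    refine contDiffOn_zero.2 fun e he => ?_
    refine (hasFDerivWithinAt_integral_compactSpace μ hS hh.continuousOn hD.continuousOn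
      (fun e he x => ?_) he).continuousWithinAt
    have h1 : ContMDiffWithinAt 𝓘(ℝ, E) 𝓘(ℝ, F) ∞ (fun e => h (e, x)) S e :=
      (hh (e, x) ⟨he, trivial⟩).comp e (contMDiffWithinAt_id.prodMk contMDiffWithinAt_const)
        fun y hy => mk_mem_prod hy (mem_univ x)
    exact (h1.contDiffWithinAt.differentiableWithinAt (by simp)).hasFDerivWithinAt
  | succ n ih =>
    intro F _ _ _ h hh
    have hD := contMDiffOn_fderivWithin_fst hU hh
    have key : ∀ e ∈ S, HasFDerivWithinAt (fun e' => ∫ x, h (e', x) ∂μ)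
        (∫ x, fderivWithin ℝ (fun e => h (e, x)) S e ∂μ) S e := by
      intro e he
      refine hasFDerivWithinAt_integral_compactSpace μ hS hh.continuousOn hD.continuousOn
        (fun e he x => ?_) he
      have h1 : ContMDiffWithinAt 𝓘(ℝ, E) 𝓘(ℝ, F) ∞ (fun e => h (e, x)) S e :=
        (hh (e, x) ⟨he, trivial⟩).comp e (contMDiffWithinAt_id.prodMk contMDiffWithinAt_const)
          fun y hy => mk_mem_prod hy (mem_univ x)
      exact (h1.contDiffWithinAt.differentiableWithinAt (by simp)).hasFDerivWithinAt
    rw [Nat.cast_add_one]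
    refine (contDiffOn_succ_iff_fderivWithin hU).2
      ⟨fun e he => (key e he).differentiableWithinAt, fun hn => absurd hn (by simp), ?_⟩
    exact (ih hD).congr fun e he => (key e he).fderivWithin (hU e he)

variable {H : Type*} [TopologicalSpace H] {I : ModelWithCorners ℝ E H}
  {T : Type*} [TopologicalSpace T] [ChartedSpace H T] [IsManifold I ∞ T]

/-- The integral over a compact manifold of a smooth function depending smoothly on a parameter
is a smooth function of the parameter. -/
theorem contMDiff_integral [CompleteSpace F] (μ : Measure X) [IsFiniteMeasure μ] {h : T × X → F}
    (hh : ContMDiff (I.prod J) 𝓘(ℝ, F) ∞ h) :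
    ContMDiff I 𝓘(ℝ, F) ∞ (fun t => ∫ x, h (t, x) ∂μ) := by
  intro t₀
  rw [contMDiffAt_iff_source]
  obtain ⟨ε, hε, hb⟩ := Metric.mem_nhdsWithin_iff.1 (extChartAt_target_mem_nhdsWithin (I := I) t₀)
  -- The parameter manifold may have boundary or corners. The range of the model is convex, so `S`
  -- is a convex neighbourhood relative to that range, as the mean value argument requires.
  set S : Set E := range I ∩ Metric.ball (extChartAt I t₀ t₀) ε
  have hST : S ⊆ (extChartAt I t₀).target := fun y hy => hb ⟨hy.2, hy.1⟩
  have hS : Convex ℝ S := I.convex_range.inter (convex_ball _ _)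
  have hU : UniqueDiffOn ℝ S := I.uniqueDiffOn.inter Metric.isOpen_ball
  have h1 : ContMDiffOn (𝓘(ℝ, E).prod J) 𝓘(ℝ, F) ∞
      (fun q : E × X => h ((extChartAt I t₀).symm q.1, q.2)) (S ×ˢ univ) := by
    refine hh.comp_contMDiffOn (ContMDiffOn.prodMk ?_ contMDiff_snd.contMDiffOn)
    exact (contMDiffOn_extChartAt_symm t₀).comp contMDiff_fst.contMDiffOn fun q hq => hST hq.1
  have h2 : ContDiffOn ℝ ∞ (fun e => ∫ x, h ((extChartAt I t₀).symm e, x) ∂μ) S :=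
    contDiffOn_infty.2 fun n => contDiffOn_integral_nat μ hS hU n h1
  have h3 : S ∈ 𝓝[range I] (extChartAt I t₀ t₀) :=
    Filter.inter_mem self_mem_nhdsWithin (mem_nhdsWithin_of_mem_nhds (Metric.ball_mem_nhds _ hε))
  exact
    ((h2 _ ⟨mem_range_self _, Metric.mem_ball_self hε⟩).mono_of_mem_nhdsWithin h3).contMDiffWithinAt

end ParametricIntegral

section Primitive

variable {E : Type} [NormedAddCommGroup E] [NormedSpace ℝ E]
  {H : Type*} [TopologicalSpace H] {I : ModelWithCorners ℝ E H}
  {T : Type*} [TopologicalSpace T] [ChartedSpace H T] [IsManifold I ∞ T]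

theorem contMDiff_unitInterval_mul :
    ContMDiff ((𝓡∂ 1).prod (𝓡∂ 1)) (𝓡∂ 1) ∞
      (fun q : unitInterval × unitInterval => q.1 * q.2) := by
  refine contMDiff_iff_comp_subtypeVal_Icc.2 ⟨continuous_mul, ?_⟩
  have h1 : ContMDiff (𝓡∂ 1) 𝓘(ℝ, ℝ) ∞ (fun t : unitInterval => (t : ℝ)) := contMDiff_subtypeVal_Icc
  exact (h1.comp contMDiff_fst).mul (h1.comp contMDiff_snd)

/-- Rescaling the variable turns a variable endpoint into a parameter of the integrand over a fixed
compact domain. Smoothness of primitives is then a case of `contMDiff_integral`, including at the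
ends of the interval. -/
theorem integral_mul_projIcc {h : unitInterval → ℝ} (t : unitInterval) :
    ∫ r : unitInterval, (t : ℝ) * h (t * r) =
      ∫ r in (0 : ℝ)..t, h (projIcc 0 1 zero_le_one r) := by
  rw [integral_unitInterval (fun r : unitInterval => (t : ℝ) * h (t * r)),
    intervalIntegral.integral_const_mul]
  have h1 := intervalIntegral.mul_integral_comp_mul_left (a := 0) (b := 1)
    (f := fun r => h (projIcc 0 1 zero_le_one r)) (t : ℝ)
  rw [mul_zero, mul_one] at h1
  rw [← h1]
  refine congrArg ((t : ℝ) * ·) ?_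
  refine intervalIntegral.integral_congr fun r hr => ?_
  rw [uIcc_of_le zero_le_one] at hr
  refine congrArg h (Subtype.ext ?_)
  rw [projIcc_of_mem zero_le_one hr, projIcc_of_mem zero_le_one (unitInterval.mul_mem t.2 hr)]
  rfl

/-- The primitive in the interval variable of a smooth function is smooth. -/
theorem contMDiff_primitive {h : unitInterval × T → ℝ}
    (hh : ContMDiff ((𝓡∂ 1).prod I) 𝓘(ℝ, ℝ) ∞ h) :
    ContMDiff ((𝓡∂ 1).prod I) 𝓘(ℝ, ℝ) ∞ (fun q : unitInterval × T =>
      ∫ r in (0 : ℝ)..q.1, h (projIcc 0 1 zero_le_one r, q.2)) := by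
  have h1 : ContMDiff (((𝓡∂ 1).prod I).prod (𝓡∂ 1)) 𝓘(ℝ, ℝ) ∞
      (fun p : (unitInterval × T) × unitInterval => (p.1.1 : ℝ) * h (p.1.1 * p.2, p.1.2)) := by
    have h2 : ContMDiff (𝓡∂ 1) 𝓘(ℝ, ℝ) ∞ (fun t : unitInterval => (t : ℝ)) :=
      contMDiff_subtypeVal_Icc
    refine (h2.comp (contMDiff_fst.comp contMDiff_fst)).mul (hh.comp ?_)
    exact (contMDiff_unitInterval_mul.comp
      ((contMDiff_fst.comp contMDiff_fst).prodMk contMDiff_snd)).prodMk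
      (contMDiff_snd.comp contMDiff_fst)
  refine (contMDiff_integral (volume : Measure unitInterval) h1).congr fun q => ?_
  exact (integral_mul_projIcc (h := fun t => h (t, q.2)) q.1).symm

end Primitive

section EvalLow

variable {E : Type*} [NormedAddCommGroup E] [NormedSpace ℝ E]
  {H : Type*} [TopologicalSpace H] {I : ModelWithCorners ℝ E H} [I.Boundaryless]
  {X : Type*} [TopologicalSpace X] [ChartedSpace H X] [IsManifold I ∞ X]
  {E' : Type*} [NormedAddCommGroup E'] [NormedSpace ℝ E']
  {H' : Type*} [TopologicalSpace H'] {J : ModelWithCorners ℝ E' H'}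
  {N : Type*} [TopologicalSpace N] [ChartedSpace H' N]

theorem DiffForm.IsSmooth.contMDiff_apply_one {η : DiffForm I X 1} (hη : η.IsSmooth)
    {u : N → X} {V : ∀ y, TangentSpace I (u y)}
    (hV : ContMDiff J I.tangent ∞ (fun y => (⟨u y, V y⟩ : TangentBundle I X))) :
    ContMDiff J 𝓘(ℝ, ℝ) ∞ (fun y => η (u y) ![V y]) := by
  intro q
  have hu : ContMDiff J I ∞ u := (Bundle.contMDiff_proj (TangentSpace I)).comp hV
  refine ((hη.contMDiffWithinAt_apply (hu q).contMDiffWithinAt (V := fun _ => V) (s := univ)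
    fun _ => (hV q).contMDiffWithinAt).contMDiffAt Filter.univ_mem).congr_of_eventuallyEq
      (.of_forall fun q => congrArg (η (u q)) (funext fun i => ?_))
  fin_cases i
  rfl

theorem DiffForm.IsSmooth.contMDiff_apply_two {η : DiffForm I X 2} (hη : η.IsSmooth)
    {u : N → X} {V W : ∀ y, TangentSpace I (u y)}
    (hV : ContMDiff J I.tangent ∞ (fun y => (⟨u y, V y⟩ : TangentBundle I X)))
    (hW : ContMDiff J I.tangent ∞ (fun y => (⟨u y, W y⟩ : TangentBundle I X))) :
    ContMDiff J 𝓘(ℝ, ℝ) ∞ (fun y => η (u y) ![V y, W y]) := by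
  intro q
  have hu : ContMDiff J I ∞ u := (Bundle.contMDiff_proj (TangentSpace I)).comp hV
  refine ((hη.contMDiffWithinAt_apply (hu q).contMDiffWithinAt (V := ![V, W]) (s := univ)
    fun i => ?_).contMDiffAt Filter.univ_mem).congr_of_eventuallyEq
      (.of_forall fun q => congrArg (η (u q)) (funext fun i => ?_))
  · fin_cases i
    · exact (hV q).contMDiffWithinAt
    · exact (hW q).contMDiffWithinAt
  · fin_cases i <;> rfl

end EvalLow

/-! ### Top powers of nondegenerate alternating forms -/

section Pfaffian

variable {V : Type*} [AddCommGroup V] [Module ℝ V]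

/-- The vector of index `j` occurs only in the pair of index `j / 2`. Isolating that factor reduces
multilinearity of the product to bilinearity of `b`. -/
theorem prod_pair_update (n : ℕ) (b : V → V → ℝ) (v : Fin (2 * n) → V) (j : Fin (2 * n)) (z : V) :
    ∏ i : Fin n, b (Function.update v j z ⟨2 * i, by omega⟩)
        (Function.update v j z ⟨2 * i + 1, by omega⟩) =
      b (Function.update v j z ⟨2 * (j / 2), by omega⟩)
          (Function.update v j z ⟨2 * (j / 2) + 1, by omega⟩) *
        ∏ i ∈ Finset.univ.erase (⟨j / 2, by omega⟩ : Fin n),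
          b (v ⟨2 * i, by omega⟩) (v ⟨2 * i + 1, by omega⟩) := by
  rw [← Finset.mul_prod_erase _ _ (Finset.mem_univ (⟨j / 2, by omega⟩ : Fin n))]
  congr 1
  refine Finset.prod_congr rfl fun i hi => ?_
  have hne := Finset.ne_of_mem_erase hi
  rw [Function.update_of_ne, Function.update_of_ne] <;>
  · rintro rfl
    apply hne
    ext
    simp
    try omega

theorem update_pair_cases {n : ℕ} (v : Fin (2 * n) → V) (j : Fin (2 * n)) :
    (∀ z, Function.update v j z ⟨2 * (j / 2), by omega⟩ = z ∧
      Function.update v j z ⟨2 * (j / 2) + 1, by omega⟩ = v ⟨2 * (j / 2) + 1, by omega⟩) ∨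
    ∀ z, Function.update v j z ⟨2 * (j / 2), by omega⟩ = v ⟨2 * (j / 2), by omega⟩ ∧
      Function.update v j z ⟨2 * (j / 2) + 1, by omega⟩ = z := by
  rcases Nat.even_or_odd' (j : ℕ) with ⟨k, hk | hk⟩
  · have h1 : (⟨2 * (j / 2), by omega⟩ : Fin (2 * n)) = j := by ext; simp; omega
    have h2 : (⟨2 * (j / 2) + 1, by omega⟩ : Fin (2 * n)) ≠ j := by
      intro h; have := congrArg Fin.val h; simp at this; omega
    exact .inl fun z => ⟨by rw [h1, Function.update_self], Function.update_of_ne h2 _ _⟩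
  · have h1 : (⟨2 * (j / 2) + 1, by omega⟩ : Fin (2 * n)) = j := by ext; simp; omega
    have h2 : (⟨2 * (j / 2), by omega⟩ : Fin (2 * n)) ≠ j := by
      intro h; have := congrArg Fin.val h; simp at this; omega
    exact .inr fun z => ⟨Function.update_of_ne h2 _ _, by rw [h1, Function.update_self]⟩

/-- The product `∏_i b(v_{2i}, v_{2i+1})` as a multilinear map. -/
def pairProd (n : ℕ) (b : V →ₗ[ℝ] V →ₗ[ℝ] ℝ) : MultilinearMap ℝ (fun _ : Fin (2 * n) => V) ℝ where
  toFun v := ∏ i : Fin n, b (v ⟨2 * i, by omega⟩) (v ⟨2 * i + 1, by omega⟩)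
  map_update_add' := by
    intro _ v j x y
    obtain rfl : ‹DecidableEq (Fin (2 * n))› = instDecidableEqFin _ := Subsingleton.elim _ _
    have key := prod_pair_update n (fun v w => b v w) v j
    rw [key, key, key, ← add_mul]
    rcases update_pair_cases v j with h | h <;> simp [h]
  map_update_smul' := by
    intro _ v j c x
    obtain rfl : ‹DecidableEq (Fin (2 * n))› = instDecidableEqFin _ := Subsingleton.elim _ _
    have key := prod_pair_update n (fun v w => b v w) v j
    rw [key, key, smul_eq_mul, ← mul_assoc]
    rcases update_pair_cases v j with h | h <;> simp [h]

/-- The form `2^n b^n` as an alternating map. -/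
def pfaffianForm (n : ℕ) (b : V →ₗ[ℝ] V →ₗ[ℝ] ℝ) : V [⋀^Fin (2 * n)]→ₗ[ℝ] ℝ :=
  MultilinearMap.alternatization (pairProd n b)

theorem pfaffianForm_apply (n : ℕ) (b : V →ₗ[ℝ] V →ₗ[ℝ] ℝ) (v : Fin (2 * n) → V) :
    pfaffianForm n b v = ∑ σ : Equiv.Perm (Fin (2 * n)), ((Equiv.Perm.sign σ : ℤ) : ℝ) *
      ∏ i : Fin n, b (v (σ ⟨2 * i, by omega⟩)) (v (σ ⟨2 * i + 1, by omega⟩)) := by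
  rw [pfaffianForm, MultilinearMap.alternatization_apply]
  refine Finset.sum_congr rfl fun σ _ => ?_
  rw [Units.smul_def, zsmul_eq_mul]
  rfl

theorem alternatingMap_map_linearMap {ι : Type*} [Fintype ι] [DecidableEq ι]
    (f : V [⋀^ι]→ₗ[ℝ] ℝ) (e : Module.Basis ι ℝ V) (L : V →ₗ[ℝ] V) :
    f (fun i => L (e i)) = LinearMap.det L * f e := by
  have h1 := f.eq_smul_basis_det e
  have h2 := e.det_comp L e
  rw [e.det_self, mul_one] at h2
  have h3 := DFunLike.congr_fun h1 (L ∘ e)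
  rw [AlternatingMap.smul_apply, h2, smul_eq_mul, mul_comm] at h3
  exact h3

/-- Darboux families exist for nondegenerate alternating forms. -/
theorem exists_darboux_family [FiniteDimensional ℝ V] (b : V →ₗ[ℝ] V →ₗ[ℝ] ℝ)
    (halt : ∀ v, b v v = 0) (n : ℕ) :
    ∀ W : Submodule ℝ V, (∀ w ∈ W, (∀ w' ∈ W, b w w' = 0) → w = 0) →
      2 * n ≤ Module.finrank ℝ W →
      ∃ v : Fin n → Fin 2 → V, (∀ i k, v i k ∈ W) ∧
        ∀ i j k l, b (v i k) (v j l) = if i = j then ((l : ℕ) : ℝ) - ((k : ℕ) : ℝ) else 0 := by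
  have hneg : ∀ v w, b v w = -b w v := by
    intro v w
    have h := halt (v + w)
    simp only [map_add, LinearMap.add_apply, halt] at h
    linarith
  induction n with
  | zero => exact fun W _ _ => ⟨fun i => i.elim0, fun i => i.elim0, fun i => i.elim0⟩
  | succ n ih =>
    intro W hW hdim
    obtain ⟨e, heW, he0⟩ : ∃ e ∈ W, e ≠ 0 := by
      by_contra! h
      have : W = ⊥ := (Submodule.eq_bot_iff W).2 h
      rw [this, finrank_bot] at hdim
      omega
    obtain ⟨f', hf'W, hf'⟩ : ∃ f ∈ W, b e f ≠ 0 := by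
      by_contra! h
      exact he0 (hW e heW h)
    obtain ⟨f, hfW, hf⟩ : ∃ f ∈ W, b e f = 1 :=
      ⟨(b e f')⁻¹ • f', W.smul_mem _ hf'W, by simp [hf']⟩
    have hfe : b f e = -1 := by rw [hneg, hf]
    -- Its kernel is the orthogonal complement in `W` of the hyperbolic plane spanned by `e` and
    -- `f`; the dimension drops by at most 2.
    let L : W →ₗ[ℝ] ℝ × ℝ := ((b e).prod (b f)).comp W.subtype
    set W' : Submodule ℝ V := (LinearMap.ker L).map W.subtype
    have hmem : ∀ w, w ∈ W' ↔ w ∈ W ∧ b e w = 0 ∧ b f w = 0 := by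
      intro w
      simp [W', L, Submodule.mem_map, LinearMap.mem_ker]
      tauto
    have hdim' : 2 * n ≤ Module.finrank ℝ W' := by
      have h1 := LinearMap.finrank_range_add_finrank_ker L
      have h2 : Module.finrank ℝ (LinearMap.range L) ≤ 2 := by
        simpa using Submodule.finrank_le (LinearMap.range L)
      have h3 : Module.finrank ℝ W' = Module.finrank ℝ (LinearMap.ker L) :=
        Submodule.finrank_map_subtype_eq W _
      omega
    have hW' : ∀ w ∈ W', (∀ w' ∈ W', b w w' = 0) → w = 0 := by
      intro w hw h
      obtain ⟨hwW, hwe, hwf⟩ := (hmem w).1 hw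
      refine hW w hwW fun u hu => ?_
      -- The component of `u` orthogonal to `e` and `f`. The vector `w` is orthogonal to both, so it
      -- pairs with this component as it does with `u`.
      have h1 := h (u - b u f • e + b u e • f) ((hmem _).2 ⟨?_, ?_, ?_⟩)
      · simp only [map_add, map_sub, map_smul, hneg w e, hneg w f, hwe, hwf] at h1
        simpa using h1
      · exact W.add_mem (W.sub_mem hu (W.smul_mem _ heW)) (W.smul_mem _ hfW)
      · simp [halt, hf, hneg u e]
      · simp [halt, hfe, hneg u f]
    obtain ⟨v, hvW, hv⟩ := ih W' hW' hdim'
    refine ⟨Fin.cons ![e, f] v, fun i k => ?_, fun i j k l => ?_⟩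
    · refine Fin.cases ?_ (fun i => ?_) i
      · fin_cases k
        · exact heW
        · exact hfW
      · exact ((hmem _).1 (hvW i k)).1
    · have hev : ∀ j l, b e (v j l) = 0 := fun j l => ((hmem _).1 (hvW j l)).2.1
      have hfv : ∀ j l, b f (v j l) = 0 := fun j l => ((hmem _).1 (hvW j l)).2.2
      have hve : ∀ j l, b (v j l) e = 0 := fun j l => by rw [hneg, hev, neg_zero]
      have hvf : ∀ j l, b (v j l) f = 0 := fun j l => by rw [hneg, hfv, neg_zero]
      refine Fin.cases ?_ (fun i => ?_) i <;> refine Fin.cases ?_ (fun j => ?_) j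
      · fin_cases k <;> fin_cases l <;> simp [halt, hf, hfe]
      · rw [if_neg (Fin.succ_ne_zero j).symm]
        fin_cases k <;> simp [hev, hfv]
      · rw [if_neg (Fin.succ_ne_zero i)]
        fin_cases l <;> simp [hve, hvf]
      · simp [hv, Fin.succ_inj]

theorem sign_perm_fin_two (ρ : Equiv.Perm (Fin 2)) :
    ((Equiv.Perm.sign ρ : ℤ) : ℝ) = ((ρ 1 : ℕ) : ℝ) - ((ρ 0 : ℕ) : ℝ) := by
  have : ∀ ρ : Equiv.Perm (Fin 2), (Equiv.Perm.sign ρ : ℤ) = ((ρ 1 : ℕ) : ℤ) - ((ρ 0 : ℕ) : ℤ) := by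
    decide
  rw [this]
  push_cast
  rfl

/-- The product vanishes unless σ carries pairs to pairs. In that case σ is a permutation τ of the
pairs composed with permutations ρ_i inside them. The sign of τ enters twice and cancels, so the
sign of σ is the product of the signs of the ρ_i, which is exactly the product displayed: the term
is a square. -/
theorem sign_mul_darboux_nonneg {n : ℕ} (σ : Equiv.Perm (Fin n × Fin 2)) :
    0 ≤ ((Equiv.Perm.sign σ : ℤ) : ℝ) * ∏ i : Fin n,
      if (σ (i, 0)).1 = (σ (i, 1)).1 then
        (((σ (i, 1)).2 : ℕ) : ℝ) - (((σ (i, 0)).2 : ℕ) : ℝ) else 0 := by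
  by_cases h : ∀ i, (σ (i, 0)).1 = (σ (i, 1)).1
  swap
  · push Not at h
    obtain ⟨i, hi⟩ := h
    rw [Finset.prod_eq_zero (Finset.mem_univ i) (if_neg hi), mul_zero]
  simp only [h, if_true]
  have h1 : ∀ (i : Fin n) (k : Fin 2), (σ (i, k)).1 = (σ (i, 0)).1 := by
    intro i k
    fin_cases k
    · rfl
    · exact (h i).symm
  have hinj2 : ∀ i : Fin n, Function.Injective fun k : Fin 2 => (σ (i, k)).2 := by
    intro i k l hkl
    have : σ (i, k) = σ (i, l) := Prod.ext ((h1 i k).trans (h1 i l).symm) hkl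
    exact (Prod.ext_iff.1 (σ.injective this)).2
  have hbij2 : ∀ i : Fin n, Function.Bijective fun k : Fin 2 => (σ (i, k)).2 :=
    fun i => Finite.injective_iff_bijective.1 (hinj2 i)
  have hinj1 : Function.Injective fun i : Fin n => (σ (i, 0)).1 := by
    intro i j hij
    obtain ⟨k, hk⟩ := (hbij2 j).2 (σ (i, 0)).2
    have : σ (i, 0) = σ (j, k) := Prod.ext (hij.trans (h1 j k).symm) hk.symm
    exact (Prod.ext_iff.1 (σ.injective this)).1
  let τ : Equiv.Perm (Fin n) := Equiv.ofBijective _ (Finite.injective_iff_bijective.1 hinj1)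
  let ρ : Fin n → Equiv.Perm (Fin 2) := fun i => Equiv.ofBijective _ (hbij2 i)
  have hσ : σ = (Equiv.prodCongrLeft fun _ : Fin 2 => τ) * Equiv.prodCongrRight ρ := by
    ext ⟨i, k⟩ : 1
    exact Prod.ext (h1 i k) rfl
  have hs : (Equiv.Perm.sign σ : ℤ) = ∏ i, (Equiv.Perm.sign (ρ i) : ℤ) := by
    rw [hσ, Equiv.Perm.sign_mul, Equiv.Perm.sign_prodCongrLeft, Equiv.Perm.sign_prodCongrRight]
    simp
  have hprod : ∏ i : Fin n, ((((σ (i, 1)).2 : ℕ) : ℝ) - (((σ (i, 0)).2 : ℕ) : ℝ)) =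
      ((Equiv.Perm.sign σ : ℤ) : ℝ) := by
    rw [hs]
    push_cast
    exact Finset.prod_congr rfl fun i _ => (sign_perm_fin_two (ρ i)).symm
  rw [hprod]
  exact mul_self_nonneg _

/-- The top power of a nondegenerate alternating form does not vanish on a basis. -/
theorem pfaffianForm_ne_zero [FiniteDimensional ℝ V] (n : ℕ) (b : V →ₗ[ℝ] V →ₗ[ℝ] ℝ)
    (halt : ∀ v, b v v = 0) (hb : ∀ v, (∀ w, b v w = 0) → v = 0)
    (e : Module.Basis (Fin (2 * n)) ℝ V) : pfaffianForm n b e ≠ 0 := by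
  obtain ⟨v, -, hv⟩ := exists_darboux_family b halt n ⊤ (fun w _ h => hb w fun w' => h w' trivial)
    (by rw [finrank_top, Module.finrank_eq_card_basis e, Fintype.card_fin])
  -- Vanishing on one basis would make the form zero, so it suffices to evaluate it on the Darboux
  -- family, which need not be known to be a basis.
  rw [ne_eq, AlternatingMap.map_basis_eq_zero_iff]
  intro h0
  let q : Fin n × Fin 2 ≃ Fin (2 * n) := finProdFinEquiv.trans (finCongr (mul_comm n 2))
  have hq0 : ∀ i : Fin n, q (i, 0) = ⟨2 * i, by omega⟩ := by
    intro i; ext; simp [q, finProdFinEquiv]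
  have hq1 : ∀ i : Fin n, q (i, 1) = ⟨2 * i + 1, by omega⟩ := by
    intro i; ext; simp [q, finProdFinEquiv]; omega
  have h1 : pfaffianForm n b (fun k => v (q.symm k).1 (q.symm k).2) =
      ∑ σ : Equiv.Perm (Fin n × Fin 2), ((Equiv.Perm.sign σ : ℤ) : ℝ) * ∏ i : Fin n,
      if (σ (i, 0)).1 = (σ (i, 1)).1 then
        (((σ (i, 1)).2 : ℕ) : ℝ) - (((σ (i, 0)).2 : ℕ) : ℝ) else 0 := by
    rw [pfaffianForm_apply, ← Equiv.sum_comp q.permCongr]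
    refine Finset.sum_congr rfl fun σ _ => ?_
    rw [Equiv.Perm.sign_permCongr]
    refine congrArg _ (Finset.prod_congr rfl fun i _ => ?_)
    rw [← hq0, ← hq1]
    simp [Equiv.permCongr_apply, hv]
  rw [h0, AlternatingMap.zero_apply] at h1
  -- No cancellation is possible among nonnegative terms, and the identity permutation contributes
  -- 1.
  have h2 := (Finset.sum_eq_zero_iff_of_nonneg
    fun σ _ => sign_mul_darboux_nonneg (n := n) σ).1 h1.symm 1 (Finset.mem_univ _)
  simp at h2

end Pfaffian

/-! ### Alternating 2-forms under linear maps and changes of charts -/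

section TwoForms

variable {E : Type*} [NormedAddCommGroup E] [NormedSpace ℝ E]

theorem alternating_two_swap (β : E [⋀^Fin 2]→L[ℝ] ℝ) (v w : E) : β ![v, w] = -β ![w, v] := by
  have h := β.toAlternatingMap.map_swap ![w, v] (i := 0) (j := 1) (by decide)
  have h2 : (![w, v] ∘ Equiv.swap (0 : Fin 2) 1) = ![v, w] := by
    ext i
    fin_cases i <;> simp
  rw [h2] at h
  exact h

/-- The bilinear map underlying an alternating 2-form. -/
def bilinOf (β : E [⋀^Fin 2]→L[ℝ] ℝ) : E →ₗ[ℝ] E →ₗ[ℝ] ℝ :=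
  LinearMap.mk₂ ℝ (fun v w => β ![v, w])
    (fun v v' w => β.vecCons_add ![w] v v')
    (fun c v w => β.vecCons_smul ![w] c v)
    (fun v w w' => by
      rw [alternating_two_swap, alternating_two_swap β v w, alternating_two_swap β v w',
        ← neg_add]
      exact congrArg _ (β.vecCons_add ![v] w w'))
    (fun c v w => by
      rw [alternating_two_swap, alternating_two_swap β v w, smul_neg]
      exact congrArg _ (β.vecCons_smul ![v] c w))

theorem bilinOf_apply (β : E [⋀^Fin 2]→L[ℝ] ℝ) (v w : E) : bilinOf β v w = β ![v, w] := rfl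

theorem bilinOf_self (β : E [⋀^Fin 2]→L[ℝ] ℝ) (v : E) : bilinOf β v v = 0 := by
  have := alternating_two_swap β v v
  rw [bilinOf_apply]
  linarith

/-- An alternating form of top degree scales by the determinant. This determinant becomes the
Jacobian in the change of variables formula. -/
theorem pfaffianForm_comp {n : ℕ} (β : E [⋀^Fin 2]→L[ℝ] ℝ) (L : E →L[ℝ] E)
    (e : Module.Basis (Fin (2 * n)) ℝ E) :
    pfaffianForm n (bilinOf (β.compContinuousLinearMap L)) e =
      L.det * pfaffianForm n (bilinOf β) e := by
  have h1 := alternatingMap_map_linearMap (pfaffianForm n (bilinOf β)) e (L : E →ₗ[ℝ] E)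
  rw [ContinuousLinearMap.det, ← h1, pfaffianForm_apply, pfaffianForm_apply]
  refine Finset.sum_congr rfl fun σ _ => congrArg _ (Finset.prod_congr rfl fun i _ => ?_)
  rw [bilinOf_apply, bilinOf_apply]
  refine congrArg β (funext fun k => ?_)
  fin_cases k <;> rfl

end TwoForms

section Transform

variable {E : Type*} [NormedAddCommGroup E] [NormedSpace ℝ E]
  {H : Type*} [TopologicalSpace H] {I : ModelWithCorners ℝ E H} [I.Boundaryless]
  {X : Type*} [TopologicalSpace X] [ChartedSpace H X] [IsManifold I ∞ X] {k : ℕ}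

theorem mdifferentiableAt_extChartAt_symm {c : X} {y : E} (hy : y ∈ (extChartAt I c).target) :
    MDifferentiableAt 𝓘(ℝ, E) I (extChartAt I c).symm y :=
  ((contMDiffOn_extChartAt_symm (n := ∞) c).contMDiffAt
    ((isOpen_extChartAt_target c).mem_nhds hy)).mdifferentiableAt (by simp)

theorem differentiableAt_chart_map {φ : X → X} (hφ : MDifferentiable I I φ) {c d : X} {y : E}
    (hy : y ∈ (extChartAt I c).target)
    (hd : φ ((extChartAt I c).symm y) ∈ (extChartAt I d).source) :
    DifferentiableAt ℝ (fun y => extChartAt I d (φ ((extChartAt I c).symm y))) y :=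
  ((mdifferentiableAt_extChartAt (by simpa using hd)).comp y
    ((hφ _).comp y (mdifferentiableAt_extChartAt_symm hy))).differentiableAt

/-- The coordinate expressions of a form preserved by a map. -/
theorem DiffForm.PreservedBy.inChart_eq {η : DiffForm I X k} {φ : X → X} (h : η.PreservedBy φ)
    (hφ : MDifferentiable I I φ) {c d : X} {y : E} (hy : y ∈ (extChartAt I c).target)
    (hd : φ ((extChartAt I c).symm y) ∈ (extChartAt I d).source) :
    η.inChart c y = (η.inChart d (extChartAt I d (φ ((extChartAt I c).symm y)))).compContinuousLinearMap
      (fderiv ℝ (fun y => extChartAt I d (φ ((extChartAt I c).symm y))) y) := by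
  have hc := mdifferentiableAt_extChartAt_symm hy
  have h1 := mfderiv_comp (I := 𝓘(ℝ, E)) (I' := I) (I'' := 𝓘(ℝ, E)) y
    (g := fun x => extChartAt I d (φ x)) (f := (extChartAt I c).symm)
    ((mdifferentiableAt_extChartAt (by simpa using hd)).comp _ (hφ _)) hc
  have h2 := mfderiv_comp (I := I) (I' := I) (I'' := 𝓘(ℝ, E)) ((extChartAt I c).symm y)
    (g := extChartAt I d) (f := φ) (mdifferentiableAt_extChartAt (by simpa using hd)) (hφ _)
  ext v
  have h3 : η.inChart c y v = η (φ ((extChartAt I c).symm y)) (fun i =>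
      mfderiv I I φ ((extChartAt I c).symm y)
        (mfderiv 𝓘(ℝ, E) I (extChartAt I c).symm y (v i))) :=
    (DFunLike.congr_fun (h ((extChartAt I c).symm y)) _).symm
  rw [h3, η.apply_eq_inChart hd]
  refine congrArg (η.inChart d _) (funext fun i => ?_)
  have h4 := DFunLike.congr_fun h1 (v i)
  have h5 := DFunLike.congr_fun h2 (mfderiv 𝓘(ℝ, E) I (extChartAt I c).symm y (v i))
  rw [mfderiv_eq_fderiv] at h4
  exact h5.symm.trans h4.symm

end Transform

/-! ### The Liouville measure: gluing, invariance, finiteness, positivity -/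

namespace SymplecticForm

variable {n : ℕ} {M : Type*} [TopologicalSpace M]
  [ChartedSpace (EuclideanSpace ℝ (Fin (2 * n))) M] [IsManifold (𝓡 (2 * n)) ∞ M]
  (Ω : SymplecticForm n M)

local notation "𝔼" => EuclideanSpace ℝ (Fin (2 * n))
local notation "ψ" c => extChartAt (𝓡 (2 * n)) c

/-- The standard basis of the model space. -/
def stdBasis (n : ℕ) : Module.Basis (Fin (2 * n)) ℝ (EuclideanSpace ℝ (Fin (2 * n))) :=
  (EuclideanSpace.basisFun (Fin (2 * n)) ℝ).toBasis

theorem liouvilleDensity_eq (c : M) (y : 𝔼) :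
    Ω.liouvilleDensity c y = ((n.factorial : ℝ))⁻¹ * ((2 : ℝ) ^ n)⁻¹ *
      |pfaffianForm n (bilinOf (Ω.form.inChart c y)) (stdBasis n)| := by
  have h0 : (0 : ℝ) ≤ ((n.factorial : ℝ))⁻¹ * ((2 : ℝ) ^ n)⁻¹ := by positivity
  rw [liouvilleDensity, liouvilleForm, abs_mul, abs_of_nonneg h0, pfaffianForm_apply]
  refine congrArg (fun r : ℝ => ((n.factorial : ℝ))⁻¹ * ((2 : ℝ) ^ n)⁻¹ * |r|) ?_
  refine Finset.sum_congr rfl fun σ _ => congrArg _ (Finset.prod_congr rfl fun i _ => ?_)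
  have hb : ∀ i, stdBasis n i = EuclideanSpace.single i (1 : ℝ) := by
    intro i
    simp [stdBasis]
  rw [bilinOf_apply, hb, hb]
  refine congrArg (Ω.form ((ψ c).symm y)) (funext fun k => ?_)
  fin_cases k <;> rfl

/-- The derivative of the chart is invertible, so the coordinate expression of the symplectic form
is nondegenerate and `pfaffianForm_ne_zero` applies. -/
theorem liouvilleDensity_pos {c : M} {y : 𝔼} (hy : y ∈ (ψ c).target) :
    0 < Ω.liouvilleDensity c y := by
  rw [liouvilleDensity_eq]
  have : pfaffianForm n (bilinOf (Ω.form.inChart c y)) (stdBasis n) ≠ 0 := by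
    refine pfaffianForm_ne_zero n _ (bilinOf_self _) (fun v hv => ?_) _
    set A := mfderiv 𝓘(ℝ, 𝔼) (𝓡 (2 * n)) (ψ c).symm y
    have hA : A v = 0 := by
      refine Ω.nondegenerate _ _ fun w => ?_
      obtain ⟨w', rfl⟩ : ∃ w', A w' = w := by
        have h1 := mfderiv_extChartAt_symm_mfderiv_extChartAt ((ψ c).map_target hy) w
        rw [(ψ c).right_inv hy] at h1
        exact ⟨_, h1⟩
      refine Eq.trans ?_ (hv w')
      refine congrArg (Ω.form ((ψ c).symm y)) (funext fun k => ?_)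
      fin_cases k <;> rfl
    have h2 := mfderiv_extChartAt_mfderiv_extChartAt_symm hy v
    rw [← h2]
    exact (congrArg _ hA).trans (map_zero _)
  positivity

theorem continuousOn_liouvilleDensity (c : M) :
    ContinuousOn (Ω.liouvilleDensity c) (ψ c).target := by
  have h1 : ∀ y, Ω.liouvilleDensity c y = _ := Ω.liouvilleDensity_eq c
  rw [funext h1]
  refine continuousOn_const.mul (ContinuousOn.abs ?_)
  simp only [pfaffianForm_apply, bilinOf_apply]
  have h2 := (Ω.smooth c).continuousOn
  refine continuousOn_finsetSum _ fun σ _ => continuousOn_const.mul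
    (continuousOn_finsetProd _ fun i _ => ?_)
  exact (ContinuousAlternatingMap.apply ℝ 𝔼 ℝ _).continuous.comp_continuousOn h2

theorem liouvilleDensity_transform {φ : M → M} (h : Ω.form.PreservedBy φ)
    (hφ : MDifferentiable (𝓡 (2 * n)) (𝓡 (2 * n)) φ) {c d : M} {y : 𝔼}
    (hy : y ∈ (ψ c).target) (hd : φ ((ψ c).symm y) ∈ (ψ d).source) :
    Ω.liouvilleDensity c y = |(fderiv ℝ (fun y => (ψ d) (φ ((ψ c).symm y))) y).det| *
      Ω.liouvilleDensity d ((ψ d) (φ ((ψ c).symm y))) := by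
  rw [liouvilleDensity_eq, liouvilleDensity_eq, h.inChart_eq hφ hy hd, pfaffianForm_comp, abs_mul]
  ring

variable [MeasurableSpace M] [BorelSpace M]

theorem measurableSet_chart_preimage (c : M) {A : Set M} (hA : MeasurableSet A) :
    MeasurableSet ((ψ c).target ∩ (ψ c).symm ⁻¹' A) := by
  have h1 : MeasurableSet (ψ c).target := (isOpen_extChartAt_target c).measurableSet
  have h2 : Measurable ((ψ c).target.domRestrict (ψ c).symm) :=
    (continuousOn_iff_continuous_domRestrict.1 (continuousOn_extChartAt_symm c)).measurable
  have h3 := h1.subtype_image (h2 hA)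
  convert h3 using 1
  ext y
  simp [Set.domRestrict]
  tauto

theorem chartLiouville_apply (c : M) {A : Set M} (hA : MeasurableSet A) :
    Ω.chartLiouville c A =
      ∫⁻ y in (ψ c).target ∩ (ψ c).symm ⁻¹' A, ENNReal.ofReal (Ω.liouvilleDensity c y) := by
  have h1 : MeasurableSet (ψ c).target := (isOpen_extChartAt_target c).measurableSet
  have hB := measurableSet_chart_preimage (n := n) c hA
  rw [chartLiouville]
  set ν := ((volume : Measure 𝔼).restrict (ψ c).target).withDensity
    fun y => ENNReal.ofReal (Ω.liouvilleDensity c y)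
  have hac : ν ≪ (volume : Measure 𝔼).restrict (ψ c).target := withDensity_absolutelyContinuous _ _
  -- The inverse chart is controlled only on its target, so it is measurable only up to a set that
  -- `ν` does not charge.
  have hm : AEMeasurable (ψ c).symm ν :=
    ((continuousOn_extChartAt_symm c).aemeasurable h1).mono_ac hac
  have h2 : ν (ψ c).targetᶜ = 0 := hac (by
    rw [Measure.restrict_apply h1.compl, compl_inter_self, measure_empty])
  rw [Measure.map_apply_of_aemeasurable hm hA, ← measure_inter_conull h2, inter_comm,
    withDensity_apply _ hB, Measure.restrict_restrict hB, inter_right_comm, inter_self]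

/-- Symplectic changes of charts preserve the Liouville measure. -/
theorem chartLiouville_image {φ : M → M} (h : Ω.form.PreservedBy φ)
    (hφ : MDifferentiable (𝓡 (2 * n)) (𝓡 (2 * n)) φ) (hinj : Function.Injective φ) {c d : M}
    {A : Set M} (hA : MeasurableSet A) (hφA : MeasurableSet (φ '' A)) (hAc : A ⊆ (ψ c).source)
    (hAd : φ '' A ⊆ (ψ d).source) :
    Ω.chartLiouville d (φ '' A) = Ω.chartLiouville c A := by
  rw [chartLiouville_apply _ _ hA, chartLiouville_apply _ _ hφA]
  set u : 𝔼 → 𝔼 := fun y => (ψ d) (φ ((ψ c).symm y))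
  set B := (ψ c).target ∩ (ψ c).symm ⁻¹' A
  have hB : MeasurableSet B := measurableSet_chart_preimage c hA
  have hBd : ∀ y ∈ B, φ ((ψ c).symm y) ∈ (ψ d).source := fun y hy => hAd ⟨_, hy.2, rfl⟩
  have himg : (ψ d).target ∩ (ψ d).symm ⁻¹' (φ '' A) = u '' B := by
    ext z
    constructor
    · rintro ⟨hz, x, hx, hxz⟩
      refine ⟨(ψ c) x, ⟨(ψ c).map_source (hAc hx), ?_⟩, ?_⟩
      · rwa [mem_preimage, (ψ c).left_inv (hAc hx)]
      · simp only [u]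
        rw [(ψ c).left_inv (hAc hx), hxz, (ψ d).right_inv hz]
    · rintro ⟨y, hy, rfl⟩
      refine ⟨(ψ d).map_source (hBd y hy), _, hy.2, ?_⟩
      simp only [u]
      rw [(ψ d).left_inv (hBd y hy)]
  have hu : InjOn u B := by
    intro y hy z hz hyz
    exact (ψ c).symm.injOn hy.1 hz.1 (hinj ((ψ d).injOn (hBd y hy) (hBd z hz) hyz))
  rw [himg, lintegral_image_eq_lintegral_abs_det_fderiv_mul volume hB
    (fun y hy => (differentiableAt_chart_map hφ hy.1 (hBd y hy)).hasFDerivAt.hasFDerivWithinAt) hu]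
  refine setLIntegral_congr_fun hB fun y hy => ?_
  rw [Ω.liouvilleDensity_transform h hφ hy.1 (hBd y hy), ENNReal.ofReal_mul (abs_nonneg _)]

/-- The identity is symplectic, so the invariance statement contains independence of the chart. -/
theorem chartLiouville_eq {c d : M} {A : Set M} (hA : MeasurableSet A) (hc : A ⊆ (ψ c).source)
    (hd : A ⊆ (ψ d).source) : Ω.chartLiouville c A = Ω.chartLiouville d A := by
  have h := Ω.chartLiouville_image (φ := id) (c := c) (d := d) (A := A)
    (DiffForm.PreservedBy.one Ω.form) mdifferentiable_id Function.injective_id hA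
    (by simpa using hA) hc (by simpa using hd)
  rw [image_id] at h
  exact h.symm

theorem chartLiouville_inter_source (c : M) {A : Set M} (hA : MeasurableSet A) :
    Ω.chartLiouville c A = Ω.chartLiouville c (A ∩ (ψ c).source) := by
  rw [chartLiouville_apply _ _ hA, chartLiouville_apply _ _
    (hA.inter (isOpen_extChartAt_source c).measurableSet)]
  congr 2
  ext y
  constructor
  · rintro ⟨h1, h2⟩
    exact ⟨h1, h2, (ψ c).map_target h1⟩
  · rintro ⟨h1, h2, -⟩
    exact ⟨h1, h2⟩

section Compact

variable [CompactSpace M] [Nonempty M]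

variable (n M) in
/-- A countable measurable partition subordinate to the charts. -/
theorem exists_chart_partition : ∃ (c : ℕ → M) (D : ℕ → Set M), (∀ i, MeasurableSet (D i)) ∧
    Pairwise (Function.onFun Disjoint D) ∧ (⋃ i, D i) = univ ∧ ∀ i, D i ⊆ (ψ (c i)).source := by
  have := ChartedSpace.secondCountable_of_sigmaCompact (EuclideanSpace ℝ (Fin (2 * n))) M
  obtain ⟨s, hs, hcov⟩ := TopologicalSpace.countable_cover_nhds
    (f := fun x : M => (ψ x).source) fun x => extChartAt_source_mem_nhds x
  have hne : s.Nonempty := by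
    rcases s.eq_empty_or_nonempty with rfl | h
    · simp at hcov
      exact (univ_nonempty (α := M)).ne_empty.symm hcov |>.elim
    · exact h
  obtain ⟨c, rfl⟩ := hs.exists_eq_range hne
  refine ⟨c, disjointed fun i => (ψ (c i)).source, fun i => ?_, disjoint_disjointed _, ?_,
    fun i => disjointed_subset _ i⟩
  · exact .disjointed (fun i => (isOpen_extChartAt_source (c i)).measurableSet) i
  · rw [iUnion_disjointed, ← hcov, biUnion_range]

/-- A supremum of measures could exceed each of them on overlaps. It does not here: the sum `ν` of
the chart measures cut along a partition dominates every chart measure, because these agree on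
overlaps, and on subsets of one chart domain `ν` is that chart's measure. -/
theorem liouville_apply_of_subset {c : M} {A : Set M} (hA : MeasurableSet A)
    (hc : A ⊆ (ψ c).source) : Ω.liouville A = Ω.chartLiouville c A := by
  obtain ⟨c', D, hDm, hDd, hDu, hDs⟩ := exists_chart_partition n M
  set ν : Measure M := Measure.sum fun i => (Ω.chartLiouville (c' i)).restrict (D i)
  have hle : Ω.liouville ≤ ν := by
    refine iSup_le fun d => Measure.le_intro fun B hB _ => ?_
    rw [Measure.sum_apply _ hB, chartLiouville_inter_source _ _ hB]
    have hBs := hB.inter (isOpen_extChartAt_source (I := 𝓡 (2 * n)) d).measurableSet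
    have h1 : B ∩ (ψ d).source = ⋃ i, B ∩ (ψ d).source ∩ D i := by
      rw [← inter_iUnion, hDu, inter_univ]
    rw [h1, measure_iUnion (fun i j hij => (hDd hij).mono inter_subset_right inter_subset_right)
      fun i => hBs.inter (hDm i)]
    refine ENNReal.tsum_le_tsum fun i => ?_
    rw [Measure.restrict_apply hB, Ω.chartLiouville_eq (c := d) (d := c' i) (hBs.inter (hDm i))
      (fun x hx => hx.1.2) (fun x hx => hDs i hx.2)]
    exact measure_mono fun x hx => ⟨hx.1.1, hx.2⟩
  refine le_antisymm ((hle A).trans ?_) (le_iSup Ω.chartLiouville c A)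
  rw [Measure.sum_apply _ hA]
  have h1 : A = ⋃ i, A ∩ D i := by rw [← inter_iUnion, hDu, inter_univ]
  conv_rhs => rw [h1, measure_iUnion (fun i j hij => (hDd hij).mono inter_subset_right
    inter_subset_right) fun i => hA.inter (hDm i)]
  refine ENNReal.tsum_le_tsum fun i => ?_
  rw [Measure.restrict_apply hA, Ω.chartLiouville_eq (c := c' i) (d := c) (hA.inter (hDm i))
      (fun x hx => hDs i hx.2) (fun x hx => hc hx.1)]

/-- Symplectic diffeomorphisms preserve the Liouville measure. -/
theorem liouville_image {φ : Equiv.Perm M} (h : Ω.form.PreservedBy φ)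
    (hφ : MDifferentiable (𝓡 (2 * n)) (𝓡 (2 * n)) φ) (hm : Measurable φ)
    (hm' : Measurable (φ⁻¹ : Equiv.Perm M))
    {A : Set M} (hA : MeasurableSet A) : Ω.liouville (φ '' A) = Ω.liouville A := by
  obtain ⟨c, D, hDm, hDd, hDu, hDs⟩ := exists_chart_partition n M
  have himg : ∀ B : Set M, MeasurableSet B → MeasurableSet (φ '' B) := by
    intro B hB
    have : φ '' B = (φ⁻¹ : Equiv.Perm M) ⁻¹' B := φ.image_eq_preimage_symm B
    rw [this]
    exact hm' hB
  -- Each piece lies in one chart domain and so does its image, so `chartLiouville_image` applies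
  -- piece by piece.
  set A' : ℕ × ℕ → Set M := fun q => A ∩ (D q.1 ∩ φ ⁻¹' D q.2)
  have hA'm : ∀ q, MeasurableSet (A' q) := fun q => hA.inter ((hDm _).inter (hm (hDm _)))
  have hA'd : Pairwise (Function.onFun Disjoint A') := by
    intro q r hqr
    refine Set.disjoint_left.2 fun x hx hy => hqr ?_
    refine Prod.ext ?_ ?_
    · by_contra hne
      exact Set.disjoint_left.1 (hDd hne) hx.2.1 hy.2.1
    · by_contra hne
      exact Set.disjoint_left.1 (hDd hne) hx.2.2 hy.2.2
  have hA'u : A = ⋃ q, A' q := by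
    ext x
    constructor
    · intro hx
      obtain ⟨i, hi⟩ := mem_iUnion.1 (hDu.symm ▸ mem_univ x : x ∈ ⋃ i, D i)
      obtain ⟨j, hj⟩ := mem_iUnion.1 (hDu.symm ▸ mem_univ (φ x) : φ x ∈ ⋃ i, D i)
      exact mem_iUnion.2 ⟨(i, j), hx, hi, hj⟩
    · intro hx
      obtain ⟨q, hq⟩ := mem_iUnion.1 hx
      exact hq.1
  rw [hA'u, image_iUnion, measure_iUnion hA'd hA'm, measure_iUnion
    (fun q r hqr => (disjoint_image_iff φ.injective).2 (hA'd hqr)) fun q => himg _ (hA'm q)]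
  refine tsum_congr fun q => ?_
  have hs2 : φ '' A' q ⊆ (ψ (c q.2)).source := by
    rintro _ ⟨x, hx, rfl⟩
    exact hDs _ hx.2.2
  have hs1 : A' q ⊆ (ψ (c q.1)).source := fun x hx => hDs _ hx.2.1
  rw [Ω.liouville_apply_of_subset (himg _ (hA'm q)) hs2, Ω.liouville_apply_of_subset (hA'm q) hs1,
    Ω.chartLiouville_image h hφ φ.injective (hA'm q) (himg _ (hA'm q)) hs1 hs2]

theorem measurePreserving_liouville {φ : Equiv.Perm M} (h : Ω.form.PreservedBy φ)
    (hφ : MDifferentiable (𝓡 (2 * n)) (𝓡 (2 * n)) φ) (hm : Measurable φ)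
    (hm' : Measurable (φ⁻¹ : Equiv.Perm M)) :
    MeasurePreserving φ Ω.liouville Ω.liouville := by
  refine ⟨hm, Measure.ext fun A hA => ?_⟩
  rw [Measure.map_apply hm hA, ← Ω.liouville_image h hφ hm hm' (hm hA),
    image_preimage_eq _ φ.surjective]

/-- By continuity and positivity of the density at the centre. The upper bound serves for finiteness
of the total volume, the lower bound for its positivity. -/
theorem exists_ball_density (c : M) : ∃ (r : ℝ) (a b : ℝ), 0 < r ∧ 0 < a ∧
    Metric.ball ((ψ c) c) r ⊆ (ψ c).target ∧
    ∀ y ∈ Metric.ball ((ψ c) c) r, a ≤ Ω.liouvilleDensity c y ∧ Ω.liouvilleDensity c y ≤ b := by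
  have h1 : ContinuousAt (Ω.liouvilleDensity c) ((ψ c) c) :=
    (Ω.continuousOn_liouvilleDensity c).continuousAt
      ((isOpen_extChartAt_target c).mem_nhds (mem_extChartAt_target c))
  have hpos := Ω.liouvilleDensity_pos (mem_extChartAt_target (I := 𝓡 (2 * n)) c)
  set δ := Ω.liouvilleDensity c ((ψ c) c)
  have h2 : ∀ᶠ y in 𝓝 ((ψ c) c), Ω.liouvilleDensity c y ∈ Icc (δ / 2) (2 * δ) :=
    h1 (Icc_mem_nhds (by linarith) (by linarith))
  obtain ⟨r, hr, hb⟩ := Metric.eventually_nhds_iff_ball.1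
    (h2.and ((isOpen_extChartAt_target c).mem_nhds (mem_extChartAt_target c)))
  exact ⟨r, δ / 2, 2 * δ, hr, by positivity, fun y hy => (hb y hy).2, fun y hy => (hb y hy).1⟩

instance isFiniteMeasure_liouville : IsFiniteMeasure Ω.liouville := by
  have hloc : IsLocallyFiniteMeasure Ω.liouville := by
    refine ⟨fun c => ?_⟩
    obtain ⟨r, a, b, hr, ha, hsub, hab⟩ := Ω.exists_ball_density c
    set V : Set M := (ψ c).source ∩ (ψ c) ⁻¹' Metric.ball ((ψ c) c) r
    have hV : IsOpen V :=
      (continuousOn_extChartAt c).isOpen_inter_preimage (isOpen_extChartAt_source c)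
        Metric.isOpen_ball
    refine ⟨V, hV.mem_nhds ⟨mem_extChartAt_source c, Metric.mem_ball_self hr⟩, ?_⟩
    rw [Ω.liouville_apply_of_subset hV.measurableSet inter_subset_left,
      chartLiouville_apply _ _ hV.measurableSet]
    have hsub2 : (ψ c).target ∩ (ψ c).symm ⁻¹' V ⊆ Metric.ball ((ψ c) c) r := by
      rintro y ⟨hy, -, hy2⟩
      rwa [mem_preimage, (ψ c).right_inv hy] at hy2
    calc ∫⁻ y in (ψ c).target ∩ (ψ c).symm ⁻¹' V, ENNReal.ofReal (Ω.liouvilleDensity c y)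
        ≤ ∫⁻ y in Metric.ball ((ψ c) c) r, ENNReal.ofReal (Ω.liouvilleDensity c y) :=
          lintegral_mono_set hsub2
      _ ≤ ∫⁻ y in Metric.ball ((ψ c) c) r, ENNReal.ofReal b :=
          setLIntegral_mono measurable_const fun y hy => ENNReal.ofReal_le_ofReal (hab y hy).2
      _ < ⊤ := by
          rw [setLIntegral_const]
          exact ENNReal.mul_lt_top ENNReal.ofReal_lt_top measure_ball_lt_top
  exact ⟨isCompact_univ.measure_lt_top⟩

theorem liouville_real_univ_pos : 0 < Ω.liouville.real univ := by
  refine ENNReal.toReal_pos ?_ (measure_ne_top _ _)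
  let c : M := Classical.arbitrary M
  obtain ⟨r, a, b, hr, ha, hsub, hab⟩ := Ω.exists_ball_density c
  refine ne_of_gt (lt_of_lt_of_le ?_ (le_iSup Ω.chartLiouville c univ))
  rw [chartLiouville_apply _ _ .univ, preimage_univ, inter_univ]
  calc (0 : ENNReal) < ENNReal.ofReal a * volume (Metric.ball ((ψ c) c) r) :=
        ENNReal.mul_pos (ENNReal.ofReal_pos.2 ha).ne' (Metric.measure_ball_pos _ _ hr).ne'
    _ = ∫⁻ y in Metric.ball ((ψ c) c) r, ENNReal.ofReal a := (setLIntegral_const _ _).symm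
    _ ≤ ∫⁻ y in Metric.ball ((ψ c) c) r, ENNReal.ofReal (Ω.liouvilleDensity c y) :=
        setLIntegral_mono' measurableSet_ball fun y hy => ENNReal.ofReal_le_ofReal (hab y hy).1
    _ ≤ _ := lintegral_mono_set hsub

end Compact

end SymplecticForm

/-! ### Linear algebra of 1-forms and reduction of tangent vectors to velocities -/

section Linear

variable {E : Type*} [AddCommGroup E] [Module ℝ E] [TopologicalSpace E]

/-- The linear map underlying an alternating 1-form. -/
def linOf (β : E [⋀^Fin 1]→L[ℝ] ℝ) : E →ₗ[ℝ] ℝ where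
  toFun v := β ![v]
  map_add' v w := β.vecCons_add ![] v w
  map_smul' c v := β.vecCons_smul ![] c v

theorem oneForm_add (β : E [⋀^Fin 1]→L[ℝ] ℝ) (v w : E) : β ![v + w] = β ![v] + β ![w] :=
  (linOf β).map_add v w

theorem oneForm_smul (β : E [⋀^Fin 1]→L[ℝ] ℝ) (c : ℝ) (v : E) : β ![c • v] = c * β ![v] :=
  (linOf β).map_smul c v

/-- The kernel of `L` is a line, spanned by `v₀`, and `a` does not vanish on it. -/
theorem eq_zero_of_map_eq_zero {E F : Type*} [AddCommGroup E] [Module ℝ E]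
    [AddCommGroup F] [Module ℝ F] [FiniteDimensional ℝ E]
    (L : E →ₗ[ℝ] F) (hL : Function.Surjective L)
    (hd : Module.finrank ℝ E = Module.finrank ℝ F + 1) (a : E →ₗ[ℝ] ℝ) {v₀ : E} (h₀ : L v₀ = 0)
    (h₁ : a v₀ = 1) {v : E} (hv : L v = 0) (ha : a v = 0) : v = 0 := by
  have h2 := L.finrank_range_add_finrank_ker
  rw [LinearMap.range_eq_top.2 hL, finrank_top, hd] at h2
  have h3 : Module.finrank ℝ (LinearMap.ker L) = 1 := by omega
  have h4 : (⟨v₀, h₀⟩ : LinearMap.ker L) ≠ 0 := by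
    intro h
    have : v₀ = 0 := congrArg Subtype.val h
    simp [this] at h₁
  obtain ⟨c, hc⟩ := (finrank_eq_one_iff_of_nonzero' _ h4).1 h3 ⟨v, hv⟩
  have h5 : c • v₀ = v := congrArg Subtype.val hc
  rw [← h5, map_smul, h₁] at ha
  simp at ha
  simp [← h5, ha]

end Linear

section TangentInduction

variable {E : Type*} [NormedAddCommGroup E] [NormedSpace ℝ E]
  {H : Type*} [TopologicalSpace H] {I : ModelWithCorners ℝ E H} [I.Boundaryless]
  {X : Type*} [TopologicalSpace X] [ChartedSpace H X] [IsManifold I ∞ X] {k : ℕ}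

/-- A homogeneous property of tangent vectors may be checked on velocities of paths. -/
theorem tangent_induction (Q : ∀ x : X, TangentSpace I x → Prop)
    (hQ : ∀ c : unitInterval → X, ContMDiff (𝓡∂ 1) I ∞ c → Q (c 0) (unitDeriv I c 0))
    (hs : ∀ (x : X) (v : TangentSpace I x) (r : ℝ), 0 < r → Q x (r • v) → Q x v)
    (x : X) (v : TangentSpace I x) : Q x v := by
  set y : E := extChartAt I x x
  set w : E := mfderiv I 𝓘(ℝ, E) (extChartAt I x) x v
  obtain ⟨ε, hε, hb⟩ := Metric.isOpen_iff.1 (isOpen_extChartAt_target (I := I) x) y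
    (mem_extChartAt_target x)
  -- Chosen so that the whole segment from `y` to `y + r • w` stays in the chart. Only `r • v` is
  -- then the velocity of a path defined on the unit interval; the homogeneity hypothesis `hs`
  -- removes the factor.
  set r : ℝ := ε / (2 * (‖w‖ + 1))
  have hr : 0 < r := by positivity
  have hmem : ∀ t : unitInterval, y + ((t : ℝ) * r) • w ∈ (extChartAt I x).target := by
    intro t
    apply hb
    rw [Metric.mem_ball, dist_eq_norm, add_sub_cancel_left, norm_smul, Real.norm_eq_abs,
      abs_of_nonneg (mul_nonneg t.2.1 hr.le)]
    have h1 : (t : ℝ) * r * ‖w‖ ≤ r * ‖w‖ :=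
      mul_le_mul_of_nonneg_right (mul_le_of_le_one_left hr.le t.2.2) (norm_nonneg _)
    have h2 : r * ‖w‖ < ε := by
      have : r * (2 * (‖w‖ + 1)) = ε := by simp only [r]; field_simp
      nlinarith [norm_nonneg w]
    linarith
  have hl : ContMDiff (𝓡∂ 1) 𝓘(ℝ, E) ∞ (fun t : unitInterval => y + ((t : ℝ) * r) • w) :=
    contMDiff_const.add ((contMDiff_subtypeVal_Icc.mul contMDiff_const).smul contMDiff_const)
  set c : unitInterval → X := fun t => (extChartAt I x).symm (y + ((t : ℝ) * r) • w)
  have hc : ContMDiff (𝓡∂ 1) I ∞ c :=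
    (contMDiffOn_extChartAt_symm x).comp_contMDiff hl hmem
  have hc0 : c 0 = x := by simp [c, y]
  have hld : (pathDeriv (fun t : unitInterval => y + ((t : ℝ) * r) • w) 0 : E) = r • w := by
    refine pathDeriv_eq_of_hasDerivWithinAt ?_
    have h1 : HasDerivWithinAt (fun t : ℝ => y + (t * r) • w) (r • w) (Icc 0 1)
        ((0 : unitInterval) : ℝ) := by
      have := (((hasDerivAt_id ((0 : unitInterval) : ℝ)).mul_const r).smul_const w).const_add y
      simpa using this.hasDerivWithinAt
    refine h1.congr_of_mem (fun t ht => ?_) (0 : unitInterval).2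
    simp [projIcc_of_mem zero_le_one ht]
  have hd : (unitDeriv I c 0 : E) = r • (v : E) := by
    have h1 : MDifferentiableAt 𝓘(ℝ, E) I (extChartAt I x).symm
        ((fun t : unitInterval => y + ((t : ℝ) * r) • w) 0) :=
      mdifferentiableAt_extChartAt_symm (hmem 0)
    have h2 := unitDeriv_comp (0 : unitInterval) h1 ((hl 0).mdifferentiableAt (by simp))
    refine Eq.trans h2 ?_
    have h3 : ∀ z : E, z = y → ∀ u : E, u = r • w →
        (mfderiv 𝓘(ℝ, E) I (extChartAt I x).symm z u : E) = r • (v : E) := by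
      rintro z rfl u rfl
      refine (map_smul _ r w).trans (congrArg (r • ·) ?_)
      exact mfderiv_extChartAt_symm_mfderiv_extChartAt (mem_extChartAt_source x) v
    exact h3 _ (by simp) _ hld
  have key : ∀ z, z = x → ∀ u : TangentSpace I z, (u : E) = r • (v : E) → Q z u → Q x v := by
    rintro z rfl u hu hz
    refine hs _ v r hr ?_
    have : u = r • v := hu
    rwa [← this]
  exact key _ hc0 _ hd (hQ c hc)

/-- The inverse chart and its composite with `φ` pull `η` back to the same form on the chart target.
Exterior derivatives commute with both pullbacks, and the derivative of the inverse chart is onto,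
so it can be cancelled. -/
theorem DiffForm.PreservedBy.d {η : DiffForm I X k} {φ : X → X} (h : η.PreservedBy φ)
    (hη : η.IsSmooth) (hφ : ContMDiff I I ∞ φ) : η.d.PreservedBy φ := by
  intro x
  set y : E := extChartAt I x x
  have hy : y ∈ (extChartAt I x).target := mem_extChartAt_target x
  have ho := isOpen_extChartAt_target (I := I) x
  have hyc : y ∈ closure (interior (extChartAt I x).target) := by
    rw [ho.interior_eq]
    exact subset_closure hy
  have hu := contMDiffOn_extChartAt_symm (I := I) (n := ∞) x
  have hu' : ContMDiffOn 𝓘(ℝ, E) I ∞ (fun y => φ ((extChartAt I x).symm y))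
    (extChartAt I x).target := hφ.comp_contMDiffOn hu
  have hD : ∀ y ∈ (extChartAt I x).target, ∀ v,
      mfderivWithin 𝓘(ℝ, E) I (fun y => φ ((extChartAt I x).symm y)) (extChartAt I x).target y v =
      mfderiv I I φ ((extChartAt I x).symm y)
        (mfderivWithin 𝓘(ℝ, E) I (extChartAt I x).symm (extChartAt I x).target y v) := by
    intro y hy v
    exact DFunLike.congr_fun (mfderiv_comp_mfderivWithin y (hφ _ |>.mdifferentiableAt (by simp))
      ((hu y hy).mdifferentiableWithinAt (by simp))
      (ho.uniqueDiffOn.uniqueMDiffOn y hy)) v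
  have h1 := hη.extDerivWithin_pullbackWithin hu ho.uniqueDiffOn hy hyc
  have h2 := hη.extDerivWithin_pullbackWithin hu' ho.uniqueDiffOn hy hyc
  have h3 : ∀ y ∈ (extChartAt I x).target,
      η.pullbackWithin (fun y => φ ((extChartAt I x).symm y)) (extChartAt I x).target y =
      η.pullbackWithin (extChartAt I x).symm (extChartAt I x).target y := by
    intro y hy
    ext v
    refine Eq.trans ?_ (DFunLike.congr_fun (h ((extChartAt I x).symm y)) _)
    exact congrArg (η (φ ((extChartAt I x).symm y))) (funext fun i => hD y hy (v i))
  have h4 := extDerivWithin_congr h3 (h3 y hy)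
  rw [h1, h2] at h4
  have key : ∀ z, z = x → ∀ A : E →L[ℝ] TangentSpace I z, (∀ v : E, ∃ u, A u = v) →
      (∀ v : Fin (k + 1) → E, η.d (φ z) (fun i => mfderiv I I φ z (A (v i))) =
        η.d z (fun i => A (v i))) →
      (η.d (φ x)).compContinuousLinearMap (mfderiv I I φ x) = η.d x := by
    rintro z rfl A hA hz
    ext v
    choose u hu using fun i => hA (v i)
    have := hz u
    have e : (fun i => A (u i)) = v := funext hu
    refine Eq.trans ?_ (this.trans (congrArg _ e))
    exact congrArg (η.d (φ z)) (funext fun i => congrArg (mfderiv I I φ z) (hu i).symm)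
  refine key _ (extChartAt_to_inv x)
    (mfderivWithin 𝓘(ℝ, E) I (extChartAt I x).symm (extChartAt I x).target y) ?_ ?_
  · intro v
    have h5 : mfderivWithin 𝓘(ℝ, E) I (extChartAt I x).symm (extChartAt I x).target y =
        mfderiv 𝓘(ℝ, E) I (extChartAt I x).symm y :=
      mfderivWithin_of_mem_nhds (ho.mem_nhds hy)
    rw [h5]
    exact ⟨_, mfderiv_extChartAt_symm_mfderiv_extChartAt (mem_extChartAt_source x) v⟩
  · intro v
    refine Eq.trans ?_ (DFunLike.congr_fun h4 v)
    exact congrArg (η.d (φ ((extChartAt I x).symm y))) (funext fun i => (hD y hy (v i)).symm)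

end TangentInduction

/-! ### Geometry of the bundle: local sections, vertical vectors, the connection form -/

namespace PrequantumBundle

variable {n : ℕ} {M : Type*} [TopologicalSpace M]
  [ChartedSpace (EuclideanSpace ℝ (Fin (2 * n))) M] {Ω : SymplecticForm n M}
  {P : Type*} [TopologicalSpace P]
  [ChartedSpace (EuclideanSpace ℝ (Fin (2 * n + 1))) P] [MulAction Circle P]
  (B : PrequantumBundle Ω P)

local notation "𝓜" => 𝓡 (2 * n)
local notation "𝓟" => 𝓡 (2 * n + 1)

/-- Freeze the circle coordinate of `p` in a local trivialisation. -/
theorem exists_section_through (p : P) : ∃ (U : Set M) (σ : M → P), IsOpen U ∧ B.proj p ∈ U ∧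
    ContMDiffOn 𝓜 𝓟 ∞ σ U ∧ (∀ y ∈ U, B.proj (σ y) = y) ∧ σ (B.proj p) = p := by
  obtain ⟨U, e, hU, hx, hs, ht, -, h2, h3⟩ := B.locally_trivial (B.proj p)
  have hp : p ∈ e.source := by rw [hs]; exact hx
  refine ⟨U, fun y => e.symm (y, (e p).2), hU, hx, ?_, fun y hy => ?_, ?_⟩
  · refine h2.comp (contMDiff_id.prodMk contMDiff_const).contMDiffOn fun y hy => ?_
    rw [ht]
    exact ⟨hy, trivial⟩
  · have hy' : (y, (e p).2) ∈ e.target := by rw [ht]; exact ⟨hy, trivial⟩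
    have := (h3 _ (e.map_target hy')).1
    rw [e.right_inv hy'] at this
    exact this.symm
  · have : (B.proj p, (e p).2) = e p := Prod.ext (h3 p hp).1.symm rfl
    exact (congrArg e.symm this).trans (e.left_inv hp)

theorem proj_surjective : Function.Surjective B.proj := by
  intro x
  obtain ⟨U, e, hU, hx, hs, ht, -, h2, h3⟩ := B.locally_trivial x
  have hy' : (x, (1 : Circle)) ∈ e.target := by rw [ht]; exact ⟨hx, trivial⟩
  have := (h3 _ (e.map_target hy')).1
  rw [e.right_inv hy'] at this
  exact ⟨_, this.symm⟩

theorem exists_smul_eq {p q : P} (h : B.proj p = B.proj q) : ∃ z : Circle, z • p = q := by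
  obtain ⟨U, e, hU, hx, hs, ht, -, h2, h3⟩ := B.locally_trivial (B.proj p)
  have hp : p ∈ e.source := by rw [hs]; exact hx
  have hq : q ∈ e.source := by rw [hs, mem_preimage, ← h]; exact hx
  refine ⟨(e q).2 * (e p).2⁻¹, ?_⟩
  have hz : ((e q).2 * (e p).2⁻¹) • p ∈ e.source := by
    rw [hs, mem_preimage, B.proj_smul]; exact hx
  refine e.injOn hz hq ?_
  rw [(h3 p hp).2, inv_mul_cancel_right, h, ← (h3 q hq).1]

/-- Smoothness on the base may be checked on the total space. -/
theorem contMDiff_of_comp_proj {E' : Type*} [NormedAddCommGroup E'] [NormedSpace ℝ E']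
    {H' : Type*} [TopologicalSpace H'] {J : ModelWithCorners ℝ E' H'}
    {N : Type*} [TopologicalSpace N] [ChartedSpace H' N]
    {E'' : Type*} [NormedAddCommGroup E''] [NormedSpace ℝ E'']
    {H'' : Type*} [TopologicalSpace H''] {K : ModelWithCorners ℝ E'' H''}
    {Y : Type*} [TopologicalSpace Y] [ChartedSpace H'' Y] {h : N × M → Y}
    (hh : ContMDiff (J.prod 𝓟) K ∞ (fun q : N × P => h (q.1, B.proj q.2))) :
    ContMDiff (J.prod 𝓜) K ∞ h := by
  rintro ⟨a, x⟩
  obtain ⟨p, rfl⟩ := B.proj_surjective x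
  obtain ⟨U, σ, hU, hx, hσ, hσ', -⟩ := B.exists_section_through p
  have h1 : ContMDiffOn (J.prod 𝓜) (J.prod 𝓟) ∞ (fun q : N × M => (q.1, σ q.2)) (univ ×ˢ U) :=
    contMDiff_fst.contMDiffOn.prodMk (hσ.comp contMDiff_snd.contMDiffOn fun q hq => hq.2)
  have h2 : ContMDiffOn (J.prod 𝓜) K ∞ h (univ ×ˢ U) := by
    refine (hh.comp_contMDiffOn h1).congr fun q hq => ?_
    simp [hσ' _ hq.2]
  exact h2.contMDiffAt ((isOpen_univ.prod hU).mem_nhds ⟨trivial, hx⟩)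

theorem mdifferentiable_proj : MDifferentiable 𝓟 𝓜 B.proj :=
  B.smooth_proj.mdifferentiable (by simp)

theorem contMDiff_exp_smul (B : PrequantumBundle Ω P) (p : P) :
    ContMDiff 𝓘(ℝ, ℝ) 𝓟 ∞ (fun θ : ℝ => Circle.exp θ • p) :=
  B.smooth_smul.comp (contMDiff_circleExp.prodMk contMDiff_const)

/-- The derivative of a local section through `p` is a right inverse. -/
theorem mfderiv_proj_surjective (p : P) :
    Function.Surjective (mfderiv 𝓟 𝓜 B.proj p) := by
  intro w
  obtain ⟨U, σ, hU, hx, hσ, hσ', hp⟩ := B.exists_section_through p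
  have hs : MDifferentiableAt 𝓜 𝓟 σ (B.proj p) :=
    (hσ.contMDiffAt (hU.mem_nhds hx)).mdifferentiableAt (by simp)
  have h1 := mfderiv_comp (I := 𝓜) (I' := 𝓟) (I'' := 𝓜) (B.proj p) (g := B.proj) (f := σ)
    (B.mdifferentiable_proj _) hs
  have h2 : mfderiv 𝓜 𝓜 (B.proj ∘ σ) (B.proj p) = mfderiv 𝓜 𝓜 id (B.proj p) := by
    refine Filter.EventuallyEq.mfderiv_eq ?_
    filter_upwards [hU.mem_nhds hx] with y hy using hσ' y hy
  have h3 : ∀ u : EuclideanSpace ℝ (Fin (2 * n)),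
      (mfderiv 𝓜 𝓜 (B.proj ∘ σ) (B.proj p) u : EuclideanSpace ℝ (Fin (2 * n))) = u := by
    intro u
    refine (DFunLike.congr_fun h2 u).trans ?_
    rw [mfderiv_id]
    rfl
  have key : ∀ q : P, q = p → ∀ v : EuclideanSpace ℝ (Fin (2 * n + 1)),
      (mfderiv 𝓟 𝓜 B.proj q v : EuclideanSpace ℝ (Fin (2 * n))) = w →
      ∃ v, mfderiv 𝓟 𝓜 B.proj p v = w := by
    rintro q rfl v hv
    exact ⟨v, hv⟩
  exact key (σ (B.proj p)) hp (mfderiv 𝓜 𝓟 σ (B.proj p) w)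
    ((DFunLike.congr_fun h1 w).symm.trans (h3 w))

theorem mfderiv_proj_circleField (p : P) : mfderiv 𝓟 𝓜 B.proj p (circleField p) = 0 := by
  have hz : ∀ q, q = p → ∀ v : EuclideanSpace ℝ (Fin (2 * n + 1)),
      (mfderiv 𝓟 𝓜 B.proj q v : EuclideanSpace ℝ (Fin (2 * n))) = mfderiv 𝓟 𝓜 B.proj p v := by
    rintro q rfl v
    rfl
  have h1 := mfderiv_comp_apply (I := 𝓘(ℝ, ℝ)) (I' := 𝓟) (I'' := 𝓜) (0 : ℝ) (g := B.proj)
    (f := fun θ : ℝ => Circle.exp θ • p) (B.mdifferentiable_proj _)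
    ((B.contMDiff_exp_smul p _).mdifferentiableAt (by simp)) (1 : ℝ)
  have h2 : B.proj ∘ (fun θ : ℝ => Circle.exp θ • p) = fun _ => B.proj p := by
    ext θ
    simp [B.proj_smul]
  have h3 : mfderiv 𝓘(ℝ, ℝ) 𝓜 (B.proj ∘ (fun θ : ℝ => Circle.exp θ • p)) 0 = 0 := by
    rw [h2]
    exact mfderiv_const
  refine (hz (Circle.exp 0 • p) (by simp) _).symm.trans (h1.symm.trans ?_)
  exact DFunLike.congr_fun h3 (1 : ℝ)

/-- A horizontal vertical vector vanishes. -/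
theorem eq_zero_of_horizontal {p : P} {v : TangentSpace 𝓟 p} (hv : mfderiv 𝓟 𝓜 B.proj p v = 0)
    (ha : B.α p ![v] = 0) : v = 0 := by
  -- The dimensions 2n + 1 and 2n leave a one-dimensional kernel, which is spanned by the circle
  -- field; α equals 1 on that field.
  have key := eq_zero_of_map_eq_zero (E := EuclideanSpace ℝ (Fin (2 * n + 1)))
    (F := EuclideanSpace ℝ (Fin (2 * n)))
  refine key (mfderiv 𝓟 𝓜 B.proj p).toLinearMap (B.mfderiv_proj_surjective p) ?_
    (linOf (B.α p)) (B.mfderiv_proj_circleField p) (B.α_circleField p) hv ha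
  exact finrank_euclideanSpace_fin.trans (congrArg (· + 1) finrank_euclideanSpace_fin.symm)

theorem eq_of_horizontal {p : P} {v w : TangentSpace 𝓟 p}
    (hv : mfderiv 𝓟 𝓜 B.proj p v = mfderiv 𝓟 𝓜 B.proj p w) (ha : B.α p ![v] = B.α p ![w]) :
    v = w := by
  refine sub_eq_zero.1 (B.eq_zero_of_horizontal ?_ ?_)
  · rw [map_sub, hv, sub_self]
  · exact ((linOf (B.α p)).map_sub v w).trans (sub_eq_zero.2 ha)

theorem d_α_apply (p : P) (v w : TangentSpace 𝓟 p) :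
    B.α.d p ![v, w] = -Ω.form (B.proj p) ![mfderiv 𝓟 𝓜 B.proj p v, mfderiv 𝓟 𝓜 B.proj p w] := by
  have h1 := DFunLike.congr_fun (B.curvature p) ![v, w]
  have h2 : B.α.d p ![v, w] + Ω.form (B.proj p) (fun i => mfderiv 𝓟 𝓜 B.proj p (![v, w] i)) = 0 :=
    h1
  have h3 : (fun i => mfderiv 𝓟 𝓜 B.proj p (![v, w] i)) =
      ![mfderiv 𝓟 𝓜 B.proj p v, mfderiv 𝓟 𝓜 B.proj p w] := by
    funext i
    fin_cases i <;> rfl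
  have h4 := congrArg (Ω.form (B.proj p)) h3
  linarith

/-- The connection form on the velocity of a path moved by the circle action. -/
theorem α_unitDeriv_exp_smul {θ : unitInterval → ℝ} {c : unitInterval → P} (t : unitInterval)
    (hθ : MDifferentiableAt (𝓡∂ 1) 𝓘(ℝ, ℝ) θ t) (hc : MDifferentiableAt (𝓡∂ 1) 𝓟 c t) :
    B.α (Circle.exp (θ t) • c t) ![unitDeriv 𝓟 (fun s => Circle.exp (θ s) • c s) t] =
      pathDeriv θ t + B.α (c t) ![unitDeriv 𝓟 c t] := by
  set z := Circle.exp (θ t)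
  have hF : MDifferentiableAt (𝓘(ℝ, ℝ).prod 𝓟) 𝓟 (fun q : ℝ × P => Circle.exp q.1 • q.2)
      (θ t, c t) :=
    ((B.smooth_smul.comp ((contMDiff_circleExp.comp contMDiff_fst).prodMk contMDiff_snd)) _
      ).mdifferentiableAt (n := ∞) (by simp)
  have hp : MDifferentiableAt (𝓡∂ 1) (𝓘(ℝ, ℝ).prod 𝓟) (fun s => (θ s, c s)) t := hθ.prodMk hc
  have h1 := mfderiv_comp_apply t hF hp (1 : TangentSpace (𝓡∂ 1) t)
  have h2 := DFunLike.congr_fun (mfderiv_prodMk hθ hc) (1 : TangentSpace (𝓡∂ 1) t)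
  have h3 := mfderiv_prod_eq_add_apply hF
    (v := ((pathDeriv (F := ℝ) θ t, unitDeriv 𝓟 c t) : TangentSpace (𝓘(ℝ, ℝ).prod 𝓟) (θ t, c t)))
  -- The product rule splits the velocity into a vertical part, on which α is the angular speed, and
  -- the velocity of `c` moved by a fixed rotation, on which α is unchanged by invariance.
  have h4 : unitDeriv 𝓟 (fun s => Circle.exp (θ s) • c s) t =
      mfderiv 𝓘(ℝ, ℝ) 𝓟 (fun s => Circle.exp s • c t) (θ t) (pathDeriv (F := ℝ) θ t) +
      mfderiv 𝓟 𝓟 (fun p => Circle.exp (θ t) • p) (c t) (unitDeriv 𝓟 c t) :=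
    (h1.trans (congrArg (mfderiv (𝓘(ℝ, ℝ).prod 𝓟) 𝓟 (fun q : ℝ × P => Circle.exp q.1 • q.2)
      (θ t, c t)) h2)).trans h3
  have h5 : B.α (z • c t) ![mfderiv 𝓟 𝓟 (fun p => z • p) (c t) (unitDeriv 𝓟 c t)] =
      B.α (c t) ![unitDeriv 𝓟 c t] := by
    refine Eq.trans ?_ (DFunLike.congr_fun (B.α_invariant z (c t)) ![unitDeriv 𝓟 c t])
    refine congrArg (B.α (z • c t)) (funext fun i => ?_)
    fin_cases i
    rfl
  have h6 : B.α (z • c t)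
      ![mfderiv 𝓘(ℝ, ℝ) 𝓟 (fun s => Circle.exp s • c t) (θ t) (pathDeriv (F := ℝ) θ t)] =
      pathDeriv θ t := by
    -- The circle field is defined by the derivative at angle 0; shifting the angle by `θ t` moves
    -- the base point to `z • c t` and reduces to that case.
    have h7 : ∀ r : ℝ, (mfderiv 𝓘(ℝ, ℝ) 𝓟 (fun s => Circle.exp s • c t) (θ t) r :
        EuclideanSpace ℝ (Fin (2 * n + 1))) = r • circleField (z • c t) := by
      intro r
      have e1 : (fun s : ℝ => Circle.exp s • c t) =
          (fun s => Circle.exp s • z • c t) ∘ (fun s => s - θ t) := by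
        ext s
        simp [z, smul_smul, ← Circle.exp_add]
      have hg : MDifferentiableAt 𝓘(ℝ, ℝ) 𝓟 (fun s => Circle.exp s • z • c t) (θ t - θ t) :=
        (B.contMDiff_exp_smul (z • c t) _).mdifferentiableAt (by simp)
      have e2 := mfderiv_comp_apply (I := 𝓘(ℝ, ℝ)) (I' := 𝓘(ℝ, ℝ)) (I'' := 𝓟) (θ t)
        (g := (fun s => Circle.exp s • z • c t)) (f := (fun s : ℝ => s - θ t)) hg
        ((differentiableAt_id.sub_const _).mdifferentiableAt) r
      have e3 : (mfderiv 𝓘(ℝ, ℝ) 𝓘(ℝ, ℝ) (fun s : ℝ => s - θ t) (θ t) r : ℝ) = r := by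
        rw [mfderiv_eq_fderiv, fderiv_sub_const]
        exact DFunLike.congr_fun fderiv_fun_id r
      have e4 : ∀ x : ℝ, x = 0 → ∀ r' : ℝ, r' = r →
          (mfderiv 𝓘(ℝ, ℝ) 𝓟 (fun s => Circle.exp s • z • c t) x r' :
          EuclideanSpace ℝ (Fin (2 * n + 1))) = r • circleField (z • c t) := by
        rintro x rfl r' rfl
        refine Eq.trans ?_ ((mfderiv 𝓘(ℝ, ℝ) 𝓟 (fun s => Circle.exp s • z • c t) 0).map_smul
          r' (1 : ℝ))
        exact congrArg (mfderiv 𝓘(ℝ, ℝ) 𝓟 (fun s => Circle.exp s • z • c t) 0)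
          (mul_one r').symm
      have e5 : ∀ u : ℝ → P, u = (fun s => Circle.exp s • z • c t) ∘ (fun s => s - θ t) →
          (mfderiv 𝓘(ℝ, ℝ) 𝓟 u (θ t) r : EuclideanSpace ℝ (Fin (2 * n + 1))) =
            r • circleField (z • c t) := by
        rintro u rfl
        exact e2.trans (e4 _ (sub_self _) _ e3)
      exact e5 _ e1
    have h8 : B.α (z • c t) ![(pathDeriv (F := ℝ) θ t) • circleField (z • c t)] = pathDeriv θ t := by
      refine (oneForm_smul (B.α (z • c t)) _ _).trans ?_
      rw [B.α_circleField, mul_one]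
    refine Eq.trans (congrArg (B.α (z • c t)) (funext fun i => ?_)) h8
    fin_cases i
    exact h7 _
  refine (congrArg (B.α (z • c t)) (congrArg (fun v => ![v]) h4)).trans ?_
  refine (oneForm_add (B.α (z • c t)) _ _).trans ?_
  exact congrArg₂ (· + ·) h6 h5

end PrequantumBundle

theorem DiffForm.PreservedBy.apply_one {E : Type*} [NormedAddCommGroup E] [NormedSpace ℝ E]
    {H : Type*} [TopologicalSpace H] {I : ModelWithCorners ℝ E H}
    {X : Type*} [TopologicalSpace X] [ChartedSpace H X] {η : DiffForm I X 1} {φ : X → X}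
    (h : η.PreservedBy φ) (x : X) (v : TangentSpace I x) :
    η (φ x) ![mfderiv I I φ x v] = η x ![v] := by
  rw [← h x]
  refine congrArg (η (φ x)) (funext fun i => ?_)
  fin_cases i
  rfl

theorem pathDeriv_const {F : Type*} [NormedAddCommGroup F] [NormedSpace ℝ F] (a : F)
    (t : unitInterval) : pathDeriv (fun _ => a) t = 0 :=
  unitDeriv_const (I := 𝓘(ℝ, F)) a t

theorem twoForm_smul_right {E : Type*} [NormedAddCommGroup E] [NormedSpace ℝ E]
    (β : E [⋀^Fin 2]→L[ℝ] ℝ) (u : E) (r : ℝ) (v : E) : β ![u, r • v] = r * β ![u, v] :=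
  (bilinOf β u).map_smul r v

/-! ### Families of automorphisms: descent to the base and Hamiltonians -/

namespace PrequantumBundle

variable {n : ℕ} {M : Type*} [TopologicalSpace M]
  [ChartedSpace (EuclideanSpace ℝ (Fin (2 * n))) M] {Ω : SymplecticForm n M}
  {P : Type*} [TopologicalSpace P]
  [ChartedSpace (EuclideanSpace ℝ (Fin (2 * n + 1))) P] [MulAction Circle P]
  (B : PrequantumBundle Ω P)

local notation "𝓜" => 𝓡 (2 * n)
local notation "𝓟" => 𝓡 (2 * n + 1)

variable {E' : Type*} [NormedAddCommGroup E'] [NormedSpace ℝ E']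
  {H' : Type*} [TopologicalSpace H'] (J : ModelWithCorners ℝ E' H')
  {T : Type*} [TopologicalSpace T] [ChartedSpace H' T]

/-- A smooth family of prequantum bundle automorphisms. -/
structure IsPreqFamily (G : T → Equiv.Perm P) : Prop where
  smooth : IsSmoothFamily 𝓟 J G
  preserves : ∀ t, B.α.PreservedBy (G t)
  equivariant : ∀ (t : T) (z : Circle) (p : P), G t (z • p) = z • G t p

variable {B J}

theorem IsPreqFamily.comp {E'' : Type*} [NormedAddCommGroup E''] [NormedSpace ℝ E'']
    {H'' : Type*} [TopologicalSpace H''] {J' : ModelWithCorners ℝ E'' H''}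
    {S : Type*} [TopologicalSpace S] [ChartedSpace H'' S]
    {G : T → Equiv.Perm P} (hG : B.IsPreqFamily J G) {u : S → T} (hu : ContMDiff J' J ∞ u) :
    B.IsPreqFamily J' (fun s => G (u s)) :=
  ⟨hG.smooth.comp hu, fun s => hG.preserves (u s), fun s => hG.equivariant (u s)⟩

theorem isPreqFamily_path (γ : B.PreqPath) : B.IsPreqFamily (𝓡∂ 1) γ.1 :=
  ⟨γ.2.2.1, γ.2.2.2.1, γ.2.2.2.2⟩

theorem proj_eq_of_equivariant {G : Equiv.Perm P} (hG : ∀ (z : Circle) (p : P), G (z • p) = z • G p)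
    {p q : P} (h : B.proj p = B.proj q) : B.proj (G p) = B.proj (G q) := by
  obtain ⟨z, rfl⟩ := B.exists_smul_eq h
  rw [hG, B.proj_smul]

variable [IsManifold (𝓡 (2 * n)) ∞ M] [IsManifold (𝓡 (2 * n + 1)) ∞ P]

/-- A family of automorphisms descends to a family of symplectic diffeomorphisms. -/
theorem IsPreqFamily.exists_descent {G : T → Equiv.Perm P} (hG : B.IsPreqFamily J G) :
    ∃ φ : T → Equiv.Perm M, IsSmoothFamily 𝓜 J φ ∧ (∀ t, Ω.form.PreservedBy (φ t)) ∧
      ∀ t p, B.proj (G t p) = φ t (B.proj p) := by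
  have hinv : ∀ t (z : Circle) p, (G t)⁻¹ (z • p) = z • (G t)⁻¹ p := by
    intro t z p
    apply (G t).injective
    simp [hG.equivariant]
  -- A set-theoretic section with no continuity. Equivariance makes the induced map independent of
  -- it, and smoothness is checked after composition with the projection.
  set s := Function.surjInv B.proj_surjective
  have hs : ∀ x, B.proj (s x) = x := Function.surjInv_eq B.proj_surjective
  have h1 : ∀ t p, B.proj (G t (s (B.proj p))) = B.proj (G t p) := fun t p =>
    proj_eq_of_equivariant (hG.equivariant t) (hs _)
  have h2 : ∀ t p, B.proj ((G t)⁻¹ (s (B.proj p))) = B.proj ((G t)⁻¹ p) := fun t p =>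
    proj_eq_of_equivariant (hinv t) (hs _)
  let φ : T → Equiv.Perm M := fun t =>
    { toFun := fun x => B.proj (G t (s x))
      invFun := fun x => B.proj ((G t)⁻¹ (s x))
      left_inv := fun x => (h2 t _).trans (by simp [hs])
      right_inv := fun x => (h1 t _).trans (by simp [hs]) }
  have hφ : ∀ t p, B.proj (G t p) = φ t (B.proj p) := fun t p => (h1 t p).symm
  have hφ' : ∀ t p, B.proj ((G t)⁻¹ p) = (φ t)⁻¹ (B.proj p) := fun t p => (h2 t p).symm
  have hsm : IsSmoothFamily 𝓜 J φ := by
    refine ⟨B.contMDiff_of_comp_proj ?_, B.contMDiff_of_comp_proj ?_⟩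
    · simp only [← hφ]
      exact B.smooth_proj.comp hG.smooth.1
    · simp only [← hφ']
      exact B.smooth_proj.comp hG.smooth.2
  refine ⟨φ, hsm, fun t x => ?_, hφ⟩
  obtain ⟨p, rfl⟩ := B.proj_surjective x
  have hGt : ContMDiff 𝓟 𝓟 ∞ (G t) := hG.smooth.1.comp (contMDiff_const.prodMk contMDiff_id)
  -- Preserving α implies preserving dα, which is minus the pullback of the symplectic form. As the
  -- derivative of the projection is onto, the descended map is symplectic.
  have hd := (hG.preserves t).d B.smooth_α hGt
  have hD : ∀ v : TangentSpace 𝓟 p, (mfderiv 𝓜 𝓜 (φ t) (B.proj p) (mfderiv 𝓟 𝓜 B.proj p v) :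
      EuclideanSpace ℝ (Fin (2 * n))) =
      mfderiv 𝓟 𝓜 B.proj (G t p) (mfderiv 𝓟 𝓟 (G t) p v) := by
    intro v
    have e1 := mfderiv_comp_apply p (hsm.mdifferentiable t (B.proj p)) (B.mdifferentiable_proj p) v
    have e2 := mfderiv_comp_apply p (B.mdifferentiable_proj (G t p))
      (hG.smooth.mdifferentiable t p) v
    have e3 : φ t ∘ B.proj = B.proj ∘ G t := funext fun p => (hφ t p).symm
    have e4 : ∀ u : P → M, u = B.proj ∘ G t → (mfderiv 𝓟 𝓜 u p v : EuclideanSpace ℝ (Fin (2 * n))) =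
        mfderiv 𝓟 𝓜 B.proj (G t p) (mfderiv 𝓟 𝓟 (G t) p v) := by
      rintro u rfl
      exact e2
    exact e1.symm.trans (e4 _ e3)
  have key : ∀ y, y = B.proj (G t p) → ∀ a b : EuclideanSpace ℝ (Fin (2 * n)),
      ∀ v w : TangentSpace 𝓟 p,
      a = mfderiv 𝓟 𝓜 B.proj (G t p) (mfderiv 𝓟 𝓟 (G t) p v) →
      b = mfderiv 𝓟 𝓜 B.proj (G t p) (mfderiv 𝓟 𝓟 (G t) p w) →
      Ω.form y ![a, b] = Ω.form (B.proj p) ![mfderiv 𝓟 𝓜 B.proj p v, mfderiv 𝓟 𝓜 B.proj p w] := by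
    rintro y rfl a b v w rfl rfl
    have e1 := hd.apply₂ p v w
    have e2 := B.d_α_apply p v w
    have e3 := B.d_α_apply (G t p) (mfderiv 𝓟 𝓟 (G t) p v) (mfderiv 𝓟 𝓟 (G t) p w)
    exact neg_injective (e3.symm.trans (e1.trans e2))
  ext v
  obtain ⟨a, ha⟩ := B.mfderiv_proj_surjective p (v 0)
  obtain ⟨b, hb⟩ := B.mfderiv_proj_surjective p (v 1)
  have hv : v = ![mfderiv 𝓟 𝓜 B.proj p a, mfderiv 𝓟 𝓜 B.proj p b] := by
    funext i
    fin_cases i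
    · exact ha.symm
    · exact hb.symm
  rw [hv]
  refine Eq.trans ?_ (key _ (hφ t p).symm _ _ a b (hD a) (hD b))
  refine congrArg (Ω.form (φ t (B.proj p))) (funext fun i => ?_)
  fin_cases i <;> rfl

/-- The connection form on the velocity of a family of automorphisms. -/
theorem IsPreqFamily.α_unitDeriv_smul {G : unitInterval × T → Equiv.Perm P}
    (hG : B.IsPreqFamily ((𝓡∂ 1).prod J) G) (t : unitInterval) (ν : T) (z : Circle) (p : P) :
    B.α (G (t, ν) (z • p)) ![unitDeriv 𝓟 (fun t' => G (t', ν) (z • p)) t] =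
      B.α (G (t, ν) p) ![unitDeriv 𝓟 (fun t' => G (t', ν) p) t] := by
  have hc : ContMDiff (𝓡∂ 1) 𝓟 ∞ (fun t' => G (t', ν) p) :=
    hG.smooth.1.comp ((contMDiff_id.prodMk contMDiff_const).prodMk contMDiff_const)
  obtain ⟨r, rfl⟩ := Circle.exp_surjective z
  have h1 := B.α_unitDeriv_exp_smul (θ := fun _ => r) t mdifferentiableAt_const
    ((hc t).mdifferentiableAt (by simp))
  rw [pathDeriv_const, zero_add] at h1
  have key : ∀ u : unitInterval → P, u = (fun t' => Circle.exp r • G (t', ν) p) →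
      B.α (u t) ![unitDeriv 𝓟 u t] =
        B.α (G (t, ν) p) ![unitDeriv 𝓟 (fun t' => G (t', ν) p) t] := by
    rintro u rfl
    exact h1
  exact key _ (funext fun t' => hG.equivariant _ _ _)

/-- The Hamiltonian of a family of automorphisms. -/
theorem IsPreqFamily.exists_hamiltonian [IsManifold J ∞ T] {G : unitInterval × T → Equiv.Perm P}
    (hG : B.IsPreqFamily ((𝓡∂ 1).prod J) G) :
    ∃ f : (unitInterval × T) × M → ℝ, ContMDiff (((𝓡∂ 1).prod J).prod 𝓜) 𝓘(ℝ, ℝ) ∞ f ∧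
      ∀ (t : unitInterval) (ν : T) (p : P),
        B.α (G (t, ν) p) ![unitDeriv 𝓟 (fun t' => G (t', ν) p) t] =
          -f ((t, ν), B.proj (G (t, ν) p)) ∧
        ∀ w : TangentSpace 𝓜 (B.proj (G (t, ν) p)),
          Ω.form (B.proj (G (t, ν) p))
            ![mfderiv 𝓟 𝓜 B.proj (G (t, ν) p) (unitDeriv 𝓟 (fun t' => G (t', ν) p) t), w] +
          differential 𝓜 (fun x => f ((t, ν), x)) (B.proj (G (t, ν) p)) w = 0 := by
  set A : (unitInterval × T) × P → ℝ := fun q =>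
    B.α (G q.1 q.2) ![unitDeriv 𝓟 (fun t' => G (t', q.1.2) q.2) q.1.1]
  have hA : ContMDiff (((𝓡∂ 1).prod J).prod 𝓟) 𝓘(ℝ, ℝ) ∞ A := by
    have h1 : ContMDiff ((𝓡∂ 1).prod (J.prod 𝓟)) 𝓟 ∞
        (fun q : unitInterval × (T × P) => G (q.1, q.2.1) q.2.2) :=
      hG.smooth.1.comp ((contMDiff_fst.prodMk (contMDiff_fst.comp contMDiff_snd)).prodMk
        (contMDiff_snd.comp contMDiff_snd))
    have h2 := B.smooth_α.contMDiff_apply_one (contMDiff_unitDeriv h1)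
    exact h2.comp (g := fun q : unitInterval × (T × P) =>
      B.α (G (q.1, q.2.1) q.2.2) ![unitDeriv 𝓟 (fun t' => G (t', q.2.1) q.2.2) q.1])
      (f := fun q : (unitInterval × T) × P => (q.1.1, (q.1.2, q.2)))
      ((contMDiff_fst.comp contMDiff_fst).prodMk
        ((contMDiff_snd.comp contMDiff_fst).prodMk contMDiff_snd))
  set s := Function.surjInv B.proj_surjective
  have hs : ∀ x, B.proj (s x) = x := Function.surjInv_eq B.proj_surjective
  have hinv : ∀ t (z : Circle) p, (G t)⁻¹ (z • p) = z • (G t)⁻¹ p := by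
    intro t z p
    apply (G t).injective
    simp [hG.equivariant]
  -- The velocity field is indexed by its starting point, while a Hamiltonian is evaluated at the
  -- moving point; hence the inverse of `G`. The choice of the point of the fibre is irrelevant by
  -- `IsPreqFamily.α_unitDeriv_smul`.
  set f : (unitInterval × T) × M → ℝ := fun q => -A (q.1, (G q.1)⁻¹ (s q.2))
  have hf : ∀ q p, f (q, B.proj p) = -A (q, (G q)⁻¹ p) := by
    rintro ⟨t, ν⟩ p
    obtain ⟨z, hz⟩ := B.exists_smul_eq (hs (B.proj p)).symm
    simp only [f, ← hz, hinv]
    exact congrArg _ (hG.α_unitDeriv_smul t ν z _)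
  have hfs : ContMDiff (((𝓡∂ 1).prod J).prod 𝓜) 𝓘(ℝ, ℝ) ∞ f := by
    refine B.contMDiff_of_comp_proj ?_
    simp only [hf]
    exact (hA.comp (contMDiff_fst.prodMk hG.smooth.2)).neg
  have hAf : ∀ t ν p, A ((t, ν), p) = -f ((t, ν), B.proj (G (t, ν) p)) := by
    intro t ν p
    rw [hf]
    simp
  refine ⟨f, hfs, fun t ν p => ⟨hAf t ν p, ?_⟩⟩
  have hGt : ContMDiff 𝓟 𝓟 ∞ (G (t, ν)) := hG.smooth.1.comp (contMDiff_const.prodMk contMDiff_id)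
  have hft : ContMDiff 𝓜 𝓘(ℝ, ℝ) ∞ (fun x => f ((t, ν), x)) :=
    hfs.comp (contMDiff_const.prodMk contMDiff_id)
  -- Every tangent vector at the image point on the base comes from a vector `v` at `p`, and `v` may
  -- be taken to be a velocity, so that Cartan's formula applies to (t', s') ↦ G_{t'}(c(s')).
  have key := tangent_induction (I := 𝓟) (X := P) (fun p v =>
    Ω.form (B.proj (G (t, ν) p))
      ![mfderiv 𝓟 𝓜 B.proj (G (t, ν) p) (unitDeriv 𝓟 (fun t' => G (t', ν) p) t),
        mfderiv 𝓟 𝓜 B.proj (G (t, ν) p) (mfderiv 𝓟 𝓟 (G (t, ν)) p v)] +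
    differential 𝓜 (fun x => f ((t, ν), x)) (B.proj (G (t, ν) p))
      (mfderiv 𝓟 𝓜 B.proj (G (t, ν) p) (mfderiv 𝓟 𝓟 (G (t, ν)) p v)) = 0) ?_ ?_
  · intro w
    obtain ⟨w', rfl⟩ := B.mfderiv_proj_surjective _ w
    have h1 := mfderiv_inv_apply (hG.smooth.mdifferentiable (t, ν))
      (hG.smooth.inv.mdifferentiable (t, ν)) p w'
    rw [← h1]
    exact key p _
  · intro c hc
    have hu : ContMDiff ((𝓡∂ 1).prod (𝓡∂ 1)) 𝓟 ∞
        (fun q : unitInterval × unitInterval => G (q.1, ν) (c q.2)) :=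
      hG.smooth.1.comp ((contMDiff_fst.prodMk contMDiff_const).prodMk (hc.comp contMDiff_snd))
    have h1 := B.smooth_α.pathDeriv_sub_pathDeriv hu t 0
    have hcomp : ∀ t' : unitInterval, unitDeriv 𝓟 (fun s' => G (t', ν) (c s')) 0 =
        mfderiv 𝓟 𝓟 (G (t', ν)) (c 0) (unitDeriv 𝓟 c 0) := fun t' =>
      unitDeriv_comp 0 (hG.smooth.mdifferentiable (t', ν) _) ((hc 0).mdifferentiableAt (by simp))
    -- Invariance of α kills the first term of Cartan's formula. The remaining terms are the
    -- differential of `f` and the curvature.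
    have h2 : (fun t' => B.α (G (t', ν) (c 0)) ![unitDeriv 𝓟 (fun s' => G (t', ν) (c s')) 0]) =
        fun _ => B.α (c 0) ![unitDeriv 𝓟 c 0] := by
      funext t'
      rw [hcomp]
      exact (hG.preserves (t', ν)).apply_one _ _
    have h3 : (pathDeriv (fun t' => B.α (G (t', ν) (c 0))
        ![unitDeriv 𝓟 (fun s' => G (t', ν) (c s')) 0]) t : ℝ) = 0 := by
      rw [h2]
      exact pathDeriv_const _ _
    have h4 : (fun s' => B.α (G (t, ν) (c s')) ![unitDeriv 𝓟 (fun t' => G (t', ν) (c s')) t]) =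
        fun s' => -f ((t, ν), B.proj (G (t, ν) (c s'))) := funext fun s' => hAf t ν (c s')
    have hGc : ContMDiff (𝓡∂ 1) 𝓟 ∞ (fun s' => G (t, ν) (c s')) := hGt.comp hc
    have h5 : (pathDeriv (fun s' => B.α (G (t, ν) (c s'))
        ![unitDeriv 𝓟 (fun t' => G (t', ν) (c s')) t]) 0 : ℝ) =
        -differential 𝓜 (fun x => f ((t, ν), x)) (B.proj (G (t, ν) (c 0)))
          (mfderiv 𝓟 𝓜 B.proj (G (t, ν) (c 0)) (mfderiv 𝓟 𝓟 (G (t, ν)) (c 0)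
            (unitDeriv 𝓟 c 0))) := by
      rw [h4]
      have e1 := unitDeriv_comp (I := 𝓜) (J := 𝓘(ℝ, ℝ)) (f := fun x => -f ((t, ν), x))
        (c := fun s' => B.proj (G (t, ν) (c s'))) 0 ((hft.neg _).mdifferentiableAt (by simp))
        (((B.smooth_proj.comp hGc) 0).mdifferentiableAt (by simp))
      have e2 := unitDeriv_comp (I := 𝓟) (J := 𝓜) (f := B.proj)
        (c := fun s' => G (t, ν) (c s')) 0 (B.mdifferentiable_proj _)
        ((hGc 0).mdifferentiableAt (by simp))
      refine e1.trans ?_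
      rw [e2, hcomp]
      exact DFunLike.congr_fun (mfderiv_neg (f := fun x => f ((t, ν), x))) _
    have h6 := B.d_α_apply (G (t, ν) (c 0)) (unitDeriv 𝓟 (fun t' => G (t', ν) (c 0)) t)
      (unitDeriv 𝓟 (fun s' => G (t, ν) (c s')) 0)
    have h7 := (congrArg₂ (· - ·) h3 h5).symm.trans (h1.trans h6)
    rw [hcomp] at h7
    simp only [zero_sub, neg_neg] at h7
    have h8 : ∀ a b : ℝ, a = -b → b + a = 0 := fun a b h => by linarith
    exact h8 _ _ h7
  · intro p v r hr h
    have e1 : mfderiv 𝓟 𝓜 B.proj (G (t, ν) p) (mfderiv 𝓟 𝓟 (G (t, ν)) p (r • v)) =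
        r • mfderiv 𝓟 𝓜 B.proj (G (t, ν) p) (mfderiv 𝓟 𝓟 (G (t, ν)) p v) :=
      (congrArg _ (map_smul _ r v)).trans (map_smul _ r _)
    have e2 := (congrArg₂ (· + ·) (congrArg (fun w => Ω.form (B.proj (G (t, ν) p))
      ![mfderiv 𝓟 𝓜 B.proj (G (t, ν) p) (unitDeriv 𝓟 (fun t' => G (t', ν) p) t), w]) e1)
      (congrArg (differential 𝓜 (fun x => f ((t, ν), x)) (B.proj (G (t, ν) p))) e1)).symm.trans h
    have e3 := twoForm_smul_right (E := EuclideanSpace ℝ (Fin (2 * n)))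
      (Ω.form (B.proj (G (t, ν) p)))
      (mfderiv 𝓟 𝓜 B.proj (G (t, ν) p) (unitDeriv 𝓟 (fun t' => G (t', ν) p) t)) r
      (mfderiv 𝓟 𝓜 B.proj (G (t, ν) p) (mfderiv 𝓟 𝓟 (G (t, ν)) p v))
    have e4 : differential 𝓜 (fun x => f ((t, ν), x)) (B.proj (G (t, ν) p))
        (r • mfderiv 𝓟 𝓜 B.proj (G (t, ν) p) (mfderiv 𝓟 𝓟 (G (t, ν)) p v)) = r *
        differential 𝓜 (fun x => f ((t, ν), x)) (B.proj (G (t, ν) p))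
        (mfderiv 𝓟 𝓜 B.proj (G (t, ν) p) (mfderiv 𝓟 𝓟 (G (t, ν)) p v)) :=
      map_smul (mfderiv 𝓜 𝓘(ℝ, ℝ) (fun x => f ((t, ν), x)) (B.proj (G (t, ν) p))) r _
    have e5 : r * _ + r * _ = (0 : ℝ) := (congrArg₂ (· + ·) e3 e4).symm.trans e2
    rw [← mul_add] at e5
    exact (mul_eq_zero.1 e5).resolve_left hr.ne'

end PrequantumBundle

/-! ### Hamiltonian equations for one path -/

namespace PrequantumBundle

variable {n : ℕ} {M : Type*} [TopologicalSpace M]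
  [ChartedSpace (EuclideanSpace ℝ (Fin (2 * n))) M] {Ω : SymplecticForm n M}
  {P : Type*} [TopologicalSpace P]
  [ChartedSpace (EuclideanSpace ℝ (Fin (2 * n + 1))) P] [MulAction Circle P]
  (B : PrequantumBundle Ω P)

local notation "𝓜" => 𝓡 (2 * n)
local notation "𝓟" => 𝓡 (2 * n + 1)

/-- The Hamiltonian equations for the velocity `v` of a lift at a point `p`: the function `f` is
minus the value of the connection form, and the projected velocity is the Hamiltonian vector
of `f`. -/
def HamiltonianAt (f : M → ℝ) (p : P) (v : TangentSpace 𝓟 p) : Prop :=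
  B.α p ![v] = -f (B.proj p) ∧ ∀ w : TangentSpace 𝓜 (B.proj p),
    Ω.form (B.proj p) ![mfderiv 𝓟 𝓜 B.proj p v, w] + differential 𝓜 f (B.proj p) w = 0

variable {B}

/-- The circle field has α equal to 1 and projects to 0. Adding `f` times it to the velocity
therefore changes only the α component, and horizontality of the sum reads α = -f. -/
theorem isHamiltonianOf_iff {f : unitInterval × M → ℝ} {γ : B.PreqPath} :
    B.IsHamiltonianOf f γ ↔ ContMDiff ((𝓡∂ 1).prod 𝓜) 𝓘(ℝ, ℝ) ∞ f ∧
      ∀ (t : unitInterval) (p : P), B.HamiltonianAt (fun x => f (t, x)) (γ.1 t p)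
        (unitDeriv 𝓟 (fun t' => γ.1 t' p) t) := by
  refine and_congr_right fun _ => forall₂_congr fun t p => and_congr ?_ (forall_congr' fun w => ?_)
  · have h1 : B.α (γ.1 t p) ![velocity 𝓟 γ.1 t p +
        f (t, B.proj (γ.1 t p)) • circleField (γ.1 t p)] =
        B.α (γ.1 t p) ![velocity 𝓟 γ.1 t p] + f (t, B.proj (γ.1 t p)) := by
      refine (oneForm_add (B.α (γ.1 t p)) _ _).trans (congrArg _ ?_)
      refine (oneForm_smul (B.α (γ.1 t p)) _ _).trans ?_
      rw [B.α_circleField, mul_one]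
    rw [h1, add_eq_zero_iff_eq_neg]
    rfl
  · have h1 : mfderiv 𝓟 𝓜 B.proj (γ.1 t p) (velocity 𝓟 γ.1 t p +
        f (t, B.proj (γ.1 t p)) • circleField (γ.1 t p)) =
        mfderiv 𝓟 𝓜 B.proj (γ.1 t p) (velocity 𝓟 γ.1 t p) := by
      rw [map_add, map_smul, B.mfderiv_proj_circleField, smul_zero, add_zero]
    rw [h1]
    rfl

/-- A path lying over `φ` and satisfying the Hamiltonian equations. -/
theorem generates_of_hamiltonianAt {γ : unitInterval → Equiv.Perm P}
    (hγ : IsSmoothFamily 𝓟 (𝓡∂ 1) γ) {φ : unitInterval → Equiv.Perm M}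
    (h : ∀ t p, B.proj (γ t p) = φ t (B.proj p)) {f : unitInterval × M → ℝ}
    (hfs : ContMDiff ((𝓡∂ 1).prod 𝓜) 𝓘(ℝ, ℝ) ∞ f)
    (hf : ∀ t p, B.HamiltonianAt (fun x => f (t, x)) (γ t p)
      (unitDeriv 𝓟 (fun t' => γ t' p) t)) : Generates Ω.form f φ := by
  refine ⟨hfs, fun t x => ?_⟩
  obtain ⟨p, rfl⟩ := B.proj_surjective x
  have hc : ContMDiff (𝓡∂ 1) 𝓟 ∞ (fun t' => γ t' p) :=
    hγ.1.comp (contMDiff_id.prodMk contMDiff_const)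
  have h1 := unitDeriv_comp (f := B.proj) t (B.mdifferentiable_proj _)
    ((hc t).mdifferentiableAt (by simp))
  have key : ∀ c : unitInterval → M, c = (fun t' => B.proj (γ t' p)) →
      ∀ w : TangentSpace 𝓜 (c t), Ω.form (c t) ![unitDeriv 𝓜 c t, w] +
        differential 𝓜 (fun y => f (t, y)) (c t) w = 0 := by
    rintro c rfl w
    rw [h1]
    exact (hf t p).2 w
  exact key (fun t' => φ t' (B.proj p)) (funext fun t' => (h t' p).symm)

section Paths

variable [IsManifold (𝓡 (2 * n)) ∞ M] [IsManifold (𝓡 (2 * n + 1)) ∞ P]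

theorem IsPreqFamily.exists_hamiltonianAt {γ : unitInterval → Equiv.Perm P}
    (hγ : B.IsPreqFamily (𝓡∂ 1) γ) :
    ∃ f : unitInterval × M → ℝ, ContMDiff ((𝓡∂ 1).prod 𝓜) 𝓘(ℝ, ℝ) ∞ f ∧
      ∀ (t : unitInterval) (p : P), B.HamiltonianAt (fun x => f (t, x)) (γ t p)
        (unitDeriv 𝓟 (fun t' => γ t' p) t) := by
  -- A single path is treated as a family that does not depend on a dummy parameter, later evaluated
  -- at 0.
  obtain ⟨f, hfs, hf⟩ := (hγ.comp (contMDiff_fst (I := 𝓡∂ 1) (J := 𝓡∂ 1)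
    (M := unitInterval) (N := unitInterval))).exists_hamiltonian
  exact ⟨fun q => f ((q.1, 0), q.2),
    hfs.comp ((contMDiff_fst.prodMk contMDiff_const).prodMk contMDiff_snd),
    fun t p => hf t 0 p⟩

/-- Uniqueness holds because `f` is read off from α of the velocity, and every point of the base
lies under a point of the form `γ.1 t q`. -/
theorem existsUnique_isHamiltonianOf (γ : B.PreqPath) :
    ∃! f : unitInterval × M → ℝ, B.IsHamiltonianOf f γ := by
  obtain ⟨f, hf⟩ := (isPreqFamily_path γ).exists_hamiltonianAt
  refine ⟨f, isHamiltonianOf_iff.2 hf, fun g hg => ?_⟩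
  replace hg := isHamiltonianOf_iff.1 hg
  funext ⟨t, x⟩
  obtain ⟨p, rfl⟩ := B.proj_surjective x
  have h1 := (hf.2 t ((γ.1 t)⁻¹ p)).1
  rw [(hg.2 t ((γ.1 t)⁻¹ p)).1] at h1
  simpa using h1

theorem existsUnique_lifts (γ : B.PreqPath) : ∃! φ : Ω.HamPath, B.Lifts γ φ := by
  have hγ := isPreqFamily_path γ
  obtain ⟨φ, hφ, hp, hl⟩ := hγ.exists_descent
  obtain ⟨f, hfs, hf⟩ := hγ.exists_hamiltonianAt
  refine ⟨⟨φ, ?_, hφ, hp, f, generates_of_hamiltonianAt hγ.smooth hl hfs hf⟩, hl, fun ψ hψ => ?_⟩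
  · ext x
    obtain ⟨p, rfl⟩ := B.proj_surjective x
    rw [← hl, γ.2.1]
    rfl
  · refine Subtype.ext (funext fun t => Equiv.ext fun x => ?_)
    obtain ⟨p, rfl⟩ := B.proj_surjective x
    exact (hψ t p).symm.trans (hl t p)

end Paths

end PrequantumBundle

/-! ### Lifting families of diffeomorphisms equivariantly -/

section UnitPart

/-- The complex number `z / |z|`, for `z ≠ 0`. -/
def unitPart (z : ℂ) : Circle := Circle.exp z.arg

theorem norm_mul_unitPart (z : ℂ) : ‖z‖ * (unitPart z : ℂ) = z := by
  rw [unitPart, Circle.coe_exp, Complex.norm_mul_exp_arg_mul_I]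

theorem unitPart_mul {z w : ℂ} (hz : z ≠ 0) (hw : w ≠ 0) :
    unitPart (z * w) = unitPart z * unitPart w := by
  have h1 := norm_mul_unitPart (z * w)
  have h2 := norm_mul_unitPart z
  have h3 := norm_mul_unitPart w
  have hz' : ((‖z * w‖ : ℝ) : ℂ) ≠ 0 := by simp [hz, hw]
  refine Circle.ext (mul_left_cancel₀ hz' (h1.trans ?_))
  nth_rewrite 1 [← h2, ← h3]
  rw [norm_mul, Complex.ofReal_mul, Circle.coe_mul]
  ring

theorem unitPart_circle (z : Circle) : unitPart z = z := Circle.exp_arg z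

theorem unitPart_of_pos {r : ℝ} (hr : 0 < r) : unitPart r = 1 := by
  rw [unitPart, Complex.arg_ofReal_of_nonneg hr.le, Circle.exp_zero]

theorem contMDiffAt_unitPart {z : ℂ} (hz : z ≠ 0) : ContMDiffAt 𝓘(ℝ, ℂ) (𝓡 1) ∞ unitPart z := by
  have h1 : ContDiffAt ℝ ∞ (fun w : ℂ => (w / z).arg) z := by
    have h2 : ContDiffAt ℝ ∞ Complex.log (z / z) := by
      rw [div_self hz]
      exact (Complex.contDiffAt_log (by simp)).restrict_scalars ℝ
    have h3 : ContDiffAt ℝ ∞ (fun w : ℂ => w / z) z := contDiffAt_id.div_const z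
    have h4 := Complex.imCLM.contDiff.contDiffAt.comp z
      (ContDiffAt.comp (f := fun w : ℂ => w / z) z h2 h3)
    simpa [Function.comp_def, Complex.log_im] using h4
  have h5 : ContMDiffAt 𝓘(ℝ, ℂ) (𝓡 1) ∞ (fun w : ℂ => unitPart z * Circle.exp (w / z).arg) z :=
    (contMDiff_mul_left (I := 𝓡 1) (a := unitPart z)).contMDiffAt.comp z
      (contMDiff_circleExp.contMDiffAt.comp z h1.contMDiffAt)
  refine h5.congr_of_eventuallyEq ?_
  filter_upwards [isOpen_ne.mem_nhds hz] with w hw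
  have h6 := unitPart_mul hz (div_ne_zero hw hz)
  rw [mul_div_cancel₀ _ hz] at h6
  exact h6

theorem contMDiff_circle_coe : ContMDiff (𝓡 1) 𝓘(ℝ, ℂ) ∞ (fun z : Circle => (z : ℂ)) :=
  haveI := finrank_real_complex_fact'
  contMDiff_coe_sphere (E := ℂ) (n := 1)

end UnitPart

namespace PrequantumBundle

variable {n : ℕ} {M : Type*} [TopologicalSpace M]
  [ChartedSpace (EuclideanSpace ℝ (Fin (2 * n))) M] {Ω : SymplecticForm n M}
  {P : Type*} [TopologicalSpace P]
  [ChartedSpace (EuclideanSpace ℝ (Fin (2 * n + 1))) P] [MulAction Circle P]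
  (B : PrequantumBundle Ω P)

local notation "𝓜" => 𝓡 (2 * n)
local notation "𝓟" => 𝓡 (2 * n + 1)

/-- A smooth equivariant function which does not vanish over a given point. -/
theorem exists_equivariant_function [IsManifold (𝓡 (2 * n)) ∞ M] [T2Space M] (x : M) :
    ∃ (Z : P → ℂ) (V : Set M), IsOpen V ∧ x ∈ V ∧ ContMDiff 𝓟 𝓘(ℝ, ℂ) ∞ Z ∧
      (∀ (z : Circle) p, Z (z • p) = z * Z p) ∧ ∀ p, B.proj p ∈ V → Z p ≠ 0 := by
  obtain ⟨U, e, hU, hx, hs, ht, h1, -, h3⟩ := B.locally_trivial x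
  obtain ⟨ρ, -, hρ⟩ := (SmoothBumpFunction.nhds_basis_tsupport (I := 𝓜) x).mem_iff.1
    (hU.mem_nhds hx)
  have hoff : ∀ p, p ∉ e.source → ρ (B.proj p) = 0 := by
    intro p hp
    rw [hs, mem_preimage] at hp
    exact image_eq_zero_of_notMem_tsupport fun h => hp (hρ h)
  -- The fibre coordinate of a trivialisation, cut off by a bump function on the base. Outside its
  -- source `e` takes arbitrary values, which the factor `ρ` annihilates.
  refine ⟨fun p => (ρ (B.proj p) : ℂ) * ((e p).2 : ℂ), Function.support ρ, ρ.isOpen_support,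
    ρ.c_mem_support, fun p => ?_, fun z p => ?_, fun p hp => ?_⟩
  · by_cases hp : B.proj p ∈ U
    · have hp' : p ∈ e.source := by rw [hs]; exact hp
      have h4 : ContMDiffAt 𝓟 𝓘(ℝ, ℂ) ∞ (fun p => ((e p).2 : ℂ)) p :=
        contMDiff_circle_coe.contMDiffAt.comp p
          (contMDiffAt_snd.comp p (h1.contMDiffAt (e.open_source.mem_nhds hp')))
      have h5 : ContMDiff 𝓟 𝓘(ℝ, ℂ) ∞ (fun p => (ρ (B.proj p) : ℂ)) :=
        Complex.ofRealCLM.contDiff.contMDiff.comp (ρ.contMDiff.comp B.smooth_proj)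
      exact (contDiff_mul (𝕜 := ℝ) (𝔸 := ℂ)).contMDiff.contMDiffAt.comp p
        (h5.contMDiffAt.prodMk_space h4)
    · have h4 : B.proj ⁻¹' (tsupport ρ)ᶜ ∈ 𝓝 p :=
        ((isClosed_tsupport _).isOpen_compl.preimage B.smooth_proj.continuous).mem_nhds
          fun h => hp (hρ h)
      refine (contMDiffAt_const (c := (0 : ℂ))).congr_of_eventuallyEq ?_
      filter_upwards [h4] with q hq
      rw [image_eq_zero_of_notMem_tsupport hq]
      simp
  · by_cases hp : p ∈ e.source
    · simp only [(h3 p hp).2, B.proj_smul, Circle.coe_mul]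
      ring
    · simp [B.proj_smul, hoff p hp]
  · exact mul_ne_zero (Complex.ofReal_ne_zero.2 hp) (Circle.coe_ne_zero _)

/-- A smooth kernel comparing the fibres of the bundle: it is sesquilinear for the action and
does not vanish near the diagonal. -/
theorem exists_kernel (B : PrequantumBundle Ω P) [IsManifold (𝓡 (2 * n)) ∞ M] [T2Space M]
    [CompactSpace M] :
    ∃ K : P × P → ℂ, ContMDiff ((𝓟).prod 𝓟) 𝓘(ℝ, ℂ) ∞ K ∧
      (∀ (z : Circle) p q, K (z • p, q) = z * K (p, q)) ∧
      (∀ p q, K (q, p) = (starRingEnd ℂ) (K (p, q))) ∧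
      ∀ p, ∃ r : ℝ, 0 < r ∧ K (p, p) = r := by
  choose Z V hV hx hZ hZs hZ0 using B.exists_equivariant_function
  obtain ⟨t, ht⟩ := isCompact_univ.elim_finite_subcover V hV
    (fun x _ => mem_iUnion.2 ⟨x, hx x⟩)
  -- The pullback of a hermitian product under the equivariant map with components `Z i`. By the
  -- choice of the finite cover these have no common zero, so the diagonal values are positive.
  refine ⟨fun q => ∑ i ∈ t, (starRingEnd ℂ) (Z i q.2) * Z i q.1, ?_, fun z p q => ?_,
    fun p q => ?_, fun p => ⟨∑ i ∈ t, Complex.normSq (Z i p), ?_, ?_⟩⟩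
  · refine contMDiff_finsetSum fun i _ => ?_
    exact (contDiff_mul (𝕜 := ℝ) (𝔸 := ℂ)).contMDiff.comp
      ((Complex.conjCLE.contDiff.contMDiff.comp ((hZ i).comp contMDiff_snd)).prodMk_space
        ((hZ i).comp contMDiff_fst))
  · simp only [hZs, Finset.mul_sum]
    exact Finset.sum_congr rfl fun i _ => by ring
  · simp only [map_sum, map_mul, Complex.conj_conj]
    exact Finset.sum_congr rfl fun i _ => mul_comm _ _
  · obtain ⟨i, hi, hp⟩ := mem_iUnion₂.1 (ht (mem_univ (B.proj p)))
    exact Finset.sum_pos' (fun i _ => Complex.normSq_nonneg _)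
      ⟨i, hi, Complex.normSq_pos.2 (hZ0 i p hp)⟩
  · rw [Complex.ofReal_sum]
    exact Finset.sum_congr rfl fun i _ => Complex.normSq_eq_conj_mul_self.symm

variable {E' : Type*} [NormedAddCommGroup E'] [NormedSpace ℝ E']
  {H' : Type*} [TopologicalSpace H'] (J : ModelWithCorners ℝ E' H')
  {T : Type*} [TopologicalSpace T] [ChartedSpace H' T]

/-- The family `G` of equivariant diffeomorphisms lifts the family `φ`. -/
structure IsLift (G : T → Equiv.Perm P) (φ : T → Equiv.Perm M) : Prop where
  smooth : IsSmoothFamily 𝓟 J G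
  equivariant : ∀ (t : T) (z : Circle) (p : P), G t (z • p) = z • G t p
  proj_apply : ∀ t p, B.proj (G t p) = φ t (B.proj p)

variable {B J}

theorem IsLift.one : B.IsLift J (1 : T → Equiv.Perm P) 1 :=
  ⟨.one, fun _ _ _ => rfl, fun _ _ => rfl⟩

theorem IsLift.mul {G G' : T → Equiv.Perm P} {φ φ' : T → Equiv.Perm M} (h : B.IsLift J G φ)
    (h' : B.IsLift J G' φ') : B.IsLift J (G * G') (φ * φ') :=
  ⟨h.smooth.mul h'.smooth, fun t z p => by simp [h.equivariant, h'.equivariant],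
    fun t p => by simp [h.proj_apply, h'.proj_apply]⟩

theorem IsLift.inv {G : T → Equiv.Perm P} {φ : T → Equiv.Perm M} (h : B.IsLift J G φ) :
    B.IsLift J G⁻¹ φ⁻¹ := by
  refine ⟨h.smooth.inv, fun t z p => ?_, fun t p => ?_⟩
  · apply (G t).injective
    simp [h.equivariant]
  · apply (φ t).injective
    have := h.proj_apply t ((G t)⁻¹ p)
    simp at this
    simp [← this]

theorem IsLift.comp {E'' : Type*} [NormedAddCommGroup E''] [NormedSpace ℝ E'']
    {H'' : Type*} [TopologicalSpace H''] {J' : ModelWithCorners ℝ E'' H''}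
    {S : Type*} [TopologicalSpace S] [ChartedSpace H'' S] {G : T → Equiv.Perm P}
    {φ : T → Equiv.Perm M} (h : B.IsLift J G φ) {u : S → T} (hu : ContMDiff J' J ∞ u) :
    B.IsLift J' (fun s => G (u s)) (fun s => φ (u s)) :=
  ⟨h.smooth.comp hu, fun t => h.equivariant (u t), fun t => h.proj_apply (u t)⟩

/-- Moving points to the closest point of another fibre. -/
theorem exists_isLift_of_kernel_ne_zero {K : P × P → ℂ}
    (hK : ContMDiff ((𝓟).prod 𝓟) 𝓘(ℝ, ℂ) ∞ K)
    (hs : ∀ (z : Circle) p q, K (z • p, q) = z * K (p, q))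
    (hc : ∀ p q, K (q, p) = (starRingEnd ℂ) (K (p, q)))
    {φ : T → Equiv.Perm M} (hφ : IsSmoothFamily 𝓜 J φ)
    (h0 : ∀ t p q, B.proj q = φ t (B.proj p) → K (p, q) ≠ 0) :
    ∃ G : T → Equiv.Perm P, B.IsLift J G φ := by
  have hs' : ∀ (z : Circle) p q, K (p, z • q) = (starRingEnd ℂ) z * K (p, q) := by
    intro z p q
    rw [hc (z • q) p, hs, map_mul, ← hc]
  -- The point of the fibre of `q` at which `K (p, ·)` is real and positive. Because `K` is
  -- hermitian this relation is symmetric in the two points, which makes the transport invertible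
  -- (`hσσ`).
  let σ : P → P → P := fun p q => unitPart (K (p, q)) • q
  have hσp : ∀ p q, B.proj (σ p q) = B.proj q := fun p q => B.proj_smul _ _
  have hσl : ∀ (z : Circle) p q, K (p, q) ≠ 0 → σ (z • p) q = z • σ p q := by
    intro z p q h
    simp only [σ]
    rw [hs, unitPart_mul (Circle.coe_ne_zero z) h, unitPart_circle, mul_smul]
  have hσr : ∀ (z : Circle) p q, K (p, q) ≠ 0 → σ p (z • q) = σ p q := by
    intro z p q h
    simp only [σ]
    rw [hs', ← Circle.coe_inv_eq_conj, unitPart_mul (Circle.coe_ne_zero _) h, unitPart_circle,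
      smul_smul, mul_comm, mul_inv_cancel_left]
  have hσσ : ∀ p q, K (p, q) ≠ 0 → σ (σ p q) p = p := by
    intro p q h
    have h1 : K (σ p q, p) = (‖K (p, q)‖ : ℝ) := by
      rw [hs, hc p q]
      have h2 := norm_mul_unitPart (K (p, q))
      nth_rewrite 2 [← h2]
      rw [map_mul, Complex.conj_ofReal, ← Circle.coe_inv_eq_conj, mul_left_comm,
        ← Circle.coe_mul, mul_inv_cancel, Circle.coe_one, mul_one]
    simp only [σ] at h1 ⊢
    rw [h1, unitPart_of_pos (norm_pos_iff.2 h), one_smul]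
  set s := Function.surjInv B.proj_surjective
  have hsx : ∀ x, B.proj (s x) = x := Function.surjInv_eq B.proj_surjective
  have hσs : ∀ p q x, B.proj q = x → K (p, q) ≠ 0 → σ p (s x) = σ p q := by
    rintro p q x rfl h
    obtain ⟨z, hz⟩ := B.exists_smul_eq (hsx (B.proj q)).symm
    rw [← hz, hσr z p q h]
  have h0' : ∀ t p q, B.proj q = (φ t)⁻¹ (B.proj p) → K (p, q) ≠ 0 := by
    intro t p q h
    rw [hc q p]
    refine (map_ne_zero _).2 (h0 t q p ?_)
    rw [h]
    simp
  have hsm : ∀ ψ : T → Equiv.Perm M, ContMDiff (J.prod 𝓜) 𝓜 ∞ (fun q : T × M => ψ q.1 q.2) →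
      (∀ t p q, B.proj q = ψ t (B.proj p) → K (p, q) ≠ 0) →
      ContMDiff (J.prod 𝓟) 𝓟 ∞ (fun q : T × P => σ q.2 (s (ψ q.1 (B.proj q.2)))) := by
    rintro ψ hψ h ⟨t, p⟩
    -- The section `s` need not be continuous. Locally it is replaced by a smooth one, which does
    -- not change the value of `σ`.
    obtain ⟨U, τ, hU, hx, hτ, hτ', -⟩ := B.exists_section_through (s (ψ t (B.proj p)))
    rw [hsx] at hx
    have h1 : ContMDiff (J.prod 𝓟) 𝓜 ∞ (fun q : T × P => ψ q.1 (B.proj q.2)) :=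
      hψ.comp (contMDiff_fst.prodMk (B.smooth_proj.comp contMDiff_snd))
    have h2 : ContMDiffAt (J.prod 𝓟) 𝓟 ∞ (fun q : T × P => τ (ψ q.1 (B.proj q.2))) (t, p) :=
      ContMDiffAt.comp (t, p) (hτ.contMDiffAt (hU.mem_nhds hx)) (h1 (t, p))
    have h3 : ContMDiffAt (J.prod 𝓟) 𝓘(ℝ, ℂ) ∞
        (fun q : T × P => K (q.2, τ (ψ q.1 (B.proj q.2)))) (t, p) :=
      ContMDiffAt.comp (t, p) (hK _) (contMDiffAt_snd.prodMk h2)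
    have h4 : ContMDiffAt (J.prod 𝓟) 𝓟 ∞
        (fun q : T × P => σ q.2 (τ (ψ q.1 (B.proj q.2)))) (t, p) :=
      ContMDiffAt.comp (t, p) (B.smooth_smul _)
        ((ContMDiffAt.comp (t, p) (contMDiffAt_unitPart (h _ _ _ (hτ' _ hx))) h3).prodMk h2)
    refine h4.congr_of_eventuallyEq ?_
    filter_upwards [h1.continuous.continuousAt.preimage_mem_nhds (hU.mem_nhds hx)] with q hq
    exact hσs _ _ _ (hτ' _ hq) (h _ _ _ (hτ' _ hq))
  let G : T → Equiv.Perm P := fun t =>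
    { toFun := fun p => σ p (s (φ t (B.proj p)))
      invFun := fun p => σ p (s ((φ t)⁻¹ (B.proj p)))
      left_inv := fun p => by
        have h1 : K (p, s (φ t (B.proj p))) ≠ 0 := h0 t _ _ (hsx _)
        have h2 : B.proj p = (φ t)⁻¹ (B.proj (σ p (s (φ t (B.proj p))))) := by
          rw [hσp, hsx]
          simp
        exact (hσs _ _ _ h2 (h0' t _ _ h2)).trans (hσσ p _ h1)
      right_inv := fun p => by
        have h1 : K (p, s ((φ t)⁻¹ (B.proj p))) ≠ 0 := h0' t _ _ (hsx _)
        have h2 : B.proj p = φ t (B.proj (σ p (s ((φ t)⁻¹ (B.proj p))))) := by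
          rw [hσp, hsx]
          simp
        exact (hσs _ _ _ h2 (h0 t _ _ h2)).trans (hσσ p _ h1) }
  refine ⟨G, ⟨hsm φ hφ.1 h0, hsm (fun t => (φ t)⁻¹) hφ.2 h0'⟩, fun t z p => ?_, fun t p => ?_⟩
  · change σ (z • p) (s (φ t (B.proj (z • p)))) = _
    rw [B.proj_smul]
    exact hσl z p _ (h0 t _ _ (hsx _))
  · exact (hσp _ _).trans (hsx _)

end PrequantumBundle

namespace PrequantumBundle

variable {n : ℕ} {M : Type*} [TopologicalSpace M]
  [ChartedSpace (EuclideanSpace ℝ (Fin (2 * n))) M] {Ω : SymplecticForm n M}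
  {P : Type*} [TopologicalSpace P]
  [ChartedSpace (EuclideanSpace ℝ (Fin (2 * n + 1))) P] [MulAction Circle P]
  {B : PrequantumBundle Ω P}

local notation "𝓜" => 𝓡 (2 * n)
local notation "𝓟" => 𝓡 (2 * n + 1)

section Lift

variable {E' : Type*} [NormedAddCommGroup E'] [NormedSpace ℝ E']
  {H' : Type*} [TopologicalSpace H'] {J : ModelWithCorners ℝ E' H'}
  {T : Type*} [TopologicalSpace T] [ChartedSpace H' T]

theorem contMDiff_mul_right_unitInterval (a : unitInterval) :
    ContMDiff (𝓡∂ 1) (𝓡∂ 1) ∞ (fun t : unitInterval => t * a) :=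
  contMDiff_unitInterval_mul.comp (contMDiff_id.prodMk contMDiff_const)

/-- A family of diffeomorphisms of the base starting at the identity has an equivariant lift. -/
theorem exists_isLift [IsManifold (𝓡 (2 * n)) ∞ M] [T2Space M] [CompactSpace M] [CompactSpace T]
    (B : PrequantumBundle Ω P) {φ : unitInterval × T → Equiv.Perm M}
    (hφ : IsSmoothFamily 𝓜 ((𝓡∂ 1).prod J) φ) (h0 : ∀ ν, φ (0, ν) = 1) :
    ∃ G : unitInterval × T → Equiv.Perm P, B.IsLift ((𝓡∂ 1).prod J) G φ ∧ ∀ ν, G (0, ν) = 1 := by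
  obtain ⟨K, hK, hs, hc, hd⟩ := B.exists_kernel
  set s := Function.surjInv B.proj_surjective
  have hsx : ∀ x, B.proj (s x) = x := Function.surjInv_eq B.proj_surjective
  have hN : ∀ p q p' q', B.proj p = B.proj p' → B.proj q = B.proj q' →
      Complex.normSq (K (p, q)) = Complex.normSq (K (p', q')) := by
    intro p q p' q' hp hq
    obtain ⟨z, rfl⟩ := B.exists_smul_eq hp
    obtain ⟨w, rfl⟩ := B.exists_smul_eq hq
    rw [hs, hc (w • q) p, hs, hc p q]
    simp [Complex.normSq_conj]
  have hKn : ContMDiff ((𝓟).prod 𝓟) 𝓘(ℝ, ℝ) ∞ (fun q : P × P => Complex.normSq (K q)) := by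
    have h1 : ContDiff ℝ ∞ (fun z : ℂ => z.re * z.re + z.im * z.im) :=
      (Complex.reCLM.contDiff.mul Complex.reCLM.contDiff).add
        (Complex.imCLM.contDiff.mul Complex.imCLM.contDiff)
    have h2 : (fun z : ℂ => z.re * z.re + z.im * z.im) = fun z => Complex.normSq z :=
      funext fun z => (Complex.normSq_apply z).symm
    rw [h2] at h1
    exact h1.contMDiff.comp hK
  -- The modulus of the kernel is invariant under both circle actions, so it descends to a
  -- continuous function on `M × M`.
  set k : M × M → ℝ := fun q => Complex.normSq (K (s q.1, s q.2))
  have hk : Continuous k := by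
    have h1 : ContMDiff ((𝓟).prod 𝓜) 𝓘(ℝ, ℝ) ∞
        (fun q : P × M => Complex.normSq (K (q.1, s q.2))) := by
      refine B.contMDiff_of_comp_proj (J := 𝓟) ?_
      exact hKn.congr fun q => hN _ _ _ _ rfl (hsx _)
    have h2 : ContMDiff ((𝓜).prod 𝓜) 𝓘(ℝ, ℝ) ∞
        (fun q : M × M => Complex.normSq (K (s q.2, s q.1))) := by
      refine B.contMDiff_of_comp_proj (J := 𝓜) ?_
      exact (h1.comp (contMDiff_snd.prodMk contMDiff_fst)).congr fun q => hN _ _ _ _ (hsx _) rfl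
    exact h2.continuous.comp continuous_swap
  set C : Set ((unitInterval × unitInterval) × (T × M)) :=
    {a | k (φ (a.1.1, a.2.1) a.2.2, φ (a.1.2, a.2.1) a.2.2) = 0}
  have hC : IsCompact C := by
    refine IsClosed.isCompact (isClosed_eq (hk.comp (Continuous.prodMk ?_ ?_)) continuous_const)
    · exact hφ.1.continuous.comp (f := fun a : (unitInterval × unitInterval) × (T × M) =>
        ((a.1.1, a.2.1), a.2.2)) (by fun_prop)
    · exact hφ.1.continuous.comp (f := fun a : (unitInterval × unitInterval) × (T × M) =>
        ((a.1.2, a.2.1), a.2.2)) (by fun_prop)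
  -- The time differences for which some point has positions with vanishing kernel form a closed
  -- set. It misses 0, since the kernel is positive on the diagonal, which yields a uniform step
  -- `δ`.
  have hC' : IsClosed ((fun a : (unitInterval × unitInterval) × (T × M) =>
      (a.1.1 : ℝ) - a.1.2) '' C) := (hC.image (by fun_prop)).isClosed
  obtain ⟨δ, hδ, hb⟩ := Metric.isOpen_iff.1 hC'.isOpen_compl 0 (by
    rintro ⟨⟨⟨t, t'⟩, ν, x⟩, ha, hb⟩
    obtain rfl : t = t' := Subtype.ext (sub_eq_zero.1 hb)
    obtain ⟨r, hr, hKr⟩ := hd (s (φ (t, ν) x))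
    have : Complex.normSq (K (s (φ (t, ν) x), s (φ (t, ν) x))) = 0 := ha
    rw [hKr, Complex.normSq_ofReal] at this
    exact (mul_pos hr hr).ne' this)
  obtain ⟨N, hNδ⟩ := exists_nat_one_div_lt hδ
  set a : ℕ → unitInterval := fun j => projIcc 0 1 zero_le_one ((j : ℝ) / (N + 1))
  have ha : ∀ j, |(a j : ℝ) - a (j + 1)| < δ := by
    intro j
    refine lt_of_le_of_lt (abs_projIcc_sub_projIcc _) (lt_of_eq_of_lt ?_ hNδ)
    rw [div_sub_div_same, abs_div, abs_of_pos (by positivity : (0 : ℝ) < N + 1)]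
    simp
  -- Induction on the number of steps: the family run up to the fraction `a j` of its time is
  -- lifted, and its quotient by the next one moves points so little that fibres are compared by a
  -- nonzero kernel.
  have key : ∀ j, ∃ G : unitInterval × T → Equiv.Perm P,
      B.IsLift ((𝓡∂ 1).prod J) G (fun q => φ (q.1 * a j, q.2)) := by
    have hsm : ∀ j, IsSmoothFamily 𝓜 ((𝓡∂ 1).prod J)
        (fun q : unitInterval × T => φ (q.1 * a j, q.2)) := fun j =>
      hφ.comp (u := fun q : unitInterval × T => (q.1 * a j, q.2))
        (((contMDiff_mul_right_unitInterval (a j)).comp contMDiff_fst).prodMk contMDiff_snd)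
    intro j
    induction j with
    | zero =>
      refine ⟨1, ?_⟩
      have h1 : (fun q : unitInterval × T => φ (q.1 * a 0, q.2)) = 1 := by
        funext q
        have : a 0 = 0 := by
          simp only [a, Nat.cast_zero, zero_div]
          exact projIcc_left zero_le_one
        rw [this, mul_zero, h0]
        rfl
      rw [h1]
      exact .one
    | succ j ih =>
      obtain ⟨G, hG⟩ := ih
      obtain ⟨G', hG'⟩ := exists_isLift_of_kernel_ne_zero hK hs hc
        ((hsm (j + 1)).mul (hsm j).inv) (by
          rintro ⟨t, ν⟩ p q hq hz
          have h1 : k (φ (t * a j, ν) ((φ (t * a j, ν))⁻¹ (B.proj p)),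
              φ (t * a (j + 1), ν) ((φ (t * a j, ν))⁻¹ (B.proj p))) = 0 := by
            refine (hN _ _ p q ?_ ?_).trans (by rw [hz, map_zero])
            · rw [hsx]
              simp
            · rw [hsx, hq]
              rfl
          refine hb ?_ ⟨((t * a j, t * a (j + 1)), (ν, (φ (t * a j, ν))⁻¹ (B.proj p))), h1, rfl⟩
          rw [Metric.mem_ball, dist_zero_right, Real.norm_eq_abs]
          have h2 : ((t * a j : unitInterval) : ℝ) - (t * a (j + 1) : unitInterval) =
              t * ((a j : ℝ) - a (j + 1)) := by
            push_cast
            ring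
          refine (congrArg abs h2).trans_lt ?_
          rw [abs_mul, abs_of_nonneg t.2.1]
          exact lt_of_le_of_lt (mul_le_of_le_one_left (abs_nonneg _) t.2.2) (ha j))
      refine ⟨G' * G, ?_⟩
      have h1 := hG'.mul hG
      rwa [mul_assoc, inv_mul_cancel, mul_one] at h1
  obtain ⟨G, hG⟩ := key (N + 1)
  have ha1 : a (N + 1) = 1 := by
    have : ((N + 1 : ℕ) : ℝ) / (N + 1) = 1 := by
      push_cast
      exact div_self (by positivity)
    simp only [a, this]
    exact projIcc_right zero_le_one
  simp only [ha1, mul_one] at hG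
  have hu : ContMDiff ((𝓡∂ 1).prod J) ((𝓡∂ 1).prod J) ∞
      (fun q : unitInterval × T => ((0 : unitInterval), q.2)) :=
    contMDiff_const.prodMk contMDiff_snd
  have hz := hG.comp hu
  -- Dividing by the value at time 0, which lifts the identity, makes the lift start at the
  -- identity.
  refine ⟨G * (fun q : unitInterval × T => G (0, q.2))⁻¹, ?_, fun ν => ?_⟩
  · have h1 := hG.mul hz.inv
    have h2 : (φ * (fun q : unitInterval × T => φ (0, q.2))⁻¹) = φ := by
      funext q
      simp [h0]
    exact h2 ▸ h1
  · exact mul_inv_cancel _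

end Lift

/-! ### Lifts with prescribed Hamiltonian -/

section Preserves

variable [IsManifold (𝓡 (2 * n + 1)) ∞ P]

/-- A path of diffeomorphisms satisfying the Hamiltonian equations preserves the connection
form. -/
theorem preservedBy_of_hamiltonianAt {G : unitInterval → Equiv.Perm P}
    (hG : IsSmoothFamily 𝓟 (𝓡∂ 1) G) (h0 : G 0 = 1) {f : unitInterval × M → ℝ}
    (hfs : ContMDiff ((𝓡∂ 1).prod 𝓜) 𝓘(ℝ, ℝ) ∞ f)
    (hf : ∀ t p, B.HamiltonianAt (fun x => f (t, x)) (G t p)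
      (unitDeriv 𝓟 (fun t' => G t' p) t)) (t : unitInterval) : B.α.PreservedBy (G t) := by
  have key := tangent_induction (I := 𝓟) (X := P) (fun p v =>
    B.α (G t p) ![mfderiv 𝓟 𝓟 (G t) p v] = B.α p ![v]) ?_ ?_
  · intro p
    ext v
    have hv : v = ![v 0] := by
      funext i
      fin_cases i
      rfl
    rw [hv]
    refine Eq.trans ?_ (key p (v 0))
    refine congrArg (B.α (G t p)) (funext fun i => ?_)
    fin_cases i
    rfl
  · intro c hc
    have hu : ContMDiff ((𝓡∂ 1).prod (𝓡∂ 1)) 𝓟 ∞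
        (fun q : unitInterval × unitInterval => G q.1 (c q.2)) :=
      hG.1.comp (contMDiff_fst.prodMk (hc.comp contMDiff_snd))
    have hu' : ContMDiff ((𝓡∂ 1).prod (𝓡∂ 1)) 𝓟 ∞
        (fun q : unitInterval × unitInterval => G q.2 (c q.1)) :=
      hG.1.comp (contMDiff_snd.prodMk (hc.comp contMDiff_fst))
    have hcomp : ∀ t' : unitInterval, unitDeriv 𝓟 (fun s' => G t' (c s')) 0 =
        mfderiv 𝓟 𝓟 (G t') (c 0) (unitDeriv 𝓟 c 0) := fun t' =>
      unitDeriv_comp 0 (hG.mdifferentiable t' _) ((hc 0).mdifferentiableAt (by simp))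
    have hb : ContMDiff (𝓡∂ 1) 𝓘(ℝ, ℝ) ∞
        (fun t' => B.α (G t' (c 0)) ![unitDeriv 𝓟 (fun s' => G t' (c s')) 0]) := by
      have h1 := B.smooth_α.contMDiff_apply_one (contMDiff_unitDeriv hu')
      exact h1.comp (g := fun q : unitInterval × unitInterval =>
        B.α (G q.2 (c q.1)) ![unitDeriv 𝓟 (fun s' => G q.2 (c s')) q.1])
        (f := fun t' : unitInterval => ((0 : unitInterval), t'))
        (contMDiff_const.prodMk contMDiff_id)
    -- Cartan's formula read backwards: the curvature term and the differential of `f` cancel by the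
    -- Hamiltonian equation, so α of the transported vector is constant in time, and `G` starts at
    -- the identity.
    have h2 : ∀ t, (pathDeriv (fun t' => B.α (G t' (c 0))
        ![unitDeriv 𝓟 (fun s' => G t' (c s')) 0]) t : ℝ) = 0 := by
      intro t
      have h1 := B.smooth_α.pathDeriv_sub_pathDeriv hu t 0
      have h4 : (fun s' => B.α (G t (c s')) ![unitDeriv 𝓟 (fun t' => G t' (c s')) t]) =
          fun s' => -f (t, B.proj (G t (c s'))) := funext fun s' => (hf t (c s')).1
      have hft : ContMDiff 𝓜 𝓘(ℝ, ℝ) ∞ (fun x => f (t, x)) :=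
        hfs.comp (contMDiff_const.prodMk contMDiff_id)
      have hGc : ContMDiff (𝓡∂ 1) 𝓟 ∞ (fun s' => G t (c s')) :=
        hu.comp (f := fun s' : unitInterval => (t, s')) (contMDiff_const.prodMk contMDiff_id)
      have h5 : (pathDeriv (fun s' => B.α (G t (c s'))
          ![unitDeriv 𝓟 (fun t' => G t' (c s')) t]) 0 : ℝ) =
          -differential 𝓜 (fun x => f (t, x)) (B.proj (G t (c 0)))
            (mfderiv 𝓟 𝓜 B.proj (G t (c 0)) (unitDeriv 𝓟 (fun s' => G t (c s')) 0)) := by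
        rw [h4]
        have e1 := unitDeriv_comp (I := 𝓜) (J := 𝓘(ℝ, ℝ)) (f := fun x => -f (t, x))
          (c := fun s' => B.proj (G t (c s'))) 0 ((hft.neg _).mdifferentiableAt (by simp))
          (((B.smooth_proj.comp hGc) 0).mdifferentiableAt (by simp))
        have e2 := unitDeriv_comp (I := 𝓟) (J := 𝓜) (f := B.proj)
          (c := fun s' => G t (c s')) 0 (B.mdifferentiable_proj _)
          ((hGc 0).mdifferentiableAt (by simp))
        refine e1.trans ?_
        rw [e2]
        exact DFunLike.congr_fun (mfderiv_neg (f := fun x => f (t, x))) _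
      have h6 := B.d_α_apply (G t (c 0)) (unitDeriv 𝓟 (fun t' => G t' (c 0)) t)
        (unitDeriv 𝓟 (fun s' => G t (c s')) 0)
      have h7 := (hf t (c 0)).2
        (mfderiv 𝓟 𝓜 B.proj (G t (c 0)) (unitDeriv 𝓟 (fun s' => G t (c s')) 0))
      have h8 : ∀ a b o d : ℝ, a - b = o → b = -d → ∀ m : ℝ, o = -m → m + d = 0 → a = 0 := by
        intro a b o d e1 e2 m e3 e4
        linarith
      exact h8 _ _ _ _ h1 h5 _ h6 h7
    have h3 := eq_of_pathDeriv_eq_pathDeriv hb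
      (contMDiff_const (c := B.α (c 0) ![unitDeriv 𝓟 c 0])) (by
        have : ∀ g : Equiv.Perm P, g = 1 → B.α (g (c 0)) ![unitDeriv 𝓟 (fun s => g (c s)) 0] =
            B.α (c 0) ![unitDeriv 𝓟 c 0] := by
          rintro g rfl
          rfl
        exact this _ h0) (fun t => (h2 t).trans (pathDeriv_const _ _).symm) t
    rw [hcomp] at h3
    exact h3
  · intro p v r hr h
    have e1 : B.α (G t p) ![mfderiv 𝓟 𝓟 (G t) p (r • v)] =
        r * B.α (G t p) ![mfderiv 𝓟 𝓟 (G t) p v] :=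
      (congrArg (fun u => B.α (G t p) ![u]) (map_smul (mfderiv 𝓟 𝓟 (G t) p) r v)).trans
        (oneForm_smul (B.α (G t p)) r _)
    have e2 : B.α p ![r • v] = r * B.α p ![v] := oneForm_smul (B.α p) r _
    have e3 := e1.symm.trans (h.trans e2)
    exact mul_left_cancel₀ hr.ne' e3

end Preserves

section PreqLift

variable {E' : Type} [NormedAddCommGroup E'] [NormedSpace ℝ E']
  {H' : Type*} [TopologicalSpace H'] {J : ModelWithCorners ℝ E' H'}
  {T : Type*} [TopologicalSpace T] [ChartedSpace H' T] [IsManifold J ∞ T]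

theorem hamiltonianAt_of_comp_proj {f : M → ℝ} {c : unitInterval → P} {t : unitInterval}
    (hc : MDifferentiableAt (𝓡∂ 1) 𝓟 c t) {d : unitInterval → M} (hd : ∀ t', B.proj (c t') = d t')
    (hα : B.α (c t) ![unitDeriv 𝓟 c t] = -f (d t))
    (hΩ : ∀ w : TangentSpace 𝓜 (d t), Ω.form (d t) ![unitDeriv 𝓜 d t, w] +
      differential 𝓜 f (d t) w = 0) : B.HamiltonianAt f (c t) (unitDeriv 𝓟 c t) := by
  obtain rfl : (fun t' => B.proj (c t')) = d := funext hd
  refine ⟨hα, fun w => ?_⟩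
  rw [← unitDeriv_comp t (B.mdifferentiable_proj _) hc]
  exact hΩ w

/-- Changing an equivariant family by a circle-invariant angle. -/
def rotate (θ : T → P → ℝ) (hθ : ∀ t (z : Circle) p, θ t (z • p) = θ t p)
    (G : T → Equiv.Perm P) (hG : ∀ (t : T) (z : Circle) (p : P), G t (z • p) = z • G t p) (t : T) :
    Equiv.Perm P where
  toFun p := Circle.exp (θ t p) • G t p
  invFun p := Circle.exp (-θ t ((G t)⁻¹ p)) • (G t)⁻¹ p
  left_inv p := by
    have h1 : (G t)⁻¹ (Circle.exp (θ t p) • G t p) = Circle.exp (θ t p) • p := by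
      rw [← hG]
      simp
    simp only [h1, hθ]
    rw [Circle.exp_neg, inv_smul_smul]
  right_inv p := by
    simp only [hθ, hG]
    rw [Circle.exp_neg, smul_inv_smul]
    simp

theorem isSmoothFamily_rotate {θ : T → P → ℝ} {hθ : ∀ t (z : Circle) p, θ t (z • p) = θ t p}
    (B : PrequantumBundle Ω P) {G : T → Equiv.Perm P}
    {hG : ∀ (t : T) (z : Circle) (p : P), G t (z • p) = z • G t p}
    (hs : IsSmoothFamily 𝓟 J G) (hθs : ContMDiff (J.prod 𝓟) 𝓘(ℝ, ℝ) ∞ (fun q : T × P => θ q.1 q.2)) :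
    IsSmoothFamily 𝓟 J (rotate θ hθ G hG) := by
  constructor
  · exact B.smooth_smul.comp ((contMDiff_circleExp.comp hθs).prodMk hs.1)
  · exact B.smooth_smul.comp
      ((contMDiff_circleExp.comp (hθs.comp (contMDiff_fst.prodMk hs.2)).neg).prodMk hs.2)

variable [IsManifold (𝓡 (2 * n)) ∞ M] [IsManifold (𝓡 (2 * n + 1)) ∞ P]

/-- The lift of a family of Hamiltonian diffeomorphisms with given Hamiltonians. -/
theorem exists_preqFamily [T2Space M] [CompactSpace M] [CompactSpace T]
    (B : PrequantumBundle Ω P) {φ : unitInterval × T → Equiv.Perm M}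
    (hφ : IsSmoothFamily 𝓜 ((𝓡∂ 1).prod J) φ) (h0 : ∀ ν, φ (0, ν) = 1)
    {f : (unitInterval × T) × M → ℝ} (hfs : ContMDiff (((𝓡∂ 1).prod J).prod 𝓜) 𝓘(ℝ, ℝ) ∞ f)
    (hf : ∀ t ν x, ∀ w : TangentSpace 𝓜 (φ (t, ν) x),
      Ω.form (φ (t, ν) x) ![unitDeriv 𝓜 (fun t' => φ (t', ν) x) t, w] +
        differential 𝓜 (fun x => f ((t, ν), x)) (φ (t, ν) x) w = 0) :
    ∃ G : unitInterval × T → Equiv.Perm P, B.IsPreqFamily ((𝓡∂ 1).prod J) G ∧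
      (∀ ν, G (0, ν) = 1) ∧ (∀ q p, B.proj (G q p) = φ q (B.proj p)) ∧
      ∀ t ν p, B.HamiltonianAt (fun x => f ((t, ν), x)) (G (t, ν) p)
        (unitDeriv 𝓟 (fun t' => G (t', ν) p) t) := by
  obtain ⟨G, hG, hG0⟩ := B.exists_isLift hφ h0
  -- The missing angular speed. Rotating `G` by an angle whose time derivative is `h` gives α of the
  -- new velocity the value -f. It is circle-invariant, so the rotated family stays equivariant.
  set h : unitInterval × (T × P) → ℝ := fun q =>
    -f ((q.1, q.2.1), φ (q.1, q.2.1) (B.proj q.2.2)) -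
      B.α (G (q.1, q.2.1) q.2.2) ![unitDeriv 𝓟 (fun t' => G (t', q.2.1) q.2.2) q.1]
  have hpt : ContMDiff ((𝓡∂ 1).prod (J.prod 𝓟)) (((𝓡∂ 1).prod J)) ∞
      (fun q : unitInterval × (T × P) => (q.1, q.2.1)) :=
    contMDiff_fst.prodMk (contMDiff_fst.comp contMDiff_snd)
  have hh : ContMDiff ((𝓡∂ 1).prod (J.prod 𝓟)) 𝓘(ℝ, ℝ) ∞ h := by
    refine ContMDiff.sub (ContMDiff.neg ?_) ?_
    · exact hfs.comp (hpt.prodMk (hφ.1.comp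
        (hpt.prodMk (B.smooth_proj.comp (contMDiff_snd.comp contMDiff_snd)))))
    · have h1 : ContMDiff ((𝓡∂ 1).prod (J.prod 𝓟)) 𝓟 ∞
          (fun q : unitInterval × (T × P) => G (q.1, q.2.1) q.2.2) :=
        hG.smooth.1.comp (hpt.prodMk (contMDiff_snd.comp contMDiff_snd))
      exact B.smooth_α.contMDiff_apply_one (contMDiff_unitDeriv h1)
  have hinv : ∀ t ν (z : Circle) p, h (t, (ν, z • p)) = h (t, (ν, p)) := by
    intro t ν z p
    have hc : ContMDiff (𝓡∂ 1) 𝓟 ∞ (fun t' => G (t', ν) p) :=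
      hG.smooth.1.comp ((contMDiff_id.prodMk contMDiff_const).prodMk contMDiff_const)
    have h1 : B.α (G (t, ν) (z • p)) ![unitDeriv 𝓟 (fun t' => G (t', ν) (z • p)) t] =
        B.α (G (t, ν) p) ![unitDeriv 𝓟 (fun t' => G (t', ν) p) t] := by
      obtain ⟨r, rfl⟩ := Circle.exp_surjective z
      have h1 := B.α_unitDeriv_exp_smul (θ := fun _ => r) t mdifferentiableAt_const
        ((hc t).mdifferentiableAt (by simp))
      rw [pathDeriv_const, zero_add] at h1
      have key : ∀ u : unitInterval → P, u = (fun t' => Circle.exp r • G (t', ν) p) →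
          B.α (u t) ![unitDeriv 𝓟 u t] =
            B.α (G (t, ν) p) ![unitDeriv 𝓟 (fun t' => G (t', ν) p) t] := by
        rintro u rfl
        exact h1
      exact key _ (funext fun t' => hG.equivariant _ _ _)
    simp only [h, B.proj_smul]
    exact congrArg _ h1
  set θ : unitInterval × T → P → ℝ := fun q p =>
    ∫ r in (0 : ℝ)..q.1, h (projIcc 0 1 zero_le_one r, (q.2, p))
  have hθ : ∀ q (z : Circle) p, θ q (z • p) = θ q p := by
    intro q z p
    simp only [θ, hinv]
  have hθs : ContMDiff (((𝓡∂ 1).prod J).prod 𝓟) 𝓘(ℝ, ℝ) ∞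
      (fun q : (unitInterval × T) × P => θ q.1 q.2) := by
    have h1 := contMDiff_primitive hh
    exact h1.comp (g := fun q : unitInterval × (T × P) =>
      ∫ r in (0 : ℝ)..q.1, h (projIcc 0 1 zero_le_one r, q.2))
      (f := fun q : (unitInterval × T) × P => (q.1.1, (q.1.2, q.2)))
      ((contMDiff_fst.comp contMDiff_fst).prodMk
        ((contMDiff_snd.comp contMDiff_fst).prodMk contMDiff_snd))
  have hsm := isSmoothFamily_rotate (hθ := hθ) B (hG := hG.equivariant) hG.smooth hθs
  set Γ := rotate θ hθ G hG.equivariant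
  have hΓ0 : ∀ ν, Γ (0, ν) = 1 := by
    intro ν
    ext p
    change Circle.exp (θ (0, ν) p) • G (0, ν) p = p
    simp [θ, hG0]
  have hΓp : ∀ q p, B.proj (Γ q p) = φ q (B.proj p) := fun q p =>
    (B.proj_smul _ _).trans (hG.proj_apply q p)
  have hham : ∀ t ν p, B.HamiltonianAt (fun x => f ((t, ν), x)) (Γ (t, ν) p)
        (unitDeriv 𝓟 (fun t' => Γ (t', ν) p) t) := by
    intro t ν p
    have hν : ContMDiff (𝓡∂ 1) (((𝓡∂ 1).prod J).prod 𝓟) ∞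
        (fun t' : unitInterval => ((t', ν), p)) :=
      (contMDiff_id.prodMk contMDiff_const).prodMk contMDiff_const
    have hc : ContMDiff (𝓡∂ 1) 𝓟 ∞ (fun t' => Γ (t', ν) p) :=
      hsm.1.comp (f := fun t' : unitInterval => ((t', ν), p)) hν
    have hc' : ContMDiff (𝓡∂ 1) 𝓟 ∞ (fun t' => G (t', ν) p) :=
      hG.smooth.1.comp (f := fun t' : unitInterval => ((t', ν), p)) hν
    have hθc : ContMDiff (𝓡∂ 1) 𝓘(ℝ, ℝ) ∞ (fun t' => θ (t', ν) p) :=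
      hθs.comp (f := fun t' : unitInterval => ((t', ν), p)) hν
    refine hamiltonianAt_of_comp_proj (c := fun t' => Γ (t', ν) p)
      (d := fun t' => φ (t', ν) (B.proj p)) ((hc t).mdifferentiableAt (by simp))
      (fun t' => hΓp (t', ν) p) ?_ (hf t ν (B.proj p))
    have h1 := B.α_unitDeriv_exp_smul t ((hθc t).mdifferentiableAt (by simp))
      ((hc' t).mdifferentiableAt (by simp))
    refine h1.trans ?_
    have h2 : (pathDeriv (fun t' => θ (t', ν) p) t : ℝ) = h (t, (ν, p)) :=
      pathDeriv_integral (h := fun t' => h (t', (ν, p)))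
        (hh.continuous.comp (by fun_prop)) t
    rw [h2]
    simp only [h]
    ring
  refine ⟨Γ, ⟨hsm, ?_, fun q z p => ?_⟩, hΓ0, hΓp, hham⟩
  · rintro ⟨t, ν⟩
    have hu : ContMDiff (𝓡∂ 1) ((𝓡∂ 1).prod J) ∞ (fun t' : unitInterval => (t', ν)) :=
      contMDiff_id.prodMk contMDiff_const
    exact preservedBy_of_hamiltonianAt (f := fun q => f ((q.1, ν), q.2)) (hsm.comp hu) (hΓ0 ν)
      (hfs.comp ((hu.comp contMDiff_fst).prodMk contMDiff_snd)) (fun t p => hham t ν p) t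
  · change Circle.exp (θ q (z • p)) • G q (z • p) = z • Circle.exp (θ q p) • G q p
    rw [hθ, hG.equivariant, smul_comm]

end PreqLift

end PrequantumBundle

/-! ### Hamiltonians depending smoothly on the homotopy parameter -/

section Contraction

variable {E : Type*} [NormedAddCommGroup E] [NormedSpace ℝ E] [FiniteDimensional ℝ E]
  {H : Type*} [TopologicalSpace H] {I : ModelWithCorners ℝ E H} [I.Boundaryless]
  {X : Type*} [TopologicalSpace X] [ChartedSpace H X] [IsManifold I ∞ X] [T2Space X]

/-- A smooth contraction of a neighbourhood of `c`, extended to the whole manifold. -/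
theorem exists_local_contraction (c : X) : ∃ κ : unitInterval × X → X,
    ContMDiff ((𝓡∂ 1).prod I) I ∞ κ ∧ (∀ x, κ (0, x) = c) ∧ ∀ᶠ x in 𝓝 c, κ (1, x) = x := by
  obtain ⟨ε, hε, hb⟩ := Metric.isOpen_iff.1 (isOpen_extChartAt_target (I := I) c)
    (extChartAt I c c) (mem_extChartAt_target c)
  set y := extChartAt I c c
  have hV : (extChartAt I c) ⁻¹' (Metric.ball y ε) ∈ 𝓝 c :=
    (continuousAt_extChartAt c).preimage_mem_nhds (Metric.ball_mem_nhds _ hε)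
  obtain ⟨ρ, -, hρ⟩ := (SmoothBumpFunction.nhds_basis_tsupport (I := I) c).mem_iff.1 hV
  -- Cutting off by a bump function supported over the ball keeps `y + t • v x` in the chart target
  -- for every point of the manifold; where the bump equals 1, time 1 gives back `x`.
  set v : X → E := fun x => ρ x • (extChartAt I c x - y)
  have hv : ContMDiff I 𝓘(ℝ, E) ∞ v :=
    ρ.contMDiff_smul (((contMDiffOn_extChartAt (n := ∞)).sub contMDiffOn_const))
  have hmem : ∀ q : unitInterval × X, y + (q.1 : ℝ) • v q.2 ∈ (extChartAt I c).target := by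
    rintro ⟨t, x⟩
    apply hb
    rw [Metric.mem_ball, dist_eq_norm, add_sub_cancel_left]
    by_cases hx : ρ x = 0
    · simpa [v, hx] using hε
    · have h1 : extChartAt I c x ∈ Metric.ball y ε := hρ (subset_tsupport _ hx)
      rw [Metric.mem_ball, dist_eq_norm] at h1
      simp only [v]
      rw [smul_smul, norm_smul, Real.norm_eq_abs, abs_of_nonneg (mul_nonneg t.2.1 ρ.nonneg)]
      exact lt_of_le_of_lt (mul_le_of_le_one_left (norm_nonneg _)
        (mul_le_one₀ t.2.2 ρ.nonneg ρ.le_one)) h1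
  have ht : ContMDiff (𝓡∂ 1) 𝓘(ℝ, ℝ) ∞ (fun t : unitInterval => (t : ℝ)) :=
    contMDiff_subtypeVal_Icc
  have hs : ContMDiff ((𝓡∂ 1).prod I) 𝓘(ℝ, E) ∞
      (fun q : unitInterval × X => y + (q.1 : ℝ) • v q.2) :=
    contMDiff_const.add ((ht.comp contMDiff_fst).smul (hv.comp contMDiff_snd))
  refine ⟨fun q => (extChartAt I c).symm (y + (q.1 : ℝ) • v q.2),
    (contMDiffOn_extChartAt_symm c).comp_contMDiff hs hmem, fun x => by simp [y], ?_⟩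
  filter_upwards [ρ.eventuallyEq_one, extChartAt_source_mem_nhds (I := I) c] with x hx hx'
  have hx1 : ρ x = 1 := hx
  have h1 : y + ((1 : unitInterval) : ℝ) • v x = extChartAt I c x := by simp [v, hx1]
  exact (congrArg (extChartAt I c).symm h1).trans ((extChartAt I c).left_inv hx')

/-- The local contraction joins nearby points to the centre by smooth paths, along which `g` is
constant; connectedness does the rest. -/
theorem eq_of_differential_eq_zero [PreconnectedSpace X] {g : X → ℝ}
    (hg : ContMDiff I 𝓘(ℝ, ℝ) ∞ g) (h0 : ∀ x w, differential I g x w = 0) (x y : X) :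
    g x = g y := by
  have key : IsLocallyConstant g := by
    refine (IsLocallyConstant.iff_eventually_eq g).2 fun c => ?_
    obtain ⟨κ, hκ, hκ0, hκ1⟩ := exists_local_contraction (I := I) c
    filter_upwards [hκ1] with x hx
    have hc : ContMDiff (𝓡∂ 1) I ∞ (fun s => κ (s, x)) :=
      hκ.comp (contMDiff_id.prodMk contMDiff_const)
    have h1 := eq_of_unitDeriv_eq_zero (I := 𝓘(ℝ, ℝ)) (hg.comp hc) (fun t => ?_) 1 0
    · simpa [hκ0, hx] using h1
    · exact (unitDeriv_comp t ((hg _).mdifferentiableAt (by simp))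
        ((hc t).mdifferentiableAt (by simp))).trans (h0 _ _)
  exact key.apply_eq_of_isPreconnected isPreconnected_univ trivial trivial

end Contraction

namespace SymplecticForm

variable {n : ℕ} {M : Type*} [TopologicalSpace M]
  [ChartedSpace (EuclideanSpace ℝ (Fin (2 * n))) M]
  (Ω : SymplecticForm n M)

local notation "𝓜" => 𝓡 (2 * n)

variable {E' : Type} [NormedAddCommGroup E'] [NormedSpace ℝ E']
  {H' : Type*} [TopologicalSpace H'] (J : ModelWithCorners ℝ E' H')
  {T : Type*} [TopologicalSpace T] [ChartedSpace H' T]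

/-- The function `f` generates the family of paths `t ↦ φ (t, ν)`. -/
def FamilyGenerates (f : (unitInterval × T) × M → ℝ) (φ : unitInterval × T → Equiv.Perm M) :
    Prop :=
  ContMDiff (((𝓡∂ 1).prod J).prod 𝓜) 𝓘(ℝ, ℝ) ∞ f ∧
  ∀ t ν x, ∀ w : TangentSpace 𝓜 (φ (t, ν) x),
    Ω.form (φ (t, ν) x) ![unitDeriv 𝓜 (fun t' => φ (t', ν) x) t, w] +
      differential 𝓜 (fun x => f ((t, ν), x)) (φ (t, ν) x) w = 0

variable {Ω J} [IsManifold J ∞ T] [IsManifold (𝓡 (2 * n)) ∞ M] [T2Space M]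

theorem differential_sub_const {f : M → ℝ} (a : ℝ) (x : M) (w : TangentSpace 𝓜 x) :
    differential 𝓜 (fun y => f y - a) x w = differential 𝓜 f x w := by
  by_cases hf : MDifferentiableAt 𝓜 𝓘(ℝ, ℝ) f x
  · refine (DFunLike.congr_fun (mfderiv_sub hf
      (mdifferentiableAt_const (c := a))) w).trans ?_
    have : mfderiv 𝓜 𝓘(ℝ, ℝ) (fun _ : M => a) x = 0 := mfderiv_const
    exact (congrArg _ (DFunLike.congr_fun this w)).trans (sub_zero _)
  · have h2 : ¬ MDifferentiableAt 𝓜 𝓘(ℝ, ℝ) (fun y => f y - a) x := by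
      intro h
      have := h.add (mdifferentiableAt_const (c := a))
      refine hf (this.congr_of_eventuallyEq (Filter.Eventually.of_forall fun y => ?_))
      simp
    simp only [differential]
    rw [mfderiv_zero_of_not_mdifferentiableAt hf, mfderiv_zero_of_not_mdifferentiableAt h2]
    rfl

/-- The given Hamiltonians carry no smoothness in `ν`, being defined only up to functions of time.
Differences of their values at two points are integrals of the symplectic form along a curve, and
these depend smoothly on everything; so normalising at the trajectory of a base point produces a
smooth family. -/
theorem exists_familyGenerates [PreconnectedSpace M] [Nonempty M]
    {φ : unitInterval × T → Equiv.Perm M} (hφ : IsSmoothFamily 𝓜 ((𝓡∂ 1).prod J) φ)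
    (hg : ∀ ν, ∃ f, Generates Ω.form f (fun t => φ (t, ν))) :
    ∃ f, Ω.FamilyGenerates J f φ := by
  choose f hfs hf using hg
  let x₀ : M := Classical.arbitrary M
  -- Evaluated along trajectories, so that differences become integrals over curves moved by `φ`.
  -- The composition with `φ` is undone at the end.
  set F : (unitInterval × T) × M → ℝ := fun q =>
    f q.1.2 (q.1.1, φ q.1 q.2) - f q.1.2 (q.1.1, φ q.1 x₀)
  have hft : ∀ t ν, ContMDiff 𝓜 𝓘(ℝ, ℝ) ∞ (fun x => f ν (t, x)) := fun t ν =>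
    (hfs ν).comp (contMDiff_const.prodMk contMDiff_id)
  have hφt : ∀ q, ContMDiff 𝓜 𝓜 ∞ (φ q) := fun q =>
    hφ.1.comp (contMDiff_const.prodMk contMDiff_id)
  -- differences are smooth
  have hdiff : ∀ κ : unitInterval × M → M, ContMDiff ((𝓡∂ 1).prod 𝓜) 𝓜 ∞ κ →
      ContMDiff (((𝓡∂ 1).prod J).prod 𝓜) 𝓘(ℝ, ℝ) ∞
        (fun q : (unitInterval × T) × M => F (q.1, κ (1, q.2)) - F (q.1, κ (0, q.2))) := by
    intro κ hκ
    let u : unitInterval × (unitInterval × (T × M)) → M := fun q =>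
      φ (q.1, q.2.2.1) (κ (q.2.1, q.2.2.2))
    let u' : unitInterval × (unitInterval × (T × M)) → M := fun q =>
      φ (q.2.1, q.2.2.1) (κ (q.1, q.2.2.2))
    have hu : ContMDiff ((𝓡∂ 1).prod ((𝓡∂ 1).prod (J.prod 𝓜))) 𝓜 ∞ u :=
      hφ.1.comp ((contMDiff_fst.prodMk
        (contMDiff_fst.comp (contMDiff_snd.comp contMDiff_snd))).prodMk
        (hκ.comp ((contMDiff_fst.comp contMDiff_snd).prodMk
          (contMDiff_snd.comp (contMDiff_snd.comp contMDiff_snd)))))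
    have hu' : ContMDiff ((𝓡∂ 1).prod ((𝓡∂ 1).prod (J.prod 𝓜))) 𝓜 ∞ u' :=
      hφ.1.comp (((contMDiff_fst.comp contMDiff_snd).prodMk
        (contMDiff_fst.comp (contMDiff_snd.comp contMDiff_snd))).prodMk
        (hκ.comp (contMDiff_fst.prodMk
          (contMDiff_snd.comp (contMDiff_snd.comp contMDiff_snd)))))
    have h1 := contMDiff_unitDeriv hu
    have h2 := contMDiff_unitDeriv hu'
    have hsw : ContMDiff ((𝓡∂ 1).prod ((𝓡∂ 1).prod (J.prod 𝓜)))
        ((𝓡∂ 1).prod ((𝓡∂ 1).prod (J.prod 𝓜))) ∞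
        (fun q : unitInterval × (unitInterval × (T × M)) => (q.2.1, (q.1, q.2.2))) :=
      (contMDiff_fst.comp contMDiff_snd).prodMk
        (contMDiff_fst.prodMk (contMDiff_snd.comp contMDiff_snd))
    have h3 := Ω.smooth.contMDiff_apply_two h1 (h2.comp hsw)
    have hre : ContMDiff ((((𝓡∂ 1).prod J).prod 𝓜).prod (𝓡∂ 1))
        ((𝓡∂ 1).prod ((𝓡∂ 1).prod (J.prod 𝓜))) ∞
        (fun q : ((unitInterval × T) × M) × unitInterval =>
          (q.1.1.1, (q.2, (q.1.1.2, q.1.2)))) :=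
      (contMDiff_fst.comp (contMDiff_fst.comp contMDiff_fst)).prodMk
        (contMDiff_snd.prodMk ((contMDiff_snd.comp (contMDiff_fst.comp contMDiff_fst)).prodMk
          (contMDiff_snd.comp contMDiff_fst)))
    have h4 := contMDiff_integral (F := ℝ) (I := ((𝓡∂ 1).prod J).prod 𝓜)
      (volume : Measure unitInterval) (h3.comp hre)
    -- By the fundamental theorem of calculus and the Hamiltonian equation, the difference equals -∫
    -- Ω(∂_t u, ∂_s u) ds for u = φ(κ(s, x)). This expression no longer involves the chosen
    -- Hamiltonians.
    refine h4.neg.congr fun q => ?_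
    obtain ⟨⟨t, ν⟩, x⟩ := q
    have hc : ContMDiff (𝓡∂ 1) 𝓜 ∞ (fun s => κ (s, x)) :=
      hκ.comp (contMDiff_id.prodMk contMDiff_const)
    have hc' : ContMDiff (𝓡∂ 1) 𝓜 ∞ (fun s => φ (t, ν) (κ (s, x))) := (hφt (t, ν)).comp hc
    have hF : ContMDiff (𝓡∂ 1) 𝓘(ℝ, ℝ) ∞ (fun s => f ν (t, φ (t, ν) (κ (s, x)))) :=
      (hft t ν).comp hc'
    have h5 := integral_pathDeriv hF
    have h6 : ∀ s, (pathDeriv (fun s => f ν (t, φ (t, ν) (κ (s, x)))) s : ℝ) =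
        -Ω.form (φ (t, ν) (κ (s, x))) ![unitDeriv 𝓜 (fun t' => φ (t', ν) (κ (s, x))) t,
          unitDeriv 𝓜 (fun s' => φ (t, ν) (κ (s', x))) s] := by
      intro s
      have e1 := unitDeriv_comp (I := 𝓜) (J := 𝓘(ℝ, ℝ)) (f := fun x => f ν (t, x)) s
        ((hft t ν _).mdifferentiableAt (by simp)) ((hc' s).mdifferentiableAt (by simp))
      have e2 := hf ν t (κ (s, x)) (unitDeriv 𝓜 (fun s' => φ (t, ν) (κ (s', x))) s)
      exact e1.trans (eq_neg_of_add_eq_zero_right e2)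
    simp only [F, sub_sub_sub_cancel_right]
    refine h5.symm.trans ?_
    rw [integral_congr_ae (Filter.Eventually.of_forall h6), integral_neg]
    rfl
  have hS : ∀ x, ContMDiff ((𝓡∂ 1).prod J) 𝓘(ℝ, ℝ) ∞ (fun q : unitInterval × T => F (q, x)) := by
    -- Smoothness of `F (·, x)` is an open and closed condition on `x`, since nearby values differ
    -- by a smooth function; it holds at `x₀`, where `F` vanishes.
    have hloc : IsLocallyConstant (fun x =>
        ContMDiff ((𝓡∂ 1).prod J) 𝓘(ℝ, ℝ) ∞ (fun q : unitInterval × T => F (q, x))) := by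
      refine (IsLocallyConstant.iff_eventually_eq _).2 fun c => ?_
      obtain ⟨κ, hκ, hκ0, hκ1⟩ := exists_local_contraction (I := 𝓜) c
      filter_upwards [hκ1] with x hx
      have h1 : ContMDiff ((𝓡∂ 1).prod J) 𝓘(ℝ, ℝ) ∞
          (fun q : unitInterval × T => F (q, x) - F (q, c)) := by
        have := (hdiff κ hκ).comp (f := fun q : unitInterval × T => (q, x))
          (contMDiff_id.prodMk contMDiff_const)
        simpa [Function.comp_def, hκ0, hx] using this
      refine propext ⟨fun h => ?_, fun h => ?_⟩
      · exact (h.sub h1).congr fun q => by simp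
      · exact (h.add h1).congr fun q => by simp
    intro x
    have h1 := hloc.apply_eq_of_isPreconnected isPreconnected_univ (mem_univ x) (mem_univ x₀)
    refine (iff_of_eq h1).2 ?_
    simp only [F, sub_self]
    exact contMDiff_const
  have hF : ContMDiff (((𝓡∂ 1).prod J).prod 𝓜) 𝓘(ℝ, ℝ) ∞ F := by
    rintro ⟨q, c⟩
    obtain ⟨κ, hκ, hκ0, hκ1⟩ := exists_local_contraction (I := 𝓜) c
    have h1 := ((hdiff κ hκ).add ((hS c).comp contMDiff_fst)) (q, c)
    refine h1.congr_of_eventuallyEq ?_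
    have h2 : ∀ᶠ z : (unitInterval × T) × M in 𝓝 (q, c), κ (1, z.2) = z.2 :=
      (continuous_snd (X := unitInterval × T)).continuousAt (x := (q, c)) |>.eventually hκ1
    filter_upwards [h2] with z hz
    simp [hz, hκ0]
  refine ⟨fun q => F (q.1, (φ q.1)⁻¹ q.2), hF.comp (contMDiff_fst.prodMk hφ.2), ?_⟩
  intro t ν x w
  refine Eq.trans ?_ (hf ν t x w)
  refine congrArg _ ?_
  have h1 : (fun x => F ((t, ν), (φ (t, ν))⁻¹ x)) =
      fun x => f ν (t, x) - f ν (t, φ (t, ν) x₀) := by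
    funext x
    simp [F]
  refine Eq.trans ?_ (differential_sub_const (f ν (t, φ (t, ν) x₀)) (φ (t, ν) x) w)
  exact congrArg (fun g : M → ℝ => differential 𝓜 g (φ (t, ν) x) w) h1

variable [CompactSpace M] [MeasurableSpace M] [BorelSpace M]

theorem integral_sub_mean [Nonempty M] {g : M → ℝ} (hg : Continuous g) :
    ∫ x, (g x - (Ω.liouville.real univ)⁻¹ * ∫ x, g x ∂Ω.liouville) ∂Ω.liouville = 0 := by
  have := ChartedSpace.secondCountable_of_sigmaCompact (EuclideanSpace ℝ (Fin (2 * n))) M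
  rw [integral_sub (integrable_of_continuous_compactSpace _ hg) (integrable_const _),
    integral_const, smul_eq_mul, mul_inv_cancel_left₀ Ω.liouville_real_univ_pos.ne', sub_self]

/-- Subtracting the mean over `M` leaves the differential unchanged, and the mean is smooth in the
parameters by `contMDiff_integral`. -/
theorem exists_familyGenerates_normalised [PreconnectedSpace M] [Nonempty M]
    {φ : unitInterval × T → Equiv.Perm M} (hφ : IsSmoothFamily 𝓜 ((𝓡∂ 1).prod J) φ)
    (hg : ∀ ν, ∃ f, Generates Ω.form f (fun t => φ (t, ν))) :
    ∃ f, Ω.FamilyGenerates J f φ ∧ ∀ q, ∫ x, f (q, x) ∂Ω.liouville = 0 := by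
  have := ChartedSpace.secondCountable_of_sigmaCompact (EuclideanSpace ℝ (Fin (2 * n))) M
  obtain ⟨f, hfs, hf⟩ := exists_familyGenerates hφ hg
  set m : unitInterval × T → ℝ := fun q =>
    (Ω.liouville.real univ)⁻¹ * ∫ x, f (q, x) ∂Ω.liouville
  have hm : ContMDiff ((𝓡∂ 1).prod J) 𝓘(ℝ, ℝ) ∞ m :=
    contMDiff_const.mul (contMDiff_integral (F := ℝ) (J := 𝓜) Ω.liouville hfs)
  refine ⟨fun q => f q - m q.1, ⟨hfs.sub (hm.comp contMDiff_fst), fun t ν x w => ?_⟩, fun q => ?_⟩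
  · refine Eq.trans (congrArg _ ?_) (hf t ν x w)
    exact differential_sub_const (m (t, ν)) (φ (t, ν) x) w
  · exact integral_sub_mean (hfs.continuous.comp (by fun_prop : Continuous fun x => (q, x)))

end SymplecticForm

/-! ### Uniqueness of lifts and the normalised lift -/

namespace PrequantumBundle

variable {n : ℕ} {M : Type*} [TopologicalSpace M]
  [ChartedSpace (EuclideanSpace ℝ (Fin (2 * n))) M] {Ω : SymplecticForm n M}
  {P : Type*} [TopologicalSpace P]
  [ChartedSpace (EuclideanSpace ℝ (Fin (2 * n + 1))) P] [MulAction Circle P]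
  {B : PrequantumBundle Ω P}

local notation "𝓜" => 𝓡 (2 * n)
local notation "𝓟" => 𝓡 (2 * n + 1)

/-- Nondegeneracy determines the projection of the vector, and its α component is prescribed;
together they determine the vector. -/
theorem HamiltonianAt.unique {f : M → ℝ} {p : P} {v v' : TangentSpace 𝓟 p}
    (h : B.HamiltonianAt f p v) (h' : B.HamiltonianAt f p v') : v = v' := by
  refine B.eq_of_horizontal (sub_eq_zero.1 ?_) (h.1.trans h'.1.symm)
  refine Ω.nondegenerate _ _ fun w => ?_
  have e1 := h.2 w
  have e2 := h'.2 w
  have e3 : Ω.form (B.proj p) ![mfderiv 𝓟 𝓜 B.proj p v - mfderiv 𝓟 𝓜 B.proj p v', w] =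
      Ω.form (B.proj p) ![mfderiv 𝓟 𝓜 B.proj p v, w] -
      Ω.form (B.proj p) ![mfderiv 𝓟 𝓜 B.proj p v', w] :=
    LinearMap.map_sub₂ (bilinOf (E := EuclideanSpace ℝ (Fin (2 * n))) (Ω.form (B.proj p))) _ _ _
  rw [e3]
  linarith

theorem eq_zero_of_mfderiv_eq_zero {E : Type*} [NormedAddCommGroup E] [NormedSpace ℝ E]
    {H : Type*} [TopologicalSpace H] {I : ModelWithCorners ℝ E H}
    {X : Type*} [TopologicalSpace X] [ChartedSpace H X] {φ : Equiv.Perm X}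
    (hφ : MDifferentiable I I φ) (hi : MDifferentiable I I (φ⁻¹ : Equiv.Perm X)) {x : X}
    {v : TangentSpace I x} (h : mfderiv I I φ x v = 0) : v = 0 := by
  have h1 := mfderiv_comp_apply (I := I) (I' := I) (I'' := I) x (hi (φ x)) (hφ x) v
  have h2 : ((φ⁻¹ : Equiv.Perm X) : X → X) ∘ φ = id := by ext; simp
  have h3 : ∀ g : X → X, g = id → (mfderiv I I g x v : E) = v := by
    rintro g rfl
    rw [mfderiv_id]
    rfl
  refine (h3 _ h2).symm.trans (h1.trans ?_)
  rw [h]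
  exact map_zero _

section

variable [IsManifold (𝓡 (2 * n + 1)) ∞ P]

/-- A path of automorphisms is determined by its Hamiltonian. -/
theorem eq_of_isHamiltonianOf {f : unitInterval × M → ℝ} {γ γ' : B.PreqPath}
    (h : B.IsHamiltonianOf f γ) (h' : B.IsHamiltonianOf f γ') : γ = γ' := by
  -- At each point both paths have the velocity prescribed by `f`. The product rule then forces the
  -- velocity of the quotient `δ` to vanish, so no uniqueness theorem for differential equations is
  -- needed.
  obtain ⟨δ, rfl⟩ : ∃ δ, γ' = γ * δ := ⟨γ⁻¹ * γ', by simp⟩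
  have hγ := (isPreqFamily_path γ).smooth
  have hδ := (isPreqFamily_path δ).smooth
  have h1 : ∀ t p, velocity 𝓟 δ.1 t p = 0 := by
    intro t p
    have e1 := velocity_mul hγ hδ t p
    have e2 := ((isHamiltonianOf_iff.1 h).2 t (δ.1 t p)).unique
      ((isHamiltonianOf_iff.1 h').2 t p)
    have e3 : mfderiv 𝓟 𝓟 (γ.1 t) (δ.1 t p) (velocity 𝓟 δ.1 t p) = 0 := by
      have e4 := e2.trans e1
      exact left_eq_add.1 e4
    exact eq_zero_of_mfderiv_eq_zero (hγ.mdifferentiable t) (hγ.inv.mdifferentiable t) e3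
  have h2 : δ = 1 := by
    refine Subtype.ext (funext fun t => Equiv.ext fun p => ?_)
    have h3 := eq_of_unitDeriv_eq_zero (I := 𝓟) (c := fun t => δ.1 t p)
      (hδ.1.comp (contMDiff_id.prodMk contMDiff_const)) (fun t => h1 t p) t 0
    rw [δ.2.1] at h3
    exact h3
  rw [h2, mul_one]

end

variable [IsManifold (𝓡 (2 * n)) ∞ M] [IsManifold (𝓡 (2 * n + 1)) ∞ P]
  [T2Space M] [CompactSpace M] [ConnectedSpace M] [MeasurableSpace M] [BorelSpace M]

/-- Two Hamiltonians of the same path on the base differ by a function of time. -/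
theorem hamiltonian_sub_eq {f f' : unitInterval × M → ℝ} {φ : unitInterval → Equiv.Perm M}
    (h : Generates Ω.form f φ) (h' : Generates Ω.form f' φ) (t : unitInterval) (x y : M) :
    f (t, x) - f' (t, x) = f (t, y) - f' (t, y) := by
  have hs : ∀ {f}, Generates Ω.form f φ → ContMDiff 𝓜 𝓘(ℝ, ℝ) ∞ (fun x => f (t, x)) := fun h =>
    h.1.comp (contMDiff_const.prodMk contMDiff_id)
  refine eq_of_differential_eq_zero (I := 𝓜) (g := fun x => f (t, x) - f' (t, x))
    ((hs h).sub (hs h')) (fun x w => ?_) x y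
  obtain ⟨z, rfl⟩ := (φ t).surjective x
  have e1 := h.2 t z w
  have e2 := h'.2 t z w
  have e3 : differential 𝓜 (fun x => f (t, x) - f' (t, x)) (φ t z) w =
      differential 𝓜 (fun x => f (t, x)) (φ t z) w -
      differential 𝓜 (fun x => f' (t, x)) (φ t z) w :=
    DFunLike.congr_fun (mfderiv_sub (h.mdifferentiableAt t _) (h'.mdifferentiableAt t _)) w
  rw [e3]
  linarith

theorem IsHamiltonianOf.generates {f : unitInterval × M → ℝ} {γ : B.PreqPath} {φ : Ω.HamPath}
    (h : B.IsHamiltonianOf f γ) (hl : B.Lifts γ φ) : Generates Ω.form f φ.1 :=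
  generates_of_hamiltonianAt (isPreqFamily_path γ).smooth hl (isHamiltonianOf_iff.1 h).1
    (isHamiltonianOf_iff.1 h).2

/-- The two Hamiltonians generate the same base path, so they differ by a function of time on the
connected manifold. The zero means and the positive volume make it vanish, and a path is determined
by its Hamiltonian. -/
theorem eq_of_lifts_of_isNormalised {γ γ' : B.PreqPath} {φ : Ω.HamPath} (h : B.Lifts γ φ)
    (hn : B.IsNormalised γ) (h' : B.Lifts γ' φ) (hn' : B.IsNormalised γ') : γ = γ' := by
  have := ChartedSpace.secondCountable_of_sigmaCompact (EuclideanSpace ℝ (Fin (2 * n))) M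
  obtain ⟨f, hf, hfi⟩ := hn
  obtain ⟨f', hf', hfi'⟩ := hn'
  have hi : ∀ {f} {γ : B.PreqPath}, B.IsHamiltonianOf f γ → ∀ t,
      Integrable (fun x => f (t, x)) Ω.liouville := fun hf t =>
    integrable_of_continuous_compactSpace _
      (hf.1.continuous.comp (by fun_prop : Continuous fun x => (t, x)))
  have h1 : f = f' := by
    funext ⟨t, x⟩
    have h2 := fun y => hamiltonian_sub_eq (hf.generates h) (hf'.generates h') t y x
    have h3 : ∫ y, (f (t, y) - f' (t, y)) ∂Ω.liouville = 0 := by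
      rw [integral_sub (hi hf t) (hi hf' t), hfi, hfi', sub_self]
    simp only [h2] at h3
    rw [integral_const, smul_eq_mul] at h3
    exact sub_eq_zero.1 ((mul_eq_zero.1 h3).resolve_left Ω.liouville_real_univ_pos.ne')
  exact eq_of_isHamiltonianOf hf (h1 ▸ hf')

/-- The normalised lift of a family of Hamiltonian paths. -/
theorem exists_normalised_preqFamily {φ : unitInterval × unitInterval → Equiv.Perm M}
    (B : PrequantumBundle Ω P)
    (hφ : IsSmoothFamily 𝓜 ((𝓡∂ 1).prod (𝓡∂ 1)) φ) (h0 : ∀ ν, φ (0, ν) = 1)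
    (hg : ∀ ν, ∃ f, Generates Ω.form f (fun t => φ (t, ν))) :
    ∃ (G : unitInterval × unitInterval → Equiv.Perm P)
      (f : (unitInterval × unitInterval) × M → ℝ),
      B.IsPreqFamily ((𝓡∂ 1).prod (𝓡∂ 1)) G ∧ (∀ ν, G (0, ν) = 1) ∧
      (∀ q p, B.proj (G q p) = φ q (B.proj p)) ∧
      ContMDiff (((𝓡∂ 1).prod (𝓡∂ 1)).prod 𝓜) 𝓘(ℝ, ℝ) ∞ f ∧
      (∀ t ν p, B.HamiltonianAt (fun x => f ((t, ν), x)) (G (t, ν) p)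
        (unitDeriv 𝓟 (fun t' => G (t', ν) p) t)) ∧
      ∀ q, ∫ x, f (q, x) ∂Ω.liouville = 0 := by
  obtain ⟨f, hf, hn⟩ := SymplecticForm.exists_familyGenerates_normalised hφ hg
  obtain ⟨G, hG, hG0, hGp, hGh⟩ := B.exists_preqFamily hφ h0 hf.1 hf.2
  exact ⟨G, f, hG, hG0, hGp, hf.1, hGh, hn⟩

theorem existsUnique_normalised_lift (B : PrequantumBundle Ω P) (φ : Ω.HamPath) :
    ∃! γ : B.PreqPath, B.Lifts γ φ ∧ B.IsNormalised γ := by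
  obtain ⟨G, f, hG, hG0, hGp, hfs, hGh, hn⟩ := B.exists_normalised_preqFamily
    (φ := fun q => φ.1 q.1) (φ.2.2.1.comp contMDiff_fst) (fun _ => φ.2.1) (fun _ => φ.2.2.2.2)
  have hu : ContMDiff (𝓡∂ 1) ((𝓡∂ 1).prod (𝓡∂ 1)) ∞
      (fun t : unitInterval => (t, (0 : unitInterval))) := contMDiff_id.prodMk contMDiff_const
  have hG' := hG.comp hu
  let γ : B.PreqPath := ⟨fun t => G (t, 0), hG0 0, hG'.smooth, hG'.preserves, hG'.equivariant⟩
  have hγ : B.IsNormalised γ := by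
    refine ⟨fun q => f ((q.1, 0), q.2), isHamiltonianOf_iff.2 ⟨?_, fun t p => hGh t 0 p⟩,
      fun t => hn (t, 0)⟩
    exact hfs.comp ((hu.comp contMDiff_fst).prodMk contMDiff_snd)
  exact ⟨γ, ⟨fun t p => hGp (t, 0) p, hγ⟩, fun γ' h =>
    eq_of_lifts_of_isNormalised h.1 h.2 (fun t p => hGp (t, 0) p) hγ⟩

end PrequantumBundle

/-! ### Homotopy invariance of the Calabi integral and of the normalised endpoint -/

section Calculus

theorem pathDeriv_neg {h : unitInterval → ℝ} {t : unitInterval}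
    (hh : MDifferentiableAt (𝓡∂ 1) 𝓘(ℝ, ℝ) h t) :
    (pathDeriv (fun t => -h t) t : ℝ) = -pathDeriv h t :=
  pathDeriv_eq_of_hasDerivWithinAt (hasDerivWithinAt_pathDeriv t hh).neg

/-- Differentiation under the integral sign. -/
theorem pathDeriv_integral_compactSpace {E' : Type*} [NormedAddCommGroup E'] [NormedSpace ℝ E']
    {H' : Type*} [TopologicalSpace H'] {J : ModelWithCorners ℝ E' H'}
    {X : Type*} [TopologicalSpace X] [ChartedSpace H' X] [IsManifold J ∞ X]
    [CompactSpace X] [SecondCountableTopology X] [MeasurableSpace X] [BorelSpace X]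
    (μ : Measure X) [IsFiniteMeasure μ] {h : unitInterval × X → ℝ}
    (hh : ContMDiff ((𝓡∂ 1).prod J) 𝓘(ℝ, ℝ) ∞ h) (t : unitInterval) :
    (pathDeriv (fun s => ∫ x, h (s, x) ∂μ) t : ℝ) =
      ∫ x, (pathDeriv (fun s => h (s, x)) t : ℝ) ∂μ := by
  have hd := contMDiff_pathDeriv hh
  set D : ℝ × X → ℝ →L[ℝ] ℝ := fun q => ContinuousLinearMap.toSpanSingleton ℝ
    (pathDeriv (F := ℝ) (fun s => h (s, q.2)) (projIcc 0 1 zero_le_one q.1))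
  have hp : Continuous fun q : ℝ × X => (projIcc (0 : ℝ) 1 zero_le_one q.1, q.2) :=
    (continuous_projIcc.comp continuous_fst).prodMk continuous_snd
  have hD : Continuous D :=
    (ContinuousLinearMap.toSpanSingletonCLE (𝕜 := ℝ) (E := ℝ)).continuous.comp
      (hd.continuous.comp hp)
  have h1 := hasFDerivWithinAt_integral_compactSpace μ (convex_Icc (0 : ℝ) 1)
    (h := fun q => h (projIcc 0 1 zero_le_one q.1, q.2)) (D := D)
    (hh.continuous.comp hp).continuousOn hD.continuousOn (fun e he x => by
      have hc : ContMDiff (𝓡∂ 1) 𝓘(ℝ, ℝ) ∞ (fun s => h (s, x)) :=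
        hh.comp (contMDiff_id.prodMk contMDiff_const)
      have h2 := hasDerivWithinAt_pathDeriv ⟨e, he⟩ ((hc _).mdifferentiableAt (by simp))
      have h3 : projIcc 0 1 zero_le_one e = ⟨e, he⟩ := projIcc_of_mem _ he
      simp only [D, h3]
      exact h2.hasFDerivWithinAt) t.2
  have h4 := h1.hasDerivWithinAt
  refine pathDeriv_eq_of_hasDerivWithinAt (h4.congr_deriv ?_)
  rw [ContinuousLinearMap.integral_apply]
  · simp [D]
  · exact integrable_of_continuous_compactSpace μ
      (hD.comp (by fun_prop : Continuous fun x => ((t : ℝ), x)))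

end Calculus

namespace SymplecticForm

variable {n : ℕ} {M : Type*} [TopologicalSpace M]
  [ChartedSpace (EuclideanSpace ℝ (Fin (2 * n))) M] {Ω : SymplecticForm n M}
  [IsManifold (𝓡 (2 * n)) ∞ M] [CompactSpace M] [Nonempty M]
  [MeasurableSpace M] [BorelSpace M]

local notation "𝓜" => 𝓡 (2 * n)

theorem integral_comp_liouville {E' : Type*} [NormedAddCommGroup E'] [NormedSpace ℝ E']
    {H' : Type*} [TopologicalSpace H'] {J : ModelWithCorners ℝ E' H'}
    {T : Type*} [TopologicalSpace T] [ChartedSpace H' T] {φ : T → Equiv.Perm M}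
    (hφ : IsSmoothFamily 𝓜 J φ) (hp : ∀ t, Ω.form.PreservedBy (φ t)) (t : T) (g : M → ℝ) :
    ∫ x, g (φ t x) ∂Ω.liouville = ∫ x, g x ∂Ω.liouville := by
  have h1 : Continuous (φ t) :=
    hφ.1.continuous.comp (by fun_prop : Continuous fun x : M => (t, x))
  have h2 : Continuous ((φ t)⁻¹ : Equiv.Perm M) :=
    hφ.2.continuous.comp (by fun_prop : Continuous fun x : M => (t, x))
  have h3 := measurePreserving_liouville Ω (hp t) (hφ.mdifferentiable t) h1.measurable h2.measurable
  exact h3.integral_comp (Homeomorph.mk (φ t) h1 h2).measurableEmbedding g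

end SymplecticForm

namespace PrequantumBundle

variable {n : ℕ} {M : Type*} [TopologicalSpace M]
  [ChartedSpace (EuclideanSpace ℝ (Fin (2 * n))) M] {Ω : SymplecticForm n M}
  {P : Type*} [TopologicalSpace P]
  [ChartedSpace (EuclideanSpace ℝ (Fin (2 * n + 1))) P] [MulAction Circle P]
  {B : PrequantumBundle Ω P}

local notation "𝓜" => 𝓡 (2 * n)
local notation "𝓟" => 𝓡 (2 * n + 1)

theorem contMDiff_swap_unitInterval : ContMDiff ((𝓡∂ 1).prod (𝓡∂ 1)) ((𝓡∂ 1).prod (𝓡∂ 1)) ∞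
    (fun q : unitInterval × unitInterval => (q.2, q.1)) :=
  contMDiff_snd.prodMk contMDiff_fst

variable [IsManifold (𝓡 (2 * n)) ∞ M] [IsManifold (𝓡 (2 * n + 1)) ∞ P]
  [CompactSpace M] [Nonempty M] [MeasurableSpace M] [BorelSpace M]

/-- The Hamiltonians of the two directions of a two-parameter family of automorphisms satisfy
`∂_s ∫ f = ∂_t ∫ g`. -/
theorem IsPreqFamily.pathDeriv_integral_eq {G : unitInterval × unitInterval → Equiv.Perm P}
    (hG : B.IsPreqFamily ((𝓡∂ 1).prod (𝓡∂ 1)) G)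
    {f g : (unitInterval × unitInterval) × M → ℝ}
    (hfs : ContMDiff (((𝓡∂ 1).prod (𝓡∂ 1)).prod 𝓜) 𝓘(ℝ, ℝ) ∞ f)
    (hgs : ContMDiff (((𝓡∂ 1).prod (𝓡∂ 1)).prod 𝓜) 𝓘(ℝ, ℝ) ∞ g)
    (hf : ∀ t s p, B.HamiltonianAt (fun x => f ((t, s), x)) (G (t, s) p)
      (unitDeriv 𝓟 (fun t' => G (t', s) p) t))
    (hg : ∀ t s p, B.HamiltonianAt (fun x => g ((s, t), x)) (G (t, s) p)
      (unitDeriv 𝓟 (fun s' => G (t, s') p) s)) (t s : unitInterval) :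
    (pathDeriv (fun s' => ∫ x, f ((t, s'), x) ∂Ω.liouville) s : ℝ) =
      pathDeriv (fun t' => ∫ x, g ((s, t'), x) ∂Ω.liouville) t := by
  have := ChartedSpace.secondCountable_of_sigmaCompact (EuclideanSpace ℝ (Fin (2 * n))) M
  obtain ⟨φ, hφ, hp, hGφ⟩ := hG.exists_descent
  have hφ1 : ∀ t, ContMDiff ((𝓡∂ 1).prod 𝓜) 𝓜 ∞
      (fun q : unitInterval × M => φ (t, q.1) q.2) := fun t =>
    hφ.1.comp (f := fun q : unitInterval × M => ((t, q.1), q.2))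
      ((contMDiff_const.prodMk contMDiff_fst).prodMk contMDiff_snd)
  have hφ2 : ContMDiff ((𝓡∂ 1).prod 𝓜) 𝓜 ∞ (fun q : unitInterval × M => φ (q.1, s) q.2) :=
    hφ.1.comp (f := fun q : unitInterval × M => ((q.1, s), q.2))
      ((contMDiff_fst.prodMk contMDiff_const).prodMk contMDiff_snd)
  -- Cartan's formula concerns values along trajectories, so the Hamiltonians are composed with `φ`;
  -- this does not change integrals over `M`. In `hK` the function is frozen at time (t, s) and only
  -- the point moves.
  have hF : ContMDiff ((𝓡∂ 1).prod 𝓜) 𝓘(ℝ, ℝ) ∞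
      (fun q : unitInterval × M => f ((t, q.1), φ (t, q.1) q.2)) :=
    hfs.comp (f := fun q : unitInterval × M => ((t, q.1), φ (t, q.1) q.2))
      ((contMDiff_const.prodMk contMDiff_fst).prodMk (hφ1 t))
  have hK : ContMDiff ((𝓡∂ 1).prod 𝓜) 𝓘(ℝ, ℝ) ∞
      (fun q : unitInterval × M => f ((t, s), φ (t, q.1) q.2)) :=
    hfs.comp (f := fun q : unitInterval × M => ((t, s), φ (t, q.1) q.2))
      (contMDiff_const.prodMk (hφ1 t))
  have hL : ContMDiff ((𝓡∂ 1).prod 𝓜) 𝓘(ℝ, ℝ) ∞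
      (fun q : unitInterval × M => g ((s, q.1), φ (q.1, s) q.2)) :=
    hgs.comp (f := fun q : unitInterval × M => ((s, q.1), φ (q.1, s) q.2))
      ((contMDiff_const.prodMk contMDiff_fst).prodMk hφ2)
  have e1 := pathDeriv_integral_compactSpace Ω.liouville hF s
  have e2 := pathDeriv_integral_compactSpace Ω.liouville hK s
  have e3 := pathDeriv_integral_compactSpace Ω.liouville hL t
  have i1 : ∀ s', ∫ x, f ((t, s'), φ (t, s') x) ∂Ω.liouville = ∫ x, f ((t, s'), x) ∂Ω.liouville :=
    fun s' => SymplecticForm.integral_comp_liouville hφ hp (t, s') (fun x => f ((t, s'), x))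
  have i2 : ∀ s', ∫ x, f ((t, s), φ (t, s') x) ∂Ω.liouville = ∫ x, f ((t, s), x) ∂Ω.liouville :=
    fun s' => SymplecticForm.integral_comp_liouville hφ hp (t, s') (fun x => f ((t, s), x))
  have i3 : ∀ t', ∫ x, g ((s, t'), φ (t', s) x) ∂Ω.liouville = ∫ x, g ((s, t'), x) ∂Ω.liouville :=
    fun t' => SymplecticForm.integral_comp_liouville hφ hp (t', s) (fun x => g ((s, t'), x))
  simp only [i1] at e1
  simp only [i2] at e2
  simp only [i3] at e3
  -- The frozen function has an integral independent of `s'`, by invariance of the measure, so this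
  -- term disappears.
  rw [pathDeriv_const] at e2
  have hmd : ∀ {h : unitInterval × M → ℝ}, ContMDiff ((𝓡∂ 1).prod 𝓜) 𝓘(ℝ, ℝ) ∞ h →
      ∀ x r, MDifferentiableAt (𝓡∂ 1) 𝓘(ℝ, ℝ) (fun r => h (r, x)) r := fun hh x r =>
    ((hh.comp (contMDiff_id.prodMk contMDiff_const)) r).mdifferentiableAt (by simp)
  have hint : ∀ {h : unitInterval × M → ℝ}, ContMDiff ((𝓡∂ 1).prod 𝓜) 𝓘(ℝ, ℝ) ∞ h →
      ∀ r, Integrable (fun x => (pathDeriv (fun r => h (r, x)) r : ℝ)) Ω.liouville := fun hh r =>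
    integrable_of_continuous_compactSpace _ ((contMDiff_pathDeriv hh).continuous.comp
      (by fun_prop : Continuous fun x => (r, x)))
  -- Cartan's formula for α on (t', s') ↦ G(t', s') p, in which the curvature term becomes the
  -- derivative of the frozen `f` by the Hamiltonian equation in the `t` direction.
  have key : ∀ x, (pathDeriv (fun s' => f ((t, s'), φ (t, s') x)) s : ℝ) =
      pathDeriv (F := ℝ) (fun s' => f ((t, s), φ (t, s') x)) s +
        pathDeriv (F := ℝ) (fun t' => g ((s, t'), φ (t', s) x)) t := by
    intro x
    obtain ⟨p, rfl⟩ := B.proj_surjective x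
    have hu : ContMDiff ((𝓡∂ 1).prod (𝓡∂ 1)) 𝓟 ∞
        (fun q : unitInterval × unitInterval => G q p) :=
      hG.smooth.1.comp (contMDiff_id.prodMk contMDiff_const)
    have h1 := B.smooth_α.pathDeriv_sub_pathDeriv hu t s
    have h2 : (fun t' => B.α (G (t', s) p) ![unitDeriv 𝓟 (fun s' => G (t', s') p) s]) =
        fun t' => -g ((s, t'), φ (t', s) (B.proj p)) := by
      funext t'
      rw [(hg t' s p).1, hGφ]
    have h3 : (fun s' => B.α (G (t, s') p) ![unitDeriv 𝓟 (fun t' => G (t', s') p) t]) =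
        fun s' => -f ((t, s'), φ (t, s') (B.proj p)) := by
      funext s'
      rw [(hf t s' p).1, hGφ]
    have h4 := (congrArg (fun a => (pathDeriv (F := ℝ) a t)) h2).trans
      (pathDeriv_neg (hmd hL (B.proj p) t))
    have h5 := (congrArg (fun a => (pathDeriv (F := ℝ) a s)) h3).trans
      (pathDeriv_neg (hmd hF (B.proj p) s))
    have h6 := B.d_α_apply (G (t, s) p) (unitDeriv 𝓟 (fun t' => G (t', s) p) t)
      (unitDeriv 𝓟 (fun s' => G (t, s') p) s)
    have h7 := (hf t s p).2
      (mfderiv 𝓟 𝓜 B.proj (G (t, s) p) (unitDeriv 𝓟 (fun s' => G (t, s') p) s))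
    have hc : ContMDiff (𝓡∂ 1) 𝓟 ∞ (fun s' => G (t, s') p) :=
      hu.comp (f := fun s' : unitInterval => (t, s')) (contMDiff_const.prodMk contMDiff_id)
    have hft : ContMDiff 𝓜 𝓘(ℝ, ℝ) ∞ (fun x => f ((t, s), x)) :=
      hfs.comp (contMDiff_const.prodMk contMDiff_id)
    have h8 : (pathDeriv (fun s' => f ((t, s), φ (t, s') (B.proj p))) s : ℝ) =
        differential 𝓜 (fun x => f ((t, s), x)) (B.proj (G (t, s) p))
          (mfderiv 𝓟 𝓜 B.proj (G (t, s) p) (unitDeriv 𝓟 (fun s' => G (t, s') p) s)) := by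
      have h9 : (fun s' => f ((t, s), φ (t, s') (B.proj p))) =
          fun s' => f ((t, s), B.proj (G (t, s') p)) := by
        funext s'
        rw [hGφ]
      rw [h9]
      have e1 := unitDeriv_comp (I := 𝓜) (J := 𝓘(ℝ, ℝ)) (f := fun x => f ((t, s), x))
        (c := fun s' => B.proj (G (t, s') p)) s ((hft _).mdifferentiableAt (by simp))
        (((B.smooth_proj.comp hc) s).mdifferentiableAt (by simp))
      rw [unitDeriv_comp s (B.mdifferentiable_proj _) ((hc s).mdifferentiableAt (by simp))] at e1
      exact e1
    have h10 : ∀ a b c d o m : ℝ, a - b = o → ∀ a' b' : ℝ, a = -a' → b = -b' → o = -m →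
        m + d = 0 → c = d → b' = c + a' := by
      intro a b c d o m e1 a' b' e2 e3 e4 e5 e6
      linarith
    exact h10 _ _ _ _ _ _ h1 _ _ h4 h5 h6 h7 h8
  refine e1.trans ((integral_congr_ae (Filter.Eventually.of_forall key)).trans ?_)
  rw [integral_add (hint hK s) (hint hL t)]
  have e2' : ∫ x, (pathDeriv (F := ℝ) (fun s' => f ((t, s), φ (t, s') x)) s) ∂Ω.liouville = 0 :=
    e2.symm
  rw [e2', zero_add]
  exact e3.symm

theorem contMDiff_integral_liouville {f : (unitInterval × unitInterval) × M → ℝ}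
    (hfs : ContMDiff (((𝓡∂ 1).prod (𝓡∂ 1)).prod 𝓜) 𝓘(ℝ, ℝ) ∞ f) :
    ContMDiff ((𝓡∂ 1).prod (𝓡∂ 1)) 𝓘(ℝ, ℝ) ∞
      (fun q : unitInterval × unitInterval => ∫ x, f (q, x) ∂Ω.liouville) := by
  have := ChartedSpace.secondCountable_of_sigmaCompact (EuclideanSpace ℝ (Fin (2 * n))) M
  exact contMDiff_integral (F := ℝ) (J := 𝓜) Ω.liouville hfs

/-- The Hamiltonian vanishes where the path is stationary. -/
theorem HamiltonianAt.eq_zero {f : M → ℝ} {c : unitInterval → P} {s : unitInterval}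
    (h : B.HamiltonianAt f (c s) (unitDeriv 𝓟 c s)) (hc : ∀ s', c s' = c s) :
    f (B.proj (c s)) = 0 := by
  have h1 : ∀ c' : unitInterval → P, (∃ p, c' = fun _ => p) →
      B.α (c' s) ![unitDeriv 𝓟 c' s] = 0 := by
    rintro c' ⟨p, rfl⟩
    rw [unitDeriv_const]
    exact (linOf (B.α p)).map_zero
  have h2 := h1 c ⟨c s, funext hc⟩
  rw [h.1] at h2
  exact neg_eq_zero.1 h2

/-- The Calabi invariant does not change under homotopies with fixed endpoints. -/
theorem IsPreqFamily.integral_integral_eq {G : unitInterval × unitInterval → Equiv.Perm P}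
    (hG : B.IsPreqFamily ((𝓡∂ 1).prod (𝓡∂ 1)) G) (h0 : ∀ s, G (0, s) = G (0, 0))
    (h1 : ∀ s, G (1, s) = G (1, 0))
    {f : (unitInterval × unitInterval) × M → ℝ}
    (hfs : ContMDiff (((𝓡∂ 1).prod (𝓡∂ 1)).prod 𝓜) 𝓘(ℝ, ℝ) ∞ f)
    (hf : ∀ t s p, B.HamiltonianAt (fun x => f ((t, s), x)) (G (t, s) p)
      (unitDeriv 𝓟 (fun t' => G (t', s) p) t)) :
    ∫ t : unitInterval, ∫ x, f ((t, 0), x) ∂Ω.liouville =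
      ∫ t : unitInterval, ∫ x, f ((t, 1), x) ∂Ω.liouville := by
  -- The Hamiltonian in the direction of the homotopy parameter. The parameters are swapped, so `g`
  -- takes (s, t).
  obtain ⟨g, hgs, hg⟩ := (hG.comp contMDiff_swap_unitInterval).exists_hamiltonian
  have hg' : ∀ t s p, B.HamiltonianAt (fun x => g ((s, t), x)) (G (t, s) p)
      (unitDeriv 𝓟 (fun s' => G (t, s') p) s) := fun t s p => hg s t p
  -- At a time when the family does not depend on `s`, its velocity in that direction is zero; this
  -- applies to both ends of the homotopy.
  have hz : ∀ t, (∀ s, G (t, s) = G (t, 0)) → ∀ s x, g ((s, t), x) = 0 := by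
    intro t ht s x
    obtain ⟨q, rfl⟩ := B.proj_surjective x
    obtain ⟨p, rfl⟩ := (G (t, s)).surjective q
    exact (hg' t s p).eq_zero (c := fun s' => G (t, s') p) fun s' => by
      rw [ht, ht s]
  have hd := hG.pathDeriv_integral_eq hfs hgs hf hg'
  have hFs := contMDiff_integral_liouville (Ω := Ω) hfs
  have hGs := contMDiff_integral_liouville (Ω := Ω) hgs
  set F := fun q : unitInterval × unitInterval => ∫ x, f (q, x) ∂Ω.liouville
  set K := fun q : unitInterval × unitInterval => ∫ x, g (q, x) ∂Ω.liouville
  have hK : Continuous fun q : unitInterval × unitInterval =>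
      (pathDeriv (F := ℝ) (fun t' => K (q.2, t')) q.1) :=
    (contMDiff_pathDeriv (hGs.comp contMDiff_swap_unitInterval)).continuous
  have i1 : ∀ t, ∫ s, (pathDeriv (F := ℝ) (fun s' => F (t, s')) s) = F (t, 1) - F (t, 0) := fun t =>
    integral_pathDeriv (hFs.comp (contMDiff_const.prodMk contMDiff_id))
  have i2 : ∀ s, ∫ t, (pathDeriv (F := ℝ) (fun t' => K (s, t')) t) = 0 := by
    intro s
    refine (integral_pathDeriv (h := fun t' => K (s, t'))
      (hGs.comp (contMDiff_const.prodMk contMDiff_id))).trans ?_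
    simp [K, hz 0 h0, hz 1 h1]
  -- Integrating ∂_t ∫g over the square in the two orders gives 0 on one side, by the boundary
  -- values of `g`, and the difference of the two Calabi integrals on the other.
  have hsw := integral_integral_swap (μ := (volume : Measure unitInterval))
    (ν := (volume : Measure unitInterval))
    (f := fun t s => (pathDeriv (F := ℝ) (fun t' => K (s, t')) t))
    (integrable_of_continuous_compactSpace _ hK)
  simp only [i2, integral_zero] at hsw
  have h3 : ∀ t, ∫ s, (pathDeriv (F := ℝ) (fun t' => K (s, t')) t) = F (t, 1) - F (t, 0) := by
    intro t
    rw [← i1]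
    exact integral_congr_ae (Filter.Eventually.of_forall fun s => (hd t s).symm)
  simp only [h3] at hsw
  have hFi : ∀ s, Integrable fun t => F (t, s) := fun s =>
    integrable_of_continuous_compactSpace _ (hFs.continuous.comp (by fun_prop))
  rw [integral_sub (hFi 1) (hFi 0)] at hsw
  exact (sub_eq_zero.1 hsw).symm

/-- The endpoint of the normalised lift does not change under homotopies with fixed endpoints. -/
theorem IsPreqFamily.eq_of_normalised [T2Space M] [PreconnectedSpace M]
    {G : unitInterval × unitInterval → Equiv.Perm P}
    (hG : B.IsPreqFamily ((𝓡∂ 1).prod (𝓡∂ 1)) G) (h0 : ∀ s, G (0, s) = 1)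
    (h1 : ∀ s p, B.proj (G (1, s) p) = B.proj (G (1, 0) p))
    {f : (unitInterval × unitInterval) × M → ℝ}
    (hfs : ContMDiff (((𝓡∂ 1).prod (𝓡∂ 1)).prod 𝓜) 𝓘(ℝ, ℝ) ∞ f)
    (hf : ∀ t s p, B.HamiltonianAt (fun x => f ((t, s), x)) (G (t, s) p)
      (unitDeriv 𝓟 (fun t' => G (t', s) p) t))
    (hn : ∀ q, ∫ x, f (q, x) ∂Ω.liouville = 0) (s : unitInterval) : G (1, s) = G (1, 0) := by
  obtain ⟨g, hgs, hg⟩ := (hG.comp contMDiff_swap_unitInterval).exists_hamiltonian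
  have hg' : ∀ t s p, B.HamiltonianAt (fun x => g ((s, t), x)) (G (t, s) p)
      (unitDeriv 𝓟 (fun s' => G (t, s') p) s) := fun t s p => hg s t p
  have hz : ∀ s x, g ((s, 0), x) = 0 := by
    intro s x
    obtain ⟨q, rfl⟩ := B.proj_surjective x
    obtain ⟨p, rfl⟩ := (G (0, s)).surjective q
    exact (hg' 0 s p).eq_zero (c := fun s' => G (0, s') p) fun s' => by
      rw [h0, h0 s]
  have hd := hG.pathDeriv_integral_eq hfs hgs hf hg'
  have hGs := contMDiff_integral_liouville (Ω := Ω) hgs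
  -- Normalisation makes ∂_s ∫f zero, so ∫g is constant in `t`; it starts at 0 because the family is
  -- stationary in `s` at t = 0.
  have hK : ∀ s, ∫ x, g ((s, 1), x) ∂Ω.liouville = 0 := by
    intro s
    have h2 := eq_of_pathDeriv_eq_pathDeriv (h := fun t => ∫ x, g ((s, t), x) ∂Ω.liouville)
      (k := fun _ => 0) (hGs.comp (contMDiff_const.prodMk contMDiff_id)) contMDiff_const
      (by simp [hz]) (fun t => ?_) 1
    · exact h2
    · rw [← hd, pathDeriv_const]
      simp only [hn]
      exact pathDeriv_const _ _
  have hc : ∀ p, ContMDiff (𝓡∂ 1) 𝓟 ∞ (fun s => G (1, s) p) := fun p =>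
    hG.smooth.1.comp (f := fun s : unitInterval => (((1 : unitInterval), s), p))
      ((contMDiff_const.prodMk contMDiff_id).prodMk contMDiff_const)
  have hvert : ∀ s p, mfderiv 𝓟 𝓜 B.proj (G (1, s) p)
      (unitDeriv 𝓟 (fun s' => G (1, s') p) s) = 0 := by
    intro s p
    rw [← unitDeriv_comp s (B.mdifferentiable_proj _) ((hc p s).mdifferentiableAt (by simp))]
    have h2 : ∀ c : unitInterval → M, (∃ x, c = fun _ => x) →
        (unitDeriv 𝓜 c s : EuclideanSpace ℝ (Fin (2 * n))) = 0 := by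
      rintro c ⟨x, rfl⟩
      exact unitDeriv_const x s
    exact h2 _ ⟨_, funext fun s' => h1 s' p⟩
  -- On the base the endpoint is fixed, so the Hamiltonian vector field of `g` at t = 1 vanishes and
  -- `g` is constant; by `hK` this constant is 0.
  have hgc : ∀ s x y, g ((s, 1), x) = g ((s, 1), y) := by
    intro s
    refine eq_of_differential_eq_zero (I := 𝓜) (g := fun x => g ((s, 1), x))
      (hgs.comp (contMDiff_const.prodMk contMDiff_id)) fun x w => ?_
    obtain ⟨q, rfl⟩ := B.proj_surjective x
    obtain ⟨p, rfl⟩ := (G (1, s)).surjective q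
    have h2 := (hg' 1 s p).2 w
    rw [hvert] at h2
    have h3 : Ω.form (B.proj (G (1, s) p)) ![(0 : TangentSpace 𝓜 (B.proj (G (1, s) p))), w] = 0 :=
      (Ω.form (B.proj (G (1, s) p))).map_coord_zero 0 rfl
    have h4 : ∀ a b : ℝ, a + b = 0 → a = 0 → b = 0 := fun a b e1 e2 => by linarith
    exact h4 _ _ h2 h3
  have hg1 : ∀ s x, g ((s, 1), x) = 0 := by
    intro s x
    have h2 := hK s
    simp only [fun y => hgc s y x] at h2
    rw [integral_const, smul_eq_mul] at h2
    exact (mul_eq_zero.1 h2).resolve_left Ω.liouville_real_univ_pos.ne'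
  refine Equiv.ext fun p => ?_
  refine eq_of_unitDeriv_eq_zero (I := 𝓟) (c := fun s => G (1, s) p) (hc p) (fun s => ?_) s 0
  refine B.eq_zero_of_horizontal (hvert s p) ?_
  exact (hg' 1 s p).1.trans (neg_eq_zero.2 (hg1 s _))

end PrequantumBundle

/-! ### Paths of rotations and Hamiltonians of products -/

namespace PrequantumBundle

variable {n : ℕ} {M : Type*} [TopologicalSpace M]
  [ChartedSpace (EuclideanSpace ℝ (Fin (2 * n))) M] {Ω : SymplecticForm n M}
  {P : Type*} [TopologicalSpace P]
  [ChartedSpace (EuclideanSpace ℝ (Fin (2 * n + 1))) P] [MulAction Circle P]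
  {B : PrequantumBundle Ω P}

local notation "𝓜" => 𝓡 (2 * n)
local notation "𝓟" => 𝓡 (2 * n + 1)

section Angle

/-- A path of rotations of the fibres. -/
def anglePath (B : PrequantumBundle Ω P) (θ : unitInterval → ℝ)
    (hθ : ContMDiff (𝓡∂ 1) 𝓘(ℝ, ℝ) ∞ θ) (h0 : θ 0 = 0) : B.PreqPath :=
  ⟨fun t => MulAction.toPerm (Circle.exp (θ t)), by
    have h2 : ContMDiff (𝓡∂ 1) (𝓡 1) ∞ (fun t : unitInterval => Circle.exp (θ t)) :=
      contMDiff_circleExp.comp hθ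
    have h3 : ContMDiff (𝓡∂ 1) (𝓡 1) ∞ (fun t : unitInterval => (Circle.exp (θ t))⁻¹) := by
      have : ContMDiff (𝓡∂ 1) (𝓡 1) ∞ (fun t : unitInterval => Circle.exp (-θ t)) :=
        contMDiff_circleExp.comp hθ.neg
      simpa [Circle.exp_neg] using this
    refine ⟨?_, ⟨?_, ?_⟩, fun t => B.α_invariant _, fun t z p => ?_⟩
    · ext p
      simp [h0]
    · exact B.smooth_smul.comp ((h2.comp contMDiff_fst).prodMk contMDiff_snd)
    · exact B.smooth_smul.comp ((h3.comp contMDiff_fst).prodMk contMDiff_snd)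
    · exact smul_comm _ _ _⟩

theorem contMDiff_coe_mul_const (τ : ℝ) :
    ContMDiff (𝓡∂ 1) 𝓘(ℝ, ℝ) ∞ (fun t : unitInterval => (t : ℝ) * τ) :=
  contMDiff_subtypeVal_Icc.mul contMDiff_const

theorem circlePath_eq_anglePath (τ : ℝ) : B.circlePath τ =
    B.anglePath (fun t => t * τ) (contMDiff_coe_mul_const τ) (by simp) := rfl

theorem circlePath_add (τ τ' : ℝ) : B.circlePath (τ + τ') = B.circlePath τ * B.circlePath τ' := by
  refine Subtype.ext (funext fun t => Equiv.ext fun p => ?_)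
  change Circle.exp (t * (τ + τ')) • p = Circle.exp (t * τ) • Circle.exp (t * τ') • p
  rw [mul_add, Circle.exp_add, mul_smul]

theorem circlePath_mul_comm (τ : ℝ) (γ : B.PreqPath) :
    B.circlePath τ * γ = γ * B.circlePath τ := by
  refine Subtype.ext (funext fun t => Equiv.ext fun p => ?_)
  exact (γ.2.2.2.2 t (Circle.exp (t * τ)) p).symm

theorem pathDeriv_mul_const (τ : ℝ) (t : unitInterval) :
    (pathDeriv (fun t : unitInterval => (t : ℝ) * τ) t : ℝ) = τ := by
  refine pathDeriv_eq_of_hasDerivWithinAt ?_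
  have h1 : HasDerivWithinAt (fun r : ℝ => r * τ) τ (Icc 0 1) (t : ℝ) := by
    simpa using ((hasDerivAt_id (t : ℝ)).mul_const τ).hasDerivWithinAt
  refine h1.congr_of_mem (fun r hr => ?_) t.2
  simp [projIcc_of_mem zero_le_one hr]

theorem isHamiltonianOf_anglePath {θ : unitInterval → ℝ} (hθ : ContMDiff (𝓡∂ 1) 𝓘(ℝ, ℝ) ∞ θ)
    (h0 : θ 0 = 0) :
    B.IsHamiltonianOf (fun q => -pathDeriv (F := ℝ) θ q.1) (B.anglePath θ hθ h0) := by
  refine isHamiltonianOf_iff.2 ⟨?_, fun t p => ?_⟩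
  · have h1 := contMDiff_pathDeriv (J := 𝓘(ℝ, ℝ)) (N := ℝ)
      (hθ.comp (contMDiff_fst (I := 𝓡∂ 1) (J := 𝓘(ℝ, ℝ)) (M := unitInterval) (N := ℝ)))
    exact (h1.comp (f := fun q : unitInterval × M => (q.1, (0 : ℝ)))
      (contMDiff_fst.prodMk contMDiff_const)).neg
  · have hc : MDifferentiableAt (𝓡∂ 1) 𝓟 (fun _ : unitInterval => p) t := mdifferentiableAt_const
    have hθt : MDifferentiableAt (𝓡∂ 1) 𝓘(ℝ, ℝ) θ t := (hθ t).mdifferentiableAt (by simp)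
    have hs : ContMDiff (𝓡∂ 1) 𝓟 ∞ (fun t => Circle.exp (θ t) • p) :=
      B.smooth_smul.comp ((contMDiff_circleExp.comp hθ).prodMk contMDiff_const)
    refine hamiltonianAt_of_comp_proj (c := fun t => Circle.exp (θ t) • p)
      (d := fun _ => B.proj p) ((hs t).mdifferentiableAt (by simp)) (fun t => B.proj_smul _ _)
      ?_ fun w => ?_
    · refine (B.α_unitDeriv_exp_smul t hθt hc).trans ?_
      rw [unitDeriv_const]
      have h2 : B.α p ![(0 : TangentSpace 𝓟 p)] = 0 := (linOf (B.α p)).map_zero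
      rw [h2, add_zero, neg_neg]
    · have h1 : differential 𝓜 (fun _ : M => -pathDeriv (F := ℝ) θ t) (B.proj p) w = 0 := by
        have : mfderiv 𝓜 𝓘(ℝ, ℝ) (fun _ : M => -pathDeriv (F := ℝ) θ t) (B.proj p) = 0 :=
          mfderiv_const
        exact DFunLike.congr_fun this w
      rw [unitDeriv_const]
      have h2 : Ω.form (B.proj p) ![(0 : TangentSpace 𝓜 (B.proj p)), w] = 0 :=
        (Ω.form (B.proj p)).map_coord_zero 0 rfl
      exact (congrArg₂ (· + ·) h2 h1).trans (add_zero 0)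

/-- Paths of rotations with the same endpoint are homotopic. -/
theorem preqClass_anglePath {θ : unitInterval → ℝ} (hθ : ContMDiff (𝓡∂ 1) 𝓘(ℝ, ℝ) ∞ θ)
    (h0 : θ 0 = 0) : B.preqClass (B.anglePath θ hθ h0) = B.preqClass (B.circlePath (θ 1)) := by
  have hs : ContMDiff ((𝓡∂ 1).prod (𝓡∂ 1)) 𝓘(ℝ, ℝ) ∞ (fun q : unitInterval × unitInterval =>
      (1 - (q.1 : ℝ)) * θ q.2 + q.1 * (q.2 * θ 1)) := by
    have h1 : ContMDiff (𝓡∂ 1) 𝓘(ℝ, ℝ) ∞ (fun t : unitInterval => (t : ℝ)) :=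
      contMDiff_subtypeVal_Icc
    exact ((contMDiff_const.sub (h1.comp contMDiff_fst)).mul (hθ.comp contMDiff_snd)).add
      ((h1.comp contMDiff_fst).mul ((h1.comp contMDiff_snd).mul contMDiff_const))
  -- Affine interpolation between the given angle and the uniform one. Interpolating in the angles,
  -- not in the circle, keeps both end angles fixed.
  refine (Con.eq _).2 ⟨fun s => B.anglePath
    (fun t => (1 - (s : ℝ)) * θ t + s * (t * θ 1))
    (hs.comp (f := fun t : unitInterval => (s, t)) (contMDiff_const.prodMk contMDiff_id))
    (by simp [h0]), ⟨?_, ?_⟩, ?_, ?_, fun s => ⟨?_, ?_⟩⟩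
  · exact B.smooth_smul.comp
      ((contMDiff_circleExp.comp (hs.comp contMDiff_fst)).prodMk contMDiff_snd)
  · have h1 : ContMDiff (((𝓡∂ 1).prod (𝓡∂ 1)).prod 𝓟) 𝓟 ∞
        (fun q : (unitInterval × unitInterval) × P =>
          Circle.exp (-((1 - (q.1.1 : ℝ)) * θ q.1.2 + q.1.1 * (q.1.2 * θ 1))) • q.2) :=
      B.smooth_smul.comp
        ((contMDiff_circleExp.comp (hs.comp contMDiff_fst).neg).prodMk contMDiff_snd)
    refine h1.congr fun q => ?_
    rw [Circle.exp_neg]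
    rfl
  · refine Subtype.ext (funext fun t => Equiv.ext fun p => ?_)
    change Circle.exp ((1 - ((0 : unitInterval) : ℝ)) * θ t +
      ((0 : unitInterval) : ℝ) * (t * θ 1)) • p
      = Circle.exp (θ t) • p
    simp
  · refine Subtype.ext (funext fun t => Equiv.ext fun p => ?_)
    change Circle.exp ((1 - ((1 : unitInterval) : ℝ)) * θ t +
      ((1 : unitInterval) : ℝ) * (t * θ 1)) • p
      = Circle.exp (t * θ 1) • p
    simp
  · exact (B.anglePath _ _ _).2.1.trans (B.anglePath _ _ _).2.1.symm
  · refine Equiv.ext fun p => ?_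
    change Circle.exp ((1 - (s : ℝ)) * θ 1 + s * (((1 : unitInterval) : ℝ) * θ 1)) • p
      = Circle.exp (θ 1) • p
    congr 2
    simp
    ring

end Angle

theorem Lifts.mul {γ γ' : B.PreqPath} {φ φ' : Ω.HamPath} (h : B.Lifts γ φ) (h' : B.Lifts γ' φ') :
    B.Lifts (γ * γ') (φ * φ') := fun t p =>
  (h t (γ'.1 t p)).trans (congrArg (φ.1 t) (h' t p))

/-- A family of elements of `P(Preq)` from a homotopy. -/
theorem isPreqFamily_of_homotopy {Γ : unitInterval → B.PreqPath}
    (h : IsSmoothFamily 𝓟 ((𝓡∂ 1).prod (𝓡∂ 1))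
      (fun q : unitInterval × unitInterval => (Γ q.1).1 q.2)) :
    B.IsPreqFamily ((𝓡∂ 1).prod (𝓡∂ 1))
      (fun q : unitInterval × unitInterval => (Γ q.2).1 q.1) :=
  ⟨h.comp contMDiff_swap_unitInterval, fun q => (Γ q.2).2.2.2.1 q.1,
    fun q => (Γ q.2).2.2.2.2 q.1⟩

variable [IsManifold (𝓡 (2 * n)) ∞ M] [IsManifold (𝓡 (2 * n + 1)) ∞ P]

/-- By the product rule for velocities: since `γ` preserves α, the α components add, the second
Hamiltonian being transported to the moving point. The equation on the base is `Generates.mul`. -/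
theorem IsHamiltonianOf.mul {γ γ' : B.PreqPath} {φ φ' : Ω.HamPath} (hl : B.Lifts γ φ)
    (hl' : B.Lifts γ' φ') {f f' : unitInterval × M → ℝ} (h : B.IsHamiltonianOf f γ)
    (h' : B.IsHamiltonianOf f' γ') :
    B.IsHamiltonianOf (fun q => f q + f' (q.1, (φ.1 q.1)⁻¹ q.2)) (γ * γ') := by
  have hg := (generates_of_hamiltonianAt (isPreqFamily_path γ).smooth hl
    (isHamiltonianOf_iff.1 h).1 (isHamiltonianOf_iff.1 h).2).mul
    (generates_of_hamiltonianAt (isPreqFamily_path γ').smooth hl'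
      (isHamiltonianOf_iff.1 h').1 (isHamiltonianOf_iff.1 h').2) φ.2.2.1 φ'.2.2.1 φ.2.2.2.1
  refine isHamiltonianOf_iff.2 ⟨hg.1, fun t p => ?_⟩
  have hc : ContMDiff (𝓡∂ 1) 𝓟 ∞ (fun t => (γ * γ').1 t p) :=
    (isPreqFamily_path (γ * γ')).smooth.1.comp (contMDiff_id.prodMk contMDiff_const)
  refine hamiltonianAt_of_comp_proj (c := fun t => (γ * γ').1 t p)
    (d := fun t => (φ.1 * φ'.1) t (B.proj p)) ((hc t).mdifferentiableAt (by simp))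
    (fun t => hl.mul hl' t p) ?_ (hg.2 t (B.proj p))
  have e1 := velocity_mul (isPreqFamily_path γ).smooth (isPreqFamily_path γ').smooth t p
  have e2 := ((isHamiltonianOf_iff.1 h).2 t (γ'.1 t p)).1
  have e3 := ((isHamiltonianOf_iff.1 h').2 t p).1
  have e4 := (γ.2.2.2.1 t).apply_one (γ'.1 t p) (velocity 𝓟 γ'.1 t p)
  have e5 : B.α (γ.1 t (γ'.1 t p)) ![velocity 𝓟 (γ.1 * γ'.1) t p] =
      B.α (γ.1 t (γ'.1 t p)) ![velocity 𝓟 γ.1 t (γ'.1 t p)] +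
      B.α (γ.1 t (γ'.1 t p)) ![mfderiv 𝓟 𝓟 (γ.1 t) (γ'.1 t p) (velocity 𝓟 γ'.1 t p)] :=
    (congrArg (fun v => B.α (γ.1 t (γ'.1 t p)) ![v]) e1).trans
      (oneForm_add (B.α (γ.1 t (γ'.1 t p))) _ _)
  rw [e4] at e5
  refine e5.trans ((congrArg₂ (· + ·) e2 e3).trans ?_)
  have h1 : B.proj (γ.1 t (γ'.1 t p)) = φ.1 t (φ'.1 t (B.proj p)) := hl.mul hl' t p
  have h2 := hl' t p
  have h3 : (φ.1 t)⁻¹ (φ.1 t (φ'.1 t (B.proj p))) = φ'.1 t (B.proj p) := by simp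
  simp only [h1, h2, h3, Pi.mul_apply, Equiv.Perm.mul_apply]
  ring

variable [T2Space M] [CompactSpace M] [ConnectedSpace M] [MeasurableSpace M] [BorelSpace M]

/-! ### The four morphisms and the two isomorphisms -/

section Maps

/-- The path of `Ham` lifted by a path of `Preq`. -/
def basePath : B.PreqPath →* Ω.HamPath where
  toFun γ := (existsUnique_lifts γ).choose
  map_one' := ((existsUnique_lifts (1 : B.PreqPath)).choose_spec.2 1 fun _ _ => rfl).symm
  map_mul' γ γ' := ((existsUnique_lifts (γ * γ')).choose_spec.2 _
    ((existsUnique_lifts γ).choose_spec.1.mul (existsUnique_lifts γ').choose_spec.1)).symm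

theorem lifts_basePath (γ : B.PreqPath) : B.Lifts γ (basePath γ) :=
  (existsUnique_lifts γ).choose_spec.1

theorem Lifts.basePath_eq {γ : B.PreqPath} {φ : Ω.HamPath} (h : B.Lifts γ φ) : basePath γ = φ :=
  (existsUnique_lifts γ).unique (lifts_basePath γ) h

theorem smoothlyHomotopic_basePath {γ γ' : B.PreqPath}
    (h : SmoothlyHomotopic 𝓟 B.PreqPath γ γ') :
    SmoothlyHomotopic 𝓜 Ω.HamPath (basePath γ) (basePath γ') := by
  obtain ⟨Γ, hs, h0, h1, he⟩ := h
  obtain ⟨φ, hφ, -, hl⟩ := (isPreqFamily_of_homotopy hs).exists_descent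
  have hΓ : ∀ s t, (basePath (Γ s)).1 t = φ (t, s) := by
    intro s t
    ext x
    obtain ⟨p, rfl⟩ := B.proj_surjective x
    exact (lifts_basePath (Γ s) t p).symm.trans (hl (t, s) p)
  have hb : ∀ {γ γ' : B.PreqPath} {t}, γ.1 t = γ'.1 t → (basePath γ).1 t = (basePath γ').1 t := by
    intro γ γ' t h
    ext x
    obtain ⟨p, rfl⟩ := B.proj_surjective x
    rw [← lifts_basePath γ, ← lifts_basePath γ', h]
  refine ⟨fun s => basePath (Γ s), ?_, congrArg basePath h0, congrArg basePath h1,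
    fun s => ⟨hb (he s).1, hb (he s).2⟩⟩
  have h2 := hφ.comp contMDiff_swap_unitInterval
  simpa only [hΓ] using h2

/-- The morphism `π`. -/
def coverProj : B.PreqCover →* Ω.HamCover :=
  Con.lift _ (Ω.hamClass.comp basePath) fun _ _ h =>
    (Con.eq _).2 (smoothlyHomotopic_basePath h)

theorem coverProj_preqClass (γ : B.PreqPath) :
    coverProj (B.preqClass γ) = Ω.hamClass (basePath γ) := rfl

/-- The generating Hamiltonian of a path. -/
def hamiltonian (γ : B.PreqPath) : unitInterval × M → ℝ := (existsUnique_isHamiltonianOf γ).choose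

theorem isHamiltonianOf_hamiltonian (γ : B.PreqPath) : B.IsHamiltonianOf (hamiltonian γ) γ :=
  (existsUnique_isHamiltonianOf γ).choose_spec.1

theorem IsHamiltonianOf.eq_hamiltonian {γ : B.PreqPath} {f : unitInterval × M → ℝ}
    (h : B.IsHamiltonianOf f γ) : f = hamiltonian γ :=
  (existsUnique_isHamiltonianOf γ).unique h (isHamiltonianOf_hamiltonian γ)

theorem contMDiff_mean (γ : B.PreqPath) : ContMDiff (𝓡∂ 1) 𝓘(ℝ, ℝ) ∞
    (fun t => ∫ x, hamiltonian γ (t, x) ∂Ω.liouville) := by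
  have := ChartedSpace.secondCountable_of_sigmaCompact (EuclideanSpace ℝ (Fin (2 * n))) M
  exact contMDiff_integral (F := ℝ) (J := 𝓜) Ω.liouville (isHamiltonianOf_hamiltonian γ).1

theorem hamiltonian_mul (γ γ' : B.PreqPath) : hamiltonian (γ * γ') =
    fun q => hamiltonian γ q + hamiltonian γ' (q.1, ((basePath γ).1 q.1)⁻¹ q.2) :=
  (IsHamiltonianOf.mul (lifts_basePath γ) (lifts_basePath γ') (isHamiltonianOf_hamiltonian γ)
    (isHamiltonianOf_hamiltonian γ')).eq_hamiltonian.symm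

/-- The transported term has the same integral because the base path is symplectic. This additivity
makes both the Calabi integral and the normalised lift morphisms. -/
theorem mean_hamiltonian_mul (γ γ' : B.PreqPath) (t : unitInterval) :
    ∫ x, hamiltonian (γ * γ') (t, x) ∂Ω.liouville =
      ∫ x, hamiltonian γ (t, x) ∂Ω.liouville + ∫ x, hamiltonian γ' (t, x) ∂Ω.liouville := by
  have := ChartedSpace.secondCountable_of_sigmaCompact (EuclideanSpace ℝ (Fin (2 * n))) M
  have hi : ∀ γ : B.PreqPath, Continuous (fun x => hamiltonian γ (t, x)) := fun γ =>
    (isHamiltonianOf_hamiltonian γ).1.continuous.comp (by fun_prop : Continuous fun x => (t, x))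
  have hφ := (basePath γ).2.2.1.inv
  have h1 := SymplecticForm.integral_comp_liouville hφ
    (basePath γ)⁻¹.2.2.2.1 t (fun x => hamiltonian γ' (t, x))
  have hc : Continuous (((basePath γ).1 t)⁻¹ : Equiv.Perm M) :=
    hφ.1.continuous.comp (by fun_prop : Continuous fun x : M => (t, x))
  rw [hamiltonian_mul]
  exact (integral_add (integrable_of_continuous_compactSpace _ (hi γ))
    (integrable_of_continuous_compactSpace _ ((hi γ').comp hc))).trans (congrArg _ h1)

/-- The Calabi invariant of a path. -/
def calabi : B.PreqPath →* Multiplicative ℝ :=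
  MonoidHom.mk' (fun γ => Multiplicative.ofAdd
    (∫ t : unitInterval, ∫ x, hamiltonian γ (t, x) ∂Ω.liouville)) fun γ γ' => by
    have hi : ∀ γ : B.PreqPath, Integrable
        (fun t : unitInterval => ∫ x, hamiltonian γ (t, x) ∂Ω.liouville) := fun γ =>
      integrable_of_continuous_compactSpace _ (contMDiff_mean γ).continuous
    simp only [mean_hamiltonian_mul]
    rw [integral_add (hi γ) (hi γ'), ofAdd_add]

theorem calabi_eq_of_smoothlyHomotopic {γ γ' : B.PreqPath}
    (h : SmoothlyHomotopic 𝓟 B.PreqPath γ γ') : calabi γ = calabi γ' := by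
  obtain ⟨Γ, hs, h0, h1, he⟩ := h
  have hG := isPreqFamily_of_homotopy hs
  obtain ⟨f, hfs, hf⟩ := hG.exists_hamiltonian
  have h2 := hG.integral_integral_eq (fun s => (he s).1.trans (he 0).1.symm)
    (fun s => (he s).2.trans (he 0).2.symm) hfs hf
  have h3 : ∀ s, (fun q : unitInterval × M => f ((q.1, s), q.2)) = hamiltonian (Γ s) := by
    intro s
    refine IsHamiltonianOf.eq_hamiltonian (isHamiltonianOf_iff.2 ⟨?_, fun t p => hf t s p⟩)
    exact hfs.comp ((contMDiff_fst.prodMk contMDiff_const).prodMk contMDiff_snd)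
  refine congrArg Multiplicative.ofAdd ?_
  rw [← h0, ← h1, ← h3 0, ← h3 1]
  exact h2

/-- The morphism `Cal`. -/
def coverCalabi : B.PreqCover →* Multiplicative ℝ :=
  Con.lift _ calabi fun _ _ h => calabi_eq_of_smoothlyHomotopic h

theorem coverCalabi_preqClass (γ : B.PreqPath) : coverCalabi (B.preqClass γ) =
    Multiplicative.ofAdd (∫ t : unitInterval, ∫ x, hamiltonian γ (t, x) ∂Ω.liouville) := rfl

theorem isNormalised_iff {γ : B.PreqPath} :
    B.IsNormalised γ ↔ ∀ t, ∫ x, hamiltonian γ (t, x) ∂Ω.liouville = 0 := by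
  constructor
  · rintro ⟨f, hf, h⟩
    rwa [← hf.eq_hamiltonian]
  · exact fun h => ⟨_, isHamiltonianOf_hamiltonian γ, h⟩

variable (B) in
/-- The normalised lift of a path. -/
def normalisedLift : Ω.HamPath →* B.PreqPath :=
  MonoidHom.mk' (fun φ => (B.existsUnique_normalised_lift φ).choose) fun φ φ' => by
    have h1 := (B.existsUnique_normalised_lift φ).choose_spec.1
    have h2 := (B.existsUnique_normalised_lift φ').choose_spec.1
    refine ((B.existsUnique_normalised_lift (φ * φ')).choose_spec.2 _
      ⟨h1.1.mul h2.1, isNormalised_iff.2 fun t => ?_⟩).symm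
    rw [mean_hamiltonian_mul, isNormalised_iff.1 h1.2, isNormalised_iff.1 h2.2, add_zero]

theorem normalisedLift_spec (φ : Ω.HamPath) :
    B.Lifts (B.normalisedLift φ) φ ∧ B.IsNormalised (B.normalisedLift φ) :=
  (B.existsUnique_normalised_lift φ).choose_spec.1

theorem eq_normalisedLift {φ : Ω.HamPath} {γ : B.PreqPath} (hl : B.Lifts γ φ)
    (hn : B.IsNormalised γ) : γ = B.normalisedLift φ :=
  (B.existsUnique_normalised_lift φ).unique ⟨hl, hn⟩ (normalisedLift_spec φ)

/-- The normalised lifts of all stages of the homotopy form one smooth family by uniqueness, and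
`IsPreqFamily.eq_of_normalised` keeps their endpoint in `P` fixed. -/
theorem smoothlyHomotopic_normalisedLift {φ φ' : Ω.HamPath}
    (h : SmoothlyHomotopic 𝓜 Ω.HamPath φ φ') :
    SmoothlyHomotopic 𝓟 B.PreqPath (B.normalisedLift φ) (B.normalisedLift φ') := by
  obtain ⟨Φ, hs, h0, h1, he⟩ := h
  obtain ⟨G, f, hG, hG0, hGp, hfs, hGh, hn⟩ := B.exists_normalised_preqFamily
    (φ := fun q : unitInterval × unitInterval => (Φ q.2).1 q.1)
    (hs.comp contMDiff_swap_unitInterval) (fun s => (Φ s).2.1) (fun s => (Φ s).2.2.2.2)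
  have hGs : ∀ s t, (B.normalisedLift (Φ s)).1 t = G (t, s) := by
    intro s
    have hu : ContMDiff (𝓡∂ 1) ((𝓡∂ 1).prod (𝓡∂ 1)) ∞
        (fun t : unitInterval => (t, s)) := contMDiff_id.prodMk contMDiff_const
    have hG' := hG.comp hu
    let γ : B.PreqPath := ⟨fun t => G (t, s), hG0 s, hG'.smooth, hG'.preserves, hG'.equivariant⟩
    have hγ : B.IsNormalised γ := by
      refine ⟨fun q => f ((q.1, s), q.2), isHamiltonianOf_iff.2 ⟨?_, fun t p => hGh t s p⟩,
        fun t => hn (t, s)⟩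
      exact hfs.comp ((hu.comp contMDiff_fst).prodMk contMDiff_snd)
    have h2 : γ = B.normalisedLift (Φ s) := eq_normalisedLift (fun t p => hGp (t, s) p) hγ
    intro t
    rw [← h2]
  have hend := hG.eq_of_normalised hG0 (fun s p => by
    rw [hGp, hGp, (he s).2, (he 0).2]) hfs hGh hn
  refine ⟨fun s => B.normalisedLift (Φ s), ?_, congrArg B.normalisedLift h0,
    congrArg B.normalisedLift h1, fun s => ⟨?_, ?_⟩⟩
  · have h2 := hG.smooth.comp contMDiff_swap_unitInterval
    simpa only [hGs] using h2
  · rw [(B.normalisedLift (Φ s)).2.1, (B.normalisedLift φ).2.1]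
  · rw [← h0, hGs, hGs, hend]

variable (B) in
/-- The morphism `L`. -/
def coverLift : Ω.HamCover →* B.PreqCover :=
  Con.lift _ (B.preqClass.comp B.normalisedLift) fun _ _ h =>
    (Con.eq _).2 (smoothlyHomotopic_normalisedLift h)

theorem coverLift_hamClass (φ : Ω.HamPath) :
    B.coverLift (Ω.hamClass φ) = B.preqClass (B.normalisedLift φ) := rfl

variable (B) in
/-- The morphism `R`. -/
def coverCircle : Multiplicative ℝ →* B.PreqCover :=
  B.preqClass.comp (MonoidHom.mk' (fun τ => B.circlePath τ.toAdd) fun τ τ' =>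
    B.circlePath_add τ.toAdd τ'.toAdd)

theorem coverCircle_ofAdd (τ : ℝ) :
    B.coverCircle (Multiplicative.ofAdd τ) = B.preqClass (B.circlePath τ) := rfl

theorem preqClass_surjective : Function.Surjective B.preqClass := Con.mk'_surjective

theorem hamClass_surjective : Function.Surjective Ω.hamClass := Con.mk'_surjective

/-- Rotations commute with equivariant maps. Centrality is what makes the product of the lift and
the rotation a group morphism. -/
theorem coverCircle_comm (τ : Multiplicative ℝ) (g : B.PreqCover) :
    B.coverCircle τ * g = g * B.coverCircle τ := by
  obtain ⟨γ, rfl⟩ := preqClass_surjective g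
  change B.preqClass _ * B.preqClass _ = B.preqClass _ * B.preqClass _
  rw [← map_mul, ← map_mul]
  exact congrArg _ (circlePath_mul_comm τ.toAdd γ)

theorem hamiltonian_circlePath (τ : ℝ) : hamiltonian (B.circlePath τ) = fun _ => -τ := by
  rw [circlePath_eq_anglePath, ← (isHamiltonianOf_anglePath _ _).eq_hamiltonian]
  funext q
  rw [pathDeriv_mul_const]

theorem coverProj_coverCircle (τ : Multiplicative ℝ) : coverProj (B.coverCircle τ) = 1 := by
  have h1 : basePath (B.circlePath τ.toAdd) = 1 :=
    Lifts.basePath_eq fun t p => B.proj_smul _ _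
  change Ω.hamClass (basePath (B.circlePath τ.toAdd)) = 1
  rw [h1, map_one]

theorem coverCalabi_coverCircle (τ : ℝ) : coverCalabi (B.coverCircle (Multiplicative.ofAdd τ)) =
    Multiplicative.ofAdd (-(Ω.liouville.real univ * τ)) := by
  rw [coverCircle_ofAdd, coverCalabi_preqClass, hamiltonian_circlePath]
  simp

theorem coverProj_coverLift (h : Ω.HamCover) : coverProj (B.coverLift h) = h := by
  obtain ⟨φ, rfl⟩ := hamClass_surjective h
  rw [coverLift_hamClass, coverProj_preqClass, (normalisedLift_spec φ).1.basePath_eq]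

theorem coverCalabi_coverLift (h : Ω.HamCover) : coverCalabi (B.coverLift h) = 1 := by
  obtain ⟨φ, rfl⟩ := hamClass_surjective h
  rw [coverLift_hamClass, coverCalabi_preqClass]
  simp only [isNormalised_iff.1 (normalisedLift_spec φ).2, integral_zero, ofAdd_zero]

/-- Every class is the product of a normalised class and a rotation. -/
theorem exists_eq_coverLift_mul_coverCircle (g : B.PreqCover) :
    ∃ h τ, B.coverLift h * B.coverCircle τ = g := by
  obtain ⟨γ, rfl⟩ := preqClass_surjective g
  -- A rotation with angular speed `m` has Hamiltonian `-m`, which cancels the mean of the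
  -- Hamiltonian of `γ`; hence `γ * δ` is normalised, with the same base path as `γ`.
  set m : unitInterval → ℝ := fun t =>
    (Ω.liouville.real univ)⁻¹ * ∫ x, hamiltonian γ (t, x) ∂Ω.liouville
  have hm : ContMDiff (𝓡∂ 1) 𝓘(ℝ, ℝ) ∞ m := contMDiff_const.mul (contMDiff_mean γ)
  set η : unitInterval → ℝ := fun t => ∫ r in (0 : ℝ)..t, m (projIcc 0 1 zero_le_one r)
  have hη : ContMDiff (𝓡∂ 1) 𝓘(ℝ, ℝ) ∞ η := by
    have h1 := contMDiff_primitive (I := 𝓘(ℝ, ℝ)) (T := ℝ)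
      (hm.comp (contMDiff_fst (I := 𝓡∂ 1) (J := 𝓘(ℝ, ℝ)) (M := unitInterval) (N := ℝ)))
    exact h1.comp (f := fun t : unitInterval => (t, (0 : ℝ)))
      (contMDiff_id.prodMk contMDiff_const)
  have hη0 : η 0 = 0 := by simp [η]
  set δ := B.anglePath η hη hη0
  have hδ : B.Lifts δ 1 := fun t p => B.proj_smul _ _
  have hN : γ * δ = B.normalisedLift (basePath γ) := by
    refine eq_normalisedLift ?_ (isNormalised_iff.2 fun t => ?_)
    · have := (lifts_basePath γ).mul hδ
      rwa [mul_one] at this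
    · rw [mean_hamiltonian_mul, ← (isHamiltonianOf_anglePath hη hη0).eq_hamiltonian]
      have h1 : (pathDeriv (F := ℝ) η t) = m t := pathDeriv_integral hm.continuous t
      simp only [h1]
      rw [integral_const, smul_eq_mul]
      simp only [m]
      rw [mul_neg, mul_inv_cancel_left₀ Ω.liouville_real_univ_pos.ne', add_neg_cancel]
  -- The correction `δ` is undone by its inverse; only its total angle `η 1` matters for its class.
  refine ⟨Ω.hamClass (basePath γ), (Multiplicative.ofAdd (η 1))⁻¹, ?_⟩
  rw [coverLift_hamClass, ← hN, map_inv, coverCircle_ofAdd, map_mul, preqClass_anglePath,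
    mul_inv_cancel_right]

/-- The morphism `(π, Cal)`. -/
def projCalabi : B.PreqCover →* Ω.HamCover × Multiplicative ℝ := coverProj.prod coverCalabi

variable (B) in
/-- The morphism `(h, τ) ↦ L(h) R(τ)`. -/
def liftMulCircle : Ω.HamCover × Multiplicative ℝ →* B.PreqCover :=
  B.coverLift.noncommCoprod B.coverCircle fun _ τ => (coverCircle_comm τ _).symm

theorem projCalabi_liftMulCircle (h : Ω.HamCover) (τ : ℝ) :
    projCalabi (B.liftMulCircle (h, Multiplicative.ofAdd τ)) =
      (h, Multiplicative.ofAdd (-(Ω.liouville.real univ * τ))) := by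
  refine (map_mul projCalabi (B.coverLift h) (B.coverCircle (Multiplicative.ofAdd τ))).trans
    (Prod.ext ?_ ?_)
  · change coverProj _ * coverProj _ = h
    rw [coverProj_coverLift, coverProj_coverCircle, mul_one]
  · change coverCalabi _ * coverCalabi _ = _
    rw [coverCalabi_coverLift, coverCalabi_coverCircle, one_mul]

theorem projCalabi_liftMulCircle_div (h : Ω.HamCover) (τ : ℝ) :
    projCalabi (B.liftMulCircle (h, Multiplicative.ofAdd (-τ / Ω.liouville.real univ))) =
      (h, Multiplicative.ofAdd τ) := by
  rw [projCalabi_liftMulCircle, mul_div_cancel₀ _ Ω.liouville_real_univ_pos.ne', neg_neg]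

/-- The composite is the identity on the first factor and multiplication by minus the volume, which
is nonzero, on the second. -/
theorem injective_projCalabi_comp_liftMulCircle :
    Function.Injective (projCalabi ∘ B.liftMulCircle) := by
  rintro ⟨h, τ⟩ ⟨h', τ'⟩ e
  have e' := ((projCalabi_liftMulCircle h τ.toAdd).symm.trans e).trans
    (projCalabi_liftMulCircle h' τ'.toAdd)
  obtain ⟨e1, e2⟩ := Prod.ext_iff.1 e'
  refine Prod.ext e1 (Multiplicative.toAdd.injective ?_)
  exact mul_left_cancel₀ Ω.liouville_real_univ_pos.ne'
    (neg_injective (Multiplicative.ofAdd.injective e2))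

theorem bijective_liftMulCircle : Function.Bijective B.liftMulCircle := by
  refine ⟨injective_projCalabi_comp_liftMulCircle.of_comp, fun g => ?_⟩
  obtain ⟨h, τ, e⟩ := exists_eq_coverLift_mul_coverCircle g
  exact ⟨(h, τ), e⟩

/-- Injectivity passes from the composite to its left factor because the right factor is onto;
surjectivity uses the rescaled preimage. -/
theorem bijective_projCalabi : Function.Bijective (projCalabi (B := B)) :=
  ⟨injective_projCalabi_comp_liftMulCircle.of_comp_right bijective_liftMulCircle.2,
    fun q => ⟨_, projCalabi_liftMulCircle_div q.1 q.2.toAdd⟩⟩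

end Maps

end PrequantumBundle

end

end Prequantum

theorem mainTheorem9 {n : ℕ}
    {M : Type*} [TopologicalSpace M] [ChartedSpace (EuclideanSpace ℝ (Fin (2 * n))) M]
    [IsManifold (𝓡 (2 * n)) ∞ M] [T2Space M] [CompactSpace M] [ConnectedSpace M]
    [MeasurableSpace M] [BorelSpace M]
    {P : Type*} [TopologicalSpace P] [ChartedSpace (EuclideanSpace ℝ (Fin (2 * n + 1))) P]
    [IsManifold (𝓡 (2 * n + 1)) ∞ P] [T2Space P] [MulAction Circle P]
    (Ω : Prequantum.SymplecticForm n M) (B : Prequantum.PrequantumBundle Ω P) :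
    -- every path of `Preq` lifts a unique path of `Ham`
    (∀ γ : B.PreqPath, ∃! φ : Ω.HamPath, B.Lifts γ φ) ∧
    -- every path of `Preq` has a unique generating Hamiltonian
    (∀ γ : B.PreqPath, ∃! f : unitInterval × M → ℝ, B.IsHamiltonianOf f γ) ∧
    -- every path of `Ham` has a unique lift with normalised generating Hamiltonian
    (∀ φ : Ω.HamPath, ∃! γ : B.PreqPath, B.Lifts γ φ ∧ B.IsNormalised γ) ∧
    -- the group morphisms `π`, `Cal`, `L`, `R`
    ∃ (π : B.PreqCover →* Ω.HamCover) (Cal : B.PreqCover →* Multiplicative ℝ)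
      (L : Ω.HamCover →* B.PreqCover) (R : Multiplicative ℝ →* B.PreqCover),
      (∀ (γ : B.PreqPath) (φ : Ω.HamPath), B.Lifts γ φ →
        π (B.preqClass γ) = Ω.hamClass φ) ∧
      (∀ (γ : B.PreqPath) (f : unitInterval × M → ℝ), B.IsHamiltonianOf f γ →
        Cal (B.preqClass γ) =
          Multiplicative.ofAdd (∫ t : unitInterval, ∫ x, f (t, x) ∂Ω.liouville)) ∧
      (∀ (φ : Ω.HamPath) (γ : B.PreqPath), B.Lifts γ φ → B.IsNormalised γ →
        L (Ω.hamClass φ) = B.preqClass γ) ∧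
      (∀ τ : ℝ, R (Multiplicative.ofAdd τ) = B.preqClass (B.circlePath τ)) ∧
      -- `(π, Cal)` and `(h, τ) ↦ L(h) R(τ)` are group isomorphisms, inverse of each other
      -- up to the normalisation of the `ℝ` factor
      ∃ (Φ : B.PreqCover ≃* Ω.HamCover × Multiplicative ℝ)
        (Ψ : Ω.HamCover × Multiplicative ℝ ≃* B.PreqCover),
        (∀ g, Φ g = (π g, Cal g)) ∧
        (∀ h τ, Ψ (h, τ) = L h * R τ) ∧
        (∀ (h : Ω.HamCover) (τ : ℝ), Φ (Ψ (h, Multiplicative.ofAdd τ)) =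
          (h, Multiplicative.ofAdd (-(Ω.liouville.real Set.univ * τ)))) ∧
        (∀ (h : Ω.HamCover) (τ : ℝ), Φ.symm (h, Multiplicative.ofAdd τ) =
          L h * R (Multiplicative.ofAdd (-τ / Ω.liouville.real Set.univ))) := by
  open Prequantum PrequantumBundle in
  exact ⟨existsUnique_lifts, existsUnique_isHamiltonianOf, B.existsUnique_normalised_lift,
    coverProj, coverCalabi, B.coverLift, B.coverCircle,
    fun γ φ h => congrArg Ω.hamClass h.basePath_eq,
    fun γ f h => by rw [coverCalabi_preqClass, h.eq_hamiltonian],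
    fun φ γ h h' => congrArg B.preqClass (eq_normalisedLift h h').symm, fun τ => rfl,
    MulEquiv.ofBijective projCalabi bijective_projCalabi,
    MulEquiv.ofBijective B.liftMulCircle bijective_liftMulCircle,
    fun g => rfl, fun h τ => rfl, projCalabi_liftMulCircle,
    fun h τ => (MulEquiv.symm_apply_eq _).2 (projCalabi_liftMulCircle_div h τ).symm⟩
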